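/- All vector spaces are real and finite-dimensional. **Constant Courant algebroids.** A Courant algebroid structure on the trivial bundle $W_1\times W_0\to W_0$ consists of a smooth fibrewise nondegenerate symmetric bilinear form $\langle\cdot,\cdot\rangle$, a smooth bundle map (anchor) $\rho$ to $TW_0=W_0\times W_0$, and a bilinear bracket on smooth sections such that, for all sections $e_i$ and smooth functions $f$: (1) $[e_1,fe_2]=\rho(e_1)(f)e_2+f[e_1,e_2]$; (2) $\rho(e_1)\langle e_2,e_3\rangle=\langle[e_1,e_2],e_3\rangle+\langle e_2,[e_1,e_3]\rangle$; (3) $[[e_1,e_2],e_3]=[e_1,[e_2,e_3]]-[e_2,[e_1,e_3]]$; (4) $[e_1,e_2]+[e_2,e_1]=\mathcal D\langle e_1,e_2\rangle$, where $\langle\mathcal Df,e\rangle=\rho(e)(f)$. It is *constant* if the pairing and the anchor are independent of the basepoint and the bracket of constant sections vanishes. Isomorphisms of constant Courant algebroids are pairs of linear isomorphisms of $W_1$ and of $W_0$ preserving pairing, anchor and bracket. **Constant symplectic 2-groupoids.** A linear 2-groupoid is a simplicial vector space $V_\bullet$, with faces $f_i$ and degeneracies $\sigma_i$, whose horn maps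 $\lambda_{q,k}:V_q\to\Lambda_{q,k}V$ are surjective for $q\ge1$ and bijective for $q>2$. Put $\hat T_q=V_q/\sum_i\sigma_i(V_{q-1})$, and let $\partial:\hat T_1\to V_0$ be induced by $f_0-f_1$. A 2-form $\alpha$ on $V_q$ is multiplicative if $\delta\alpha=\sum_i(-1)^if_i^*\alpha=0$ and normalized if $\sigma_i^*\alpha=0$ for all $i$. A normalized 2-form $\omega$ on $V_2$ induces, at each $x\in V_0$, a pairing $A_\omega(v,w)=\omega(\sigma_0\sigma_0v,w)$ of $V_0$ with $\hat T_2$ and a symmetric form $B_\omega(\theta,\eta)=\omega(\sigma_1\theta,\sigma_0\eta)+\omega(\sigma_1\eta,\sigma_0\theta)$ on $\hat T_1$ (with $\omega$ evaluated at $\sigma_0\sigma_0x$); $\omega$ is simplicially nondegenerate if $A_\omega$ and $B_\omega$ are nondegenerate at all $x$. A constant symplectic 2-groupoid is a linear 2-groupoid $V_\bullet$ with a closed, multiplicative, normalized, simplicially nondegenerate 2-form $\omega$ on $V_2$ that is constant. Two such forms $\omega,\omega'$ on the same $V_\bullet$ are equivalent if $\omega'-\omega=\delta\alpha$ for a closed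 normalized (smooth, not necessarily constant) 2-form $\alpha$ on $V_1$ with $A_{\delta\alpha}=B_{\delta\alpha}=0$. Constant symplectic 2-groupoids $(V_\bullet,\omega)$, $(V'_\bullet,\omega')$ are equivalent if there is an isomorphism $\varphi:V_\bullet\to V'_\bullet$ of simplicial vector spaces such that $\omega$ is equivalent to $\varphi^*\omega'$. **Theorem 4.3.** There is a one-to-one correspondence between constant Courant algebroids and equivalence classes of constant symplectic 2-groupoids. Precisely: (a) Let $W_1,W_0$ be vector spaces. Then there are bijections between the following three sets: the constant Courant algebroid structures on $W_1\times W_0\to W_0$; the pairs $(\langle\cdot,\cdot\rangle,\partial)$ of a nondegenerate symmetric bilinear form on $W_1$ and a linear map $\partial:W_1\to W_0$ with $\partial\circ\partial^*=0$, where $\partial^*:W_0^*\to W_1^*\cong W_1$; and the constant symplectic 2-groupoids with given identifications $\hat T_1\cong W_1$, $V_0\cong W_0$, modulo equivalences that are compatible with these identifications. The first bijection sends a constant Courant algebroid to its pairing and its anchor; under the second, the pair $(\langle\cdot,\cdot\rangle,\partial)$ corresponds to the class of $(V_\bullet,\omega)$ if and only if the identifications carry $B_\omega$ (at every $x\in V_0$)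 to $\langle\cdot,\cdot\rangle$ and $\partial:\hat T_1\to V_0$ to $\partial$. (b) There is a bijection between isomorphism classes of constant Courant algebroids and equivalence classes of constant symplectic 2-groupoids, under which the class of $W_1\times W_0\to W_0$ corresponds to the class of $(V_\bullet,\omega)$ if and only if there are linear isomorphisms $\hat T_1\cong W_1$ and $V_0\cong W_0$ carrying $B_\omega$ to the pairing and $\partial$ to the anchor. -/

import Mathlib

open CategoryTheory Opposite
open scoped Simplicial

universe u

noncomputable section

namespace ConstantCourant

/-! ### Smooth maps and differential 2-forms on finite-dimensional real vector spaces

No norm is chosen on the vector spaces: a map `f : V → W` is smooth if all its components `ξ ∘ f`,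
for `ξ` a linear functional on `W`, are smooth functions of linear coordinates on `V`. -/

section Smooth

variable {V W V' : Type u} [AddCommGroup V] [Module ℝ V] [FiniteDimensional ℝ V]
  [AddCommGroup W] [Module ℝ W] [AddCommGroup V'] [Module ℝ V'] [FiniteDimensional ℝ V']

/-- The linear coordinates on `V` given by a basis. -/
def coords (V : Type u) [AddCommGroup V] [Module ℝ V] [FiniteDimensional ℝ V] :
    V ≃ₗ[ℝ] (Fin (Module.finrank ℝ V) → ℝ) :=
  (Module.finBasis ℝ V).equivFun

/-- A smooth real-valued function on the vector space `V`. -/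
def SmoothFun (f : V → ℝ) : Prop :=
  ContDiff ℝ (⊤ : ℕ∞) fun y => f ((coords V).symm y)

/-- A smooth map between vector spaces. -/
def SmoothMap (f : V → W) : Prop :=
  ∀ ξ : W →ₗ[ℝ] ℝ, SmoothFun fun x => ξ (f x)

theorem SmoothFun.const (c : ℝ) : SmoothFun (fun _ : V => c) := contDiff_const

theorem SmoothFun.add {f g : V → ℝ} (hf : SmoothFun f) (hg : SmoothFun g) :
    SmoothFun fun x => f x + g x := ContDiff.add hf hg

theorem SmoothFun.mul {f g : V → ℝ} (hf : SmoothFun f) (hg : SmoothFun g) :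
    SmoothFun fun x => f x * g x := ContDiff.mul hf hg

theorem SmoothFun.neg {f : V → ℝ} (hf : SmoothFun f) : SmoothFun fun x => -f x :=
  ContDiff.neg hf

theorem SmoothFun.comp_linear {f : V → ℝ} (hf : SmoothFun f) (L : V' →ₗ[ℝ] V) :
    SmoothFun fun x => f (L x) := by
  have h : ContDiff ℝ (⊤ : ℕ∞) (LinearMap.toContinuousLinearMap
      ((coords V).toLinearMap ∘ₗ L ∘ₗ (coords V').symm.toLinearMap)) :=
    ContinuousLinearMap.contDiff _
  have h2 := ContDiff.comp hf h
  refine (congrArg (ContDiff ℝ (⊤ : ℕ∞)) ?_).mp h2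
  funext y
  simp

theorem SmoothFun.lineDifferentiableAt {f : V → ℝ} (hf : SmoothFun f) (x v : V) :
    LineDifferentiableAt ℝ f x v := by
  have h : ContDiff ℝ (⊤ : ℕ∞) fun t : ℝ => coords V x + t • coords V v := by fun_prop
  have h2 := (ContDiff.comp hf h).differentiable (by simp)
  refine (congrArg (fun g => DifferentiableAt ℝ g (0 : ℝ)) ?_).mp (h2 0)
  funext t
  simp

/-- A smooth differential 2-form on the vector space `V`; the tangent space of `V` at every point
is identified with `V`. -/
def IsTwoForm (α : V → LinearMap.BilinForm ℝ V) : Prop :=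
  (∀ x, (α x).IsAlt) ∧ ∀ u v, SmoothFun fun x => α x u v

/-- `dα = 0`, where the exterior derivative is evaluated on constant vector fields. -/
def IsClosedForm (α : V → LinearMap.BilinForm ℝ V) : Prop :=
  ∀ x u v w, lineDeriv ℝ (fun y => α y v w) x u - lineDeriv ℝ (fun y => α y u w) x v
    + lineDeriv ℝ (fun y => α y u v) x w = 0

/-- The pullback of a 2-form along a linear map. -/
def pullback (L : V' →ₗ[ℝ] V) (α : V → LinearMap.BilinForm ℝ V) :
    V' → LinearMap.BilinForm ℝ V' :=
  fun x => (α (L x)).compl₁₂ L L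

end Smooth

/-! ### Simplicial vector spaces and linear 2-groupoids -/

section Simplicial

/-- A simplicial real vector space. -/
abbrev SVect := SimplicialObject (ModuleCat.{u} ℝ)

variable (X : SVect.{u})

/-- The face map `f_i : X_{q+1} → X_q`. -/
def face (q : ℕ) (i : Fin (q + 2)) : X _⦋q + 1⦌ →ₗ[ℝ] X _⦋q⦌ := (X.δ i).hom

/-- The degeneracy map `σ_i : X_q → X_{q+1}`. -/
def degen (q : ℕ) (i : Fin (q + 1)) : X _⦋q⦌ →ₗ[ℝ] X _⦋q + 1⦌ := (X.σ i).hom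

/-- The space of `(q + 1, k)`-horns: families of `q`-simplices `x_i`, `i ≠ k`, such that
`f_i x_j = f_{j-1} x_i` for `i < j`. For `q = 0` there is no condition. In the case `q + 1` below,
the pair of indices `i < j` is written as `i.castSucc < j.succ` with `i ≤ j`. -/
def hornSpace (q : ℕ) (k : Fin (q + 2)) : Submodule ℝ ({i : Fin (q + 2) // i ≠ k} → X _⦋q⦌) :=
  match q, k with
  | 0, _ => ⊤
  | q + 1, k =>
    { carrier := {x | ∀ (i j : Fin (q + 2)), i ≤ j → ∀ (hi : i.castSucc ≠ k) (hj : j.succ ≠ k),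
        face X q i (x ⟨j.succ, hj⟩) = face X q j (x ⟨i.castSucc, hi⟩)}
      add_mem' := by
        intro a b ha hb i j hij hi hj
        simp only [Pi.add_apply, map_add, ha i j hij hi hj, hb i j hij hi hj]
      zero_mem' := by
        intro i j _ _ _
        simp
      smul_mem' := by
        intro c a ha i j hij hi hj
        simp only [Pi.smul_apply, map_smul, ha i j hij hi hj] }

theorem face_face (q : ℕ) {i j : Fin (q + 2)} (h : i ≤ j) (x : X _⦋q + 2⦌) :
    face X q i (face X (q + 1) j.succ x) = face X q j (face X (q + 1) i.castSucc x) := by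
  have := X.δ_comp_δ h
  exact congrArg (fun g => g.hom x) this

theorem hornMap_mem (q : ℕ) (k : Fin (q + 2)) (x : X _⦋q + 1⦌) :
    (fun i : {i : Fin (q + 2) // i ≠ k} => face X q i.1 x) ∈ hornSpace X q k := by
  cases q with
  | zero => exact Submodule.mem_top
  | succ q => exact fun i j hij _ _ => face_face X q hij x

/-- The horn map `λ_{q+1,k} : X_{q+1} → Λ_{q+1,k} X`. -/
def hornMap (q : ℕ) (k : Fin (q + 2)) : X _⦋q + 1⦌ →ₗ[ℝ] hornSpace X q k :=
  LinearMap.codRestrict (hornSpace X q k) (LinearMap.pi fun i => face X q i.1) (hornMap_mem X q k)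

/-! ### The tangent complex

All tangent spaces of `X_q` are identified with `X_q`, so the tangent complex of `X` at any point
of `X_0` is the normalized chain complex of `X`. -/

/-- The sum of the degenerate subspaces of `X_{q+1}`. -/
def degenerate (q : ℕ) : Submodule ℝ (X _⦋q + 1⦌) :=
  ⨆ i : Fin (q + 1), LinearMap.range (degen X q i)

/-- The normalized tangent space in degree `q + 1`. -/
abbrev NormTangent (q : ℕ) := X _⦋q + 1⦌ ⧸ degenerate X q

/-- The alternating sum of the face maps. -/
def boundary (q : ℕ) : X _⦋q + 1⦌ →ₗ[ℝ] X _⦋q⦌ :=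
  ∑ i : Fin (q + 2), (-1 : ℝ) ^ (i : ℕ) • face X q i

theorem face_degen_castSucc (q : ℕ) (i : Fin (q + 1)) (x : X _⦋q⦌) :
    face X q i.castSucc (degen X q i x) = x :=
  congrArg (fun g => g.hom x) (X.δ_comp_σ_self (i := i))

theorem face_degen_succ (q : ℕ) (i : Fin (q + 1)) (x : X _⦋q⦌) :
    face X q i.succ (degen X q i x) = x :=
  congrArg (fun g => g.hom x) (X.δ_comp_σ_succ (i := i))

theorem degen_degen (x : X _⦋0⦌) :
    degen X 1 0 (degen X 0 0 x) = degen X 1 1 (degen X 0 0 x) :=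
  congrArg (fun g => g.hom x) (X.σ_comp_σ (le_refl (0 : Fin 1)))

theorem degenerate_le_ker_boundary : degenerate X 0 ≤ LinearMap.ker (boundary X 0) := by
  refine iSup_le fun i => ?_
  rintro _ ⟨v, rfl⟩
  have h0 := face_degen_castSucc X 0 i v
  have h1 := face_degen_succ X 0 i v
  fin_cases i
  have h : boundary X 0 = face X 0 0 - face X 0 1 := by
    unfold boundary
    rw [Fin.sum_univ_two]
    simp [sub_eq_add_neg]
  rw [LinearMap.mem_ker, h, LinearMap.sub_apply]
  exact sub_eq_zero.mpr (h0.trans h1.symm)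

/-- The boundary map `∂ : T̂_1 → T_0` of the tangent complex. -/
def tangentBoundary : NormTangent X 0 →ₗ[ℝ] X _⦋0⦌ :=
  (degenerate X 0).liftQ (boundary X 0) (degenerate_le_ker_boundary X)

/-! ### Forms on simplicial vector spaces -/

/-- The simplicial coboundary `δα = ∑ (-1)^i f_i^* α`. -/
def coboundary (q : ℕ) (α : X _⦋q⦌ → LinearMap.BilinForm ℝ (X _⦋q⦌)) :
    X _⦋q + 1⦌ → LinearMap.BilinForm ℝ (X _⦋q + 1⦌) :=
  fun x => ∑ i : Fin (q + 2), (-1 : ℝ) ^ (i : ℕ) • pullback (face X q i) α x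

/-- A 2-form is multiplicative if its simplicial coboundary vanishes. -/
def IsMultiplicative (q : ℕ) (α : X _⦋q⦌ → LinearMap.BilinForm ℝ (X _⦋q⦌)) : Prop :=
  coboundary X q α = 0

/-- A 2-form on `X_{q+1}` is normalized if its pullback by every degeneracy map vanishes. -/
def IsNormalized (q : ℕ) (α : X _⦋q + 1⦌ → LinearMap.BilinForm ℝ (X _⦋q + 1⦌)) : Prop :=
  ∀ i : Fin (q + 1), pullback (degen X q i) α = 0

/-- The total degeneracy `σ² : X_0 → X_2`. -/
def unitTwo : X _⦋0⦌ →ₗ[ℝ] X _⦋2⦌ := degen X 1 0 ∘ₗ degen X 0 0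

variable (ω : X _⦋2⦌ → LinearMap.BilinForm ℝ (X _⦋2⦌))

/-- `Ã_ω(v, w) = ω(σ² v, w)` at `x ∈ X_0`. -/
def tildeA (x : X _⦋0⦌) : X _⦋0⦌ →ₗ[ℝ] X _⦋2⦌ →ₗ[ℝ] ℝ :=
  LinearMap.comp (ω (unitTwo X x)) (unitTwo X)

/-- `B̃_ω(θ, η) = ω(σ_1 θ, σ_0 η) + ω(σ_1 η, σ_0 θ)` at `x ∈ X_0`. -/
def tildeB (x : X _⦋0⦌) : X _⦋1⦌ →ₗ[ℝ] X _⦋1⦌ →ₗ[ℝ] ℝ :=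
  (ω (unitTwo X x)).compl₁₂ (degen X 1 1) (degen X 1 0)
    + ((ω (unitTwo X x)).compl₁₂ (degen X 1 1) (degen X 1 0)).flip

theorem normalized_apply {ω : X _⦋2⦌ → LinearMap.BilinForm ℝ (X _⦋2⦌)} (h : IsNormalized X 1 ω)
    (x : X _⦋0⦌) (i : Fin 2) (a b : X _⦋1⦌) :
    ω (unitTwo X x) (degen X 1 i a) (degen X 1 i b) = 0 := by
  have h1 : unitTwo X x = degen X 1 i (degen X 0 0 x) := by
    fin_cases i
    · rfl
    · exact degen_degen X x
  rw [h1]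
  have h2 := congrFun (h i) (degen X 0 0 x)
  exact congrArg (fun B : LinearMap.BilinForm ℝ (X _⦋1⦌) => B a b) h2

theorem tildeA_right (h : IsNormalized X 1 ω) (x : X _⦋0⦌) :
    degenerate X 1 ≤ LinearMap.ker (tildeA X ω x).flip := by
  refine iSup_le fun i => ?_
  rintro _ ⟨w, rfl⟩
  rw [LinearMap.mem_ker]
  ext v
  have h1 : unitTwo X v = degen X 1 i (degen X 0 0 v) := by
    fin_cases i
    · rfl
    · exact degen_degen X v
  change ω (unitTwo X x) (unitTwo X v) (degen X 1 i w) = 0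
  rw [h1]
  exact normalized_apply X h x i _ _

theorem tildeB_left (h : IsNormalized X 1 ω) (x : X _⦋0⦌) :
    degenerate X 0 ≤ LinearMap.ker (tildeB X ω x) := by
  refine iSup_le fun i => ?_
  rintro _ ⟨v, rfl⟩
  rw [LinearMap.mem_ker]
  ext η
  fin_cases i
  change ω (unitTwo X x) (degen X 1 1 (degen X 0 0 v)) (degen X 1 0 η)
    + ω (unitTwo X x) (degen X 1 1 η) (degen X 1 0 (degen X 0 0 v)) = 0
  rw [← degen_degen, normalized_apply X h, degen_degen, normalized_apply X h, add_zero]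

theorem tildeB_flip (x : X _⦋0⦌) : (tildeB X ω x).flip = tildeB X ω x := by
  ext θ η
  exact add_comm _ _

/-- The pairing `A_ω` of `T_0` with `T̂_2` at `x`, for `ω` normalized. -/
def pairingA (h : IsNormalized X 1 ω) (x : X _⦋0⦌) :
    X _⦋0⦌ →ₗ[ℝ] NormTangent X 1 →ₗ[ℝ] ℝ :=
  ((degenerate X 1).liftQ (tildeA X ω x).flip (tildeA_right X ω h x)).flip

/-- The symmetric bilinear form `B_ω` on `T̂_1` at `x`, for `ω` normalized. -/
def pairingB (h : IsNormalized X 1 ω) (x : X _⦋0⦌) :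
    LinearMap.BilinForm ℝ (NormTangent X 0) :=
  (tildeB X ω x).liftQ₂ (degenerate X 0) (degenerate X 0) (tildeB_left X ω h x)
    ((tildeB_left X ω h x).trans_eq (by rw [tildeB_flip]))

/-- Simplicial nondegeneracy: `A_ω` and `B_ω` are nondegenerate at all points of `X_0`. -/
def SimpliciallyNondegenerate (h : IsNormalized X 1 ω) : Prop :=
  ∀ x, (pairingA X ω h x).Nondegenerate ∧ (pairingB X ω h x).Nondegenerate

/-- Equivalence of 2-forms `ω, ω'` on `X_2`: there is a closed, normalized, not necessarily
constant, 2-form `α` on `X_1` with `ω' - ω = δα` and `A_{δα} = B_{δα} = 0`. -/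
def FormEquivalent [FiniteDimensional ℝ (X _⦋1⦌)]
    (ω ω' : X _⦋2⦌ → LinearMap.BilinForm ℝ (X _⦋2⦌)) : Prop :=
  ∃ α : X _⦋1⦌ → LinearMap.BilinForm ℝ (X _⦋1⦌),
    IsTwoForm α ∧ IsClosedForm α ∧ IsNormalized X 0 α ∧
      (∀ x u v, ω' x u v - ω x u v = coboundary X 1 α x u v) ∧
      (∀ x, tildeA X (coboundary X 1 α) x = 0) ∧ ∀ x, tildeB X (coboundary X 1 α) x = 0

end Simplicial

/-! ### Constant symplectic 2-groupoids -/

/-- A linear 2-groupoid: a simplicial object in finite-dimensional real vector spaces such that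
all horn maps are surjective submersions, and diffeomorphisms in degrees above 2. A linear map
between finite-dimensional vector spaces is a surjective submersion iff it is surjective, and a
diffeomorphism iff it is bijective. Faces are automatically surjective and degeneracies
automatically embeddings, by the simplicial identities. -/
structure LinearTwoGroupoid where
  X : SVect.{u}
  finite : ∀ q, FiniteDimensional ℝ (X _⦋q⦌)
  horn_surjective : ∀ q k, Function.Surjective (hornMap X q k)
  horn_bijective : ∀ q k, 2 < q + 1 → Function.Bijective (hornMap X q k)

attribute [instance] LinearTwoGroupoid.finite

/-- A constant symplectic 2-groupoid: a linear 2-groupoid with a closed, multiplicative,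
normalized, simplicially nondegenerate 2-form on `X_2` which is constant. -/
structure ConstantSymplecticTwoGroupoid extends LinearTwoGroupoid.{u} where
  ω : X _⦋2⦌ → LinearMap.BilinForm ℝ (X _⦋2⦌)
  isTwoForm : IsTwoForm ω
  closed : IsClosedForm ω
  multiplicative : IsMultiplicative X 2 ω
  normalized : IsNormalized X 1 ω
  nondegenerate : SimpliciallyNondegenerate X ω normalized
  constant : ∀ x y, ω x = ω y

/-- The linear map in degree `q` of a morphism of simplicial vector spaces. -/
def degreeMap {X Y : SVect.{u}} (φ : X ⟶ Y) (q : ℕ) : X _⦋q⦌ →ₗ[ℝ] Y _⦋q⦌ :=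
  (φ.app (op ⦋q⦌)).hom

section FormEquivalent

variable {X Y : SVect.{u}}

theorem degreeMap_face (φ : X ⟶ Y) (q : ℕ) (i : Fin (q + 2)) (x : X _⦋q + 1⦌) :
    degreeMap φ q (face X q i x) = face Y q i (degreeMap φ (q + 1) x) :=
  congrArg (fun g => g.hom x) (SimplicialObject.δ_naturality φ i)

theorem degreeMap_degen (φ : X ⟶ Y) (q : ℕ) (i : Fin (q + 1)) (x : X _⦋q⦌) :
    degreeMap φ (q + 1) (degen X q i x) = degen Y q i (degreeMap φ q x) :=
  congrArg (fun g => g.hom x) (SimplicialObject.σ_naturality φ i)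

theorem degreeMap_unitTwo (φ : X ⟶ Y) (x : X _⦋0⦌) :
    degreeMap φ 2 (unitTwo X x) = unitTwo Y (degreeMap φ 0 x) :=
  (degreeMap_degen φ 1 0 _).trans (congrArg _ (degreeMap_degen φ 0 0 x))

theorem coboundary_pullback (φ : X ⟶ Y) (α : Y _⦋1⦌ → LinearMap.BilinForm ℝ (Y _⦋1⦌)) :
    coboundary X 1 (pullback (degreeMap φ 1) α) = pullback (degreeMap φ 2) (coboundary Y 1 α) := by
  funext x
  ext u v
  simp [coboundary, pullback, degreeMap_face]

theorem coboundary_add (α β : X _⦋1⦌ → LinearMap.BilinForm ℝ (X _⦋1⦌)) :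
    coboundary X 1 (α + β) = coboundary X 1 α + coboundary X 1 β := by
  funext x
  ext u v
  simp [coboundary, pullback, Finset.sum_add_distrib, mul_add]

theorem coboundary_neg (α : X _⦋1⦌ → LinearMap.BilinForm ℝ (X _⦋1⦌)) :
    coboundary X 1 (-α) = -coboundary X 1 α := by
  funext x
  ext u v
  simp [coboundary, pullback]

theorem FormEquivalent.refl [FiniteDimensional ℝ (X _⦋1⦌)]
    (ω : X _⦋2⦌ → LinearMap.BilinForm ℝ (X _⦋2⦌)) : FormEquivalent X ω ω := by
  have h0 : coboundary X 1 0 = 0 := by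
    funext x
    ext u v
    simp [coboundary, pullback]
  refine ⟨0, ⟨fun x v => rfl, fun u v => SmoothFun.const 0⟩, ?_, ?_, ?_, ?_, ?_⟩
  · intro x u v w
    simp [lineDeriv]
  · intro i
    rfl
  · intro x u v
    rw [h0, sub_self]
    rfl
  · intro x
    rw [h0]
    rfl
  · intro x
    rw [h0]
    ext u v
    simp [tildeB]

theorem FormEquivalent.symm [FiniteDimensional ℝ (X _⦋1⦌)]
    {ω ω' : X _⦋2⦌ → LinearMap.BilinForm ℝ (X _⦋2⦌)} (h : FormEquivalent X ω ω') :
    FormEquivalent X ω' ω := by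
  obtain ⟨α, ⟨h1, h2⟩, h3, h4, h5, h6, h7⟩ := h
  refine ⟨-α, ⟨fun x v => ?_, fun u v => (h2 u v).neg⟩, ?_, ?_, ?_, ?_, ?_⟩
  · simp [h1 x v]
  · intro x u v w
    have := h3 x u v w
    simp only [lineDeriv, Pi.neg_apply, LinearMap.neg_apply, deriv.fun_neg] at this ⊢
    linarith
  · intro i
    have := h4 i
    funext x
    ext u v
    have := congrFun this x
    have := congrArg (fun B : LinearMap.BilinForm ℝ (X _⦋0⦌) => B u v) this
    simpa [pullback] using this
  · intro x u v
    rw [coboundary_neg, ← neg_sub, h5]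
    rfl
  · intro x
    have := h6 x
    rw [coboundary_neg]
    ext u v
    have := congrArg (fun B : X _⦋0⦌ →ₗ[ℝ] X _⦋2⦌ →ₗ[ℝ] ℝ => B u v) this
    simpa [tildeA] using this
  · intro x
    have := h7 x
    rw [coboundary_neg]
    ext u v
    have := congrArg (fun B : X _⦋1⦌ →ₗ[ℝ] X _⦋1⦌ →ₗ[ℝ] ℝ => B u v) this
    simp only [tildeB, LinearMap.add_apply, LinearMap.flip_apply, LinearMap.compl₁₂_apply,
      Pi.neg_apply, LinearMap.neg_apply, LinearMap.zero_apply] at this ⊢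
    linarith

theorem FormEquivalent.trans [FiniteDimensional ℝ (X _⦋1⦌)]
    {ω ω' ω'' : X _⦋2⦌ → LinearMap.BilinForm ℝ (X _⦋2⦌)} (h : FormEquivalent X ω ω')
    (h' : FormEquivalent X ω' ω'') : FormEquivalent X ω ω'' := by
  obtain ⟨α, ⟨h1, h2⟩, h3, h4, h5, h6, h7⟩ := h
  obtain ⟨β, ⟨k1, k2⟩, k3, k4, k5, k6, k7⟩ := h'
  refine ⟨α + β, ⟨fun x v => ?_, fun u v => (h2 u v).add (k2 u v)⟩, ?_, ?_, ?_, ?_, ?_⟩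
  · simp [h1 x v, k1 x v]
  · intro x u v w
    have e : ∀ x u v w, lineDeriv ℝ (fun y => (α + β) y v w) x u
        = lineDeriv ℝ (fun y => α y v w) x u + lineDeriv ℝ (fun y => β y v w) x u :=
      fun x u v w => deriv_fun_add ((h2 v w).lineDifferentiableAt x u)
        ((k2 v w).lineDifferentiableAt x u)
    have := h3 x u v w
    have := k3 x u v w
    rw [e, e, e]
    linarith
  · intro i
    funext x
    ext u v
    have h := congrArg (fun B : LinearMap.BilinForm ℝ (X _⦋0⦌) => B u v) (congrFun (h4 i) x)
    have k := congrArg (fun B : LinearMap.BilinForm ℝ (X _⦋0⦌) => B u v) (congrFun (k4 i) x)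
    simp only [pullback, LinearMap.compl₁₂_apply, Pi.zero_apply, LinearMap.zero_apply,
      Pi.add_apply, LinearMap.add_apply] at h k ⊢
    rw [h, k, add_zero]
  · intro x u v
    rw [coboundary_add]
    exact (sub_add_sub_cancel' _ _ _).symm.trans (congrArg₂ (· + ·) (h5 x u v) (k5 x u v))
  · intro x
    rw [coboundary_add]
    ext u v
    have h := congrArg (fun B : X _⦋0⦌ →ₗ[ℝ] X _⦋2⦌ →ₗ[ℝ] ℝ => B u v) (h6 x)
    have k := congrArg (fun B : X _⦋0⦌ →ₗ[ℝ] X _⦋2⦌ →ₗ[ℝ] ℝ => B u v) (k6 x)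
    simp only [tildeA, LinearMap.comp_apply, Pi.add_apply, LinearMap.add_apply,
      LinearMap.zero_apply] at h k ⊢
    rw [h, k, add_zero]
  · intro x
    rw [coboundary_add]
    ext u v
    have h := congrArg (fun B : X _⦋1⦌ →ₗ[ℝ] X _⦋1⦌ →ₗ[ℝ] ℝ => B u v) (h7 x)
    have k := congrArg (fun B : X _⦋1⦌ →ₗ[ℝ] X _⦋1⦌ →ₗ[ℝ] ℝ => B u v) (k7 x)
    simp only [tildeB, LinearMap.add_apply, LinearMap.flip_apply, LinearMap.compl₁₂_apply,
      Pi.add_apply, LinearMap.zero_apply] at h k ⊢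
    linarith

theorem FormEquivalent.pullback [FiniteDimensional ℝ (X _⦋1⦌)] [FiniteDimensional ℝ (Y _⦋1⦌)]
    (φ : X ⟶ Y) {ω ω' : Y _⦋2⦌ → LinearMap.BilinForm ℝ (Y _⦋2⦌)} (h : FormEquivalent Y ω ω') :
    FormEquivalent X (pullback (degreeMap φ 2) ω) (pullback (degreeMap φ 2) ω') := by
  obtain ⟨α, ⟨h1, h2⟩, h3, h4, h5, h6, h7⟩ := h
  refine ⟨ConstantCourant.pullback (degreeMap φ 1) α,
    ⟨fun x v => h1 _ _, fun u v => (h2 _ _).comp_linear (degreeMap φ 1)⟩, ?_, ?_, ?_, ?_, ?_⟩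
  · intro x u v w
    have := h3 (degreeMap φ 1 x) (degreeMap φ 1 u) (degreeMap φ 1 v) (degreeMap φ 1 w)
    simpa [lineDeriv, ConstantCourant.pullback] using this
  · intro i
    funext x
    ext u v
    have h := congrArg (fun B : LinearMap.BilinForm ℝ (Y _⦋0⦌) =>
      B (degreeMap φ 0 u) (degreeMap φ 0 v)) (congrFun (h4 i) (degreeMap φ 0 x))
    have e := degreeMap_degen φ 0 i
    change α (degreeMap φ (0 + 1) (degen X 0 i x)) (degreeMap φ (0 + 1) (degen X 0 i u))
      (degreeMap φ (0 + 1) (degen X 0 i v)) = 0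
    rw [e, e, e]
    exact h
  · intro x u v
    rw [coboundary_pullback]
    exact h5 _ _ _
  · intro x
    rw [coboundary_pullback]
    ext u v
    have h := congrArg (fun B : Y _⦋0⦌ →ₗ[ℝ] Y _⦋2⦌ →ₗ[ℝ] ℝ =>
      B (degreeMap φ 0 u) (degreeMap φ 2 v)) (h6 (degreeMap φ 0 x))
    simp only [tildeA, LinearMap.comp_apply, ConstantCourant.pullback, LinearMap.compl₁₂_apply,
      degreeMap_unitTwo]
    exact h
  · intro x
    rw [coboundary_pullback]
    ext u v
    have h := congrArg (fun B : Y _⦋1⦌ →ₗ[ℝ] Y _⦋1⦌ →ₗ[ℝ] ℝ =>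
      B (degreeMap φ 1 u) (degreeMap φ 1 v)) (h7 (degreeMap φ 0 x))
    have e := degreeMap_degen φ 1
    simp only [Nat.reduceAdd] at e
    simp only [tildeB, LinearMap.add_apply, LinearMap.flip_apply, ConstantCourant.pullback,
      LinearMap.compl₁₂_apply, degreeMap_unitTwo, e]
    exact h

end FormEquivalent

namespace ConstantSymplecticTwoGroupoid

/-- `φ` is an isomorphism of linear 2-groupoids and `S.ω` is equivalent to `φ^* T.ω`. -/
def IsEquivalence {S T : ConstantSymplecticTwoGroupoid.{u}} (φ : S.X ≅ T.X) : Prop :=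
  FormEquivalent S.X S.ω (pullback (degreeMap φ.hom 2) T.ω)

theorem IsEquivalence.refl (S : ConstantSymplecticTwoGroupoid.{u}) :
    IsEquivalence (S := S) (T := S) (Iso.refl S.X) :=
  FormEquivalent.refl S.ω

theorem IsEquivalence.symm {S T : ConstantSymplecticTwoGroupoid.{u}} {φ : S.X ≅ T.X}
    (h : IsEquivalence φ) : IsEquivalence (S := T) (T := S) φ.symm := by
  have h' := (FormEquivalent.pullback φ.inv h).symm
  have e : ∀ x, degreeMap φ.hom 2 (degreeMap φ.inv 2 x) = x := fun x =>
    congrArg (fun g => (g.app (op ⦋2⦌)).hom x) φ.inv_hom_id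
  refine (congrArg (fun η => FormEquivalent T.X η _) ?_).mp h'
  funext x
  ext u v
  simp [pullback, e]

theorem IsEquivalence.trans {S T U : ConstantSymplecticTwoGroupoid.{u}} {φ : S.X ≅ T.X}
    {ψ : T.X ≅ U.X} (h : IsEquivalence φ) (k : IsEquivalence ψ) :
    IsEquivalence (S := S) (T := U) (φ ≪≫ ψ) :=
  FormEquivalent.trans h (FormEquivalent.pullback φ.hom k)

/-- Equivalence of constant symplectic 2-groupoids, up to isomorphism of the underlying linear
2-groupoids. -/
instance setoid : Setoid ConstantSymplecticTwoGroupoid.{u} where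
  r S T := ∃ φ : S.X ≅ T.X, IsEquivalence φ
  iseqv := ⟨fun S => ⟨_, IsEquivalence.refl S⟩, fun ⟨_, h⟩ => ⟨_, h.symm⟩,
    fun ⟨_, h⟩ ⟨_, k⟩ => ⟨_, h.trans k⟩⟩

end ConstantSymplecticTwoGroupoid

/-- A constant symplectic 2-groupoid whose tangent complex is identified, in degrees 1 and 0, with
the given vector spaces `W₁` and `W₀`. -/
structure MarkedSymplecticTwoGroupoid (W₁ W₀ : Type u) [AddCommGroup W₁] [Module ℝ W₁]
    [AddCommGroup W₀] [Module ℝ W₀] extends ConstantSymplecticTwoGroupoid.{u} where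
  mark₁ : NormTangent X 0 ≃ₗ[ℝ] W₁
  mark₀ : X _⦋0⦌ ≃ₗ[ℝ] W₀

/-- Equivalence of constant symplectic 2-groupoids by isomorphisms that induce the identity on
`W₁` and `W₀`. -/
instance MarkedSymplecticTwoGroupoid.setoid (W₁ W₀ : Type u) [AddCommGroup W₁] [Module ℝ W₁]
    [AddCommGroup W₀] [Module ℝ W₀] : Setoid (MarkedSymplecticTwoGroupoid W₁ W₀) where
  r S T := ∃ φ : S.X ≅ T.X, ConstantSymplecticTwoGroupoid.IsEquivalence φ ∧
    (∀ θ : S.X _⦋1⦌, T.mark₁ (Submodule.Quotient.mk (degreeMap φ.hom 1 θ))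
      = S.mark₁ (Submodule.Quotient.mk θ)) ∧
    ∀ v : S.X _⦋0⦌, T.mark₀ (degreeMap φ.hom 0 v) = S.mark₀ v
  iseqv :=
    { refl := fun S => ⟨_, ConstantSymplecticTwoGroupoid.IsEquivalence.refl _,
        fun _ => rfl, fun _ => rfl⟩
      symm := by
        rintro S T ⟨φ, h, h1, h0⟩
        refine ⟨_, h.symm, fun θ => ?_, fun v => ?_⟩
        · have e : degreeMap φ.hom 1 (degreeMap φ.inv 1 θ) = θ :=
            congrArg (fun g => (g.app (op ⦋1⦌)).hom θ) φ.inv_hom_id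
          have := h1 (degreeMap φ.inv 1 θ)
          rw [e] at this
          exact this.symm
        · have e : degreeMap φ.hom 0 (degreeMap φ.inv 0 v) = v :=
            congrArg (fun g => (g.app (op ⦋0⦌)).hom v) φ.inv_hom_id
          have := h0 (degreeMap φ.inv 0 v)
          rw [e] at this
          exact this.symm
      trans := by
        rintro S T U ⟨φ, h, h1, h0⟩ ⟨ψ, k, k1, k0⟩
        exact ⟨_, h.trans k, fun θ => (k1 _).trans (h1 θ), fun v => (k0 _).trans (h0 v)⟩ }

/-! ### Constant Courant algebroids -/

section Courant

variable (W₁ W₀ : Type u) [AddCommGroup W₁] [Module ℝ W₁] [FiniteDimensional ℝ W₁]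
  [AddCommGroup W₀] [Module ℝ W₀] [FiniteDimensional ℝ W₀]

/-- The smooth sections of the trivial vector bundle `W₁ × W₀ → W₀`. -/
def Sections : Submodule ℝ (W₀ → W₁) where
  carrier := {e | SmoothMap e}
  add_mem' := fun ha hb ξ => by
    simpa using (ha ξ).add (hb ξ)
  zero_mem' := fun ξ => by
    simpa using SmoothFun.const 0
  smul_mem' := fun c a ha ξ => by
    simpa using (SmoothFun.const c).mul (ha ξ)

variable {W₁ W₀}

/-- The product of a smooth function and a section. -/
def Sections.mulFun (f : W₀ → ℝ) (hf : SmoothFun f) (e : Sections W₁ W₀) : Sections W₁ W₀ :=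
  ⟨fun x => f x • e.1 x, fun ξ => by simpa using hf.mul (e.2 ξ)⟩

/-- A vector, viewed as a constant section. -/
def Sections.const (w : W₁) : Sections W₁ W₀ :=
  ⟨fun _ => w, fun ξ => SmoothFun.const (ξ w)⟩

variable (W₁ W₀)

/-- A Courant algebroid structure on the vector bundle `W₁ × W₀ → W₀`. For a section `e` and a
function `f`, the function `ρ(e)(f)` is `x ↦ lineDeriv ℝ f x (anchor x (e x))`. -/
@[ext]
structure CourantAlgebroid where
  pairing : W₀ → LinearMap.BilinForm ℝ W₁
  anchor : W₀ → W₁ →ₗ[ℝ] W₀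
  bracket : Sections W₁ W₀ →ₗ[ℝ] Sections W₁ W₀ →ₗ[ℝ] Sections W₁ W₀
  pairing_smooth : ∀ w w', SmoothFun fun x => pairing x w w'
  pairing_symm : ∀ x, (pairing x).IsSymm
  pairing_nondegenerate : ∀ x, (pairing x).Nondegenerate
  anchor_smooth : ∀ w, SmoothMap fun x => anchor x w
  /-- `[e₁, f e₂] = ρ(e₁)(f) e₂ + f [e₁, e₂]` -/
  leibniz : ∀ (e₁ e₂ : Sections W₁ W₀) (f : W₀ → ℝ) (hf : SmoothFun f) (x : W₀),
    (bracket e₁ (Sections.mulFun f hf e₂)).1 x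
      = lineDeriv ℝ f x (anchor x (e₁.1 x)) • e₂.1 x + f x • (bracket e₁ e₂).1 x
  /-- `ρ(e₁)⟨e₂, e₃⟩ = ⟨[e₁, e₂], e₃⟩ + ⟨e₂, [e₁, e₃]⟩` -/
  invariance : ∀ (e₁ e₂ e₃ : Sections W₁ W₀) (x : W₀),
    lineDeriv ℝ (fun y => pairing y (e₂.1 y) (e₃.1 y)) x (anchor x (e₁.1 x))
      = pairing x ((bracket e₁ e₂).1 x) (e₃.1 x) + pairing x (e₂.1 x) ((bracket e₁ e₃).1 x)
  /-- `[[e₁, e₂], e₃] = [e₁, [e₂, e₃]] - [e₂, [e₁, e₃]]` -/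
  jacobi : ∀ e₁ e₂ e₃ : Sections W₁ W₀,
    bracket (bracket e₁ e₂) e₃ = bracket e₁ (bracket e₂ e₃) - bracket e₂ (bracket e₁ e₃)
  /-- `[e₁, e₂] + [e₂, e₁] = 𝒟⟨e₁, e₂⟩`, where `⟨𝒟f, e⟩ = ρ(e)(f)` for all sections `e` -/
  skew : ∀ (e₁ e₂ e : Sections W₁ W₀) (x : W₀),
    pairing x ((bracket e₁ e₂ + bracket e₂ e₁).1 x) (e.1 x)
      = lineDeriv ℝ (fun y => pairing y (e₁.1 y) (e₂.1 y)) x (anchor x (e.1 x))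

/-- A constant Courant algebroid structure on `W₁ × W₀ → W₀`. -/
@[ext]
structure ConstantCourantAlgebroid extends CourantAlgebroid W₁ W₀ where
  pairing_constant : ∀ x y, pairing x = pairing y
  anchor_constant : ∀ x y, anchor x = anchor y
  bracket_constant : ∀ w w' : W₁, bracket (Sections.const w) (Sections.const w') = 0

/-- The linear algebra data: a nondegenerate symmetric bilinear form on `W₁` and a linear map
`∂ : W₁ → W₀` with `∂ ∘ ∂^* = 0`, where `∂^* : W₀^* → W₁^* ≅ W₁`. -/
@[ext]
structure IsotropicData where
  pairing : LinearMap.BilinForm ℝ W₁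
  symm : pairing.IsSymm
  nondegenerate : pairing.Nondegenerate
  del : W₁ →ₗ[ℝ] W₀
  isotropic : del ∘ₗ (pairing.toDual nondegenerate).symm.toLinearMap ∘ₗ del.dualMap = 0

end Courant

/-- A constant Courant algebroid together with its underlying vector spaces. -/
structure BundledConstantCourant where
  W₁ : Type u
  W₀ : Type u
  [addCommGroup₁ : AddCommGroup W₁]
  [module₁ : Module ℝ W₁]
  [finite₁ : FiniteDimensional ℝ W₁]
  [addCommGroup₀ : AddCommGroup W₀]
  [module₀ : Module ℝ W₀]
  [finite₀ : FiniteDimensional ℝ W₀]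
  E : ConstantCourantAlgebroid W₁ W₀

attribute [instance] BundledConstantCourant.addCommGroup₁ BundledConstantCourant.module₁
  BundledConstantCourant.finite₁ BundledConstantCourant.addCommGroup₀
  BundledConstantCourant.module₀ BundledConstantCourant.finite₀

namespace BundledConstantCourant

/-- The linear isomorphism of vector bundles `φ₁ × φ₀` preserves pairing, anchor and bracket. -/
structure IsIsomorphism {C D : BundledConstantCourant.{u}} (φ₁ : C.W₁ ≃ₗ[ℝ] D.W₁)
    (φ₀ : C.W₀ ≃ₗ[ℝ] D.W₀) : Prop where
  pairing : ∀ x w w', D.E.pairing (φ₀ x) (φ₁ w) (φ₁ w') = C.E.pairing x w w'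
  anchor : ∀ x w, D.E.anchor (φ₀ x) (φ₁ w) = φ₀ (C.E.anchor x w)
  bracket : ∀ (e₁ e₂ : Sections C.W₁ C.W₀) (e₁' e₂' : Sections D.W₁ D.W₀),
    (∀ x, e₁'.1 (φ₀ x) = φ₁ (e₁.1 x)) → (∀ x, e₂'.1 (φ₀ x) = φ₁ (e₂.1 x)) →
      ∀ x, (D.E.bracket e₁' e₂').1 (φ₀ x) = φ₁ ((C.E.bracket e₁ e₂).1 x)

/-- Isomorphism of constant Courant algebroids. -/
instance setoid : Setoid BundledConstantCourant.{u} where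
  r C D := ∃ (φ₁ : C.W₁ ≃ₗ[ℝ] D.W₁) (φ₀ : C.W₀ ≃ₗ[ℝ] D.W₀), IsIsomorphism φ₁ φ₀
  iseqv :=
    { refl := fun C => ⟨LinearEquiv.refl ℝ _, LinearEquiv.refl ℝ _, fun _ _ _ => rfl,
        fun _ _ => rfl, fun e₁ e₂ e₁' e₂' h₁ h₂ x => by
          have h1 : e₁' = e₁ := Subtype.ext (funext h₁)
          have h2 : e₂' = e₂ := Subtype.ext (funext h₂)
          rw [h1, h2]
          rfl⟩
      symm := by
        rintro C D ⟨φ₁, φ₀, h⟩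
        refine ⟨φ₁.symm, φ₀.symm, fun x w w' => ?_, fun x w => ?_, fun e₁ e₂ e₁' e₂' h₁ h₂ x => ?_⟩
        · simpa using (h.pairing (φ₀.symm x) (φ₁.symm w) (φ₁.symm w')).symm
        · rw [LinearEquiv.eq_symm_apply, ← h.anchor]
          simp
        · rw [LinearEquiv.eq_symm_apply, ← h.bracket e₁' e₂' e₁ e₂]
          · simp
          · intro y
            have := h₁ (φ₀ y)
            rw [φ₀.symm_apply_apply, LinearEquiv.eq_symm_apply] at this
            exact this.symm
          · intro y
            have := h₂ (φ₀ y)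
            rw [φ₀.symm_apply_apply, LinearEquiv.eq_symm_apply] at this
            exact this.symm
      trans := by
        rintro C D F ⟨φ₁, φ₀, h⟩ ⟨ψ₁, ψ₀, k⟩
        refine ⟨φ₁.trans ψ₁, φ₀.trans ψ₀, fun x w w' => ?_, fun x w => ?_,
          fun e₁ e₂ e₁' e₂' h₁ h₂ x => ?_⟩
        · exact (k.pairing _ _ _).trans (h.pairing _ _ _)
        · exact (k.anchor _ _).trans (congrArg ψ₀ (h.anchor _ _))
        · let push : Sections C.W₁ C.W₀ → Sections D.W₁ D.W₀ := fun e =>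
            ⟨fun y => φ₁ (e.1 (φ₀.symm y)), fun ξ =>
              (e.2 (ξ ∘ₗ φ₁.toLinearMap)).comp_linear φ₀.symm.toLinearMap⟩
          have hp : ∀ e x, (push e).1 (φ₀ x) = φ₁ (e.1 x) := fun e x => by simp [push]
          have hk := k.bracket (push e₁) (push e₂) e₁' e₂'
            (fun y => by simpa [push] using h₁ (φ₀.symm y))
            (fun y => by simpa [push] using h₂ (φ₀.symm y)) (φ₀ x)
          exact hk.trans (congrArg ψ₁ (h.bracket e₁ e₂ _ _ (hp e₁) (hp e₂) x)) }

end BundledConstantCourant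

/-- The constant Courant algebroid `C` and the constant symplectic 2-groupoid `S` correspond to
each other: the tangent complex of `S` in degrees 1 and 0, with the form `B_ω`, is isomorphic to
the anchor of `C` with its pairing. -/
def Corresponds (C : BundledConstantCourant.{u}) (S : ConstantSymplecticTwoGroupoid.{u}) : Prop :=
  ∃ (φ₁ : NormTangent S.X 0 ≃ₗ[ℝ] C.W₁) (φ₀ : S.X _⦋0⦌ ≃ₗ[ℝ] C.W₀),
    (∀ x θ η, C.E.pairing (φ₀ x) (φ₁ θ) (φ₁ η) = pairingB S.X S.ω S.normalized x θ η) ∧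
    ∀ x θ, C.E.anchor x (φ₁ θ) = φ₀ (tangentBoundary S.X θ)

end ConstantCourant

end

open ConstantCourant

noncomputable section

namespace ConstantCourant

/-! ### Simplicial vector spaces satisfy the Kan condition -/

section Kan

variable (X : SVect.{u})

/-! All the objects are governed by one piece of linear algebra: a metric on `W₁` and a map `∂ : W₁
→ W₀` with `∂ ∘ ∂^* = 0`, that is, a three-term complex `W₀^* → W₁ → W₀` that is self-dual up to a
shift.

Courant side. Brackets of constant sections vanish, so invariance and the axiom on `[e₁, e₂] + [e₂,
e₁]` compute `⟨[e₁, e₂], w⟩` from first derivatives (`pairing_bracket`); pairing and anchor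
therefore determine everything. The relation `∂ ∘ ∂^* = 0` holds because the Jacobi identity makes
every symmetrized bracket act by zero from the left (`anchor_toDual_symm`). Conversely, `D_{∂e₁} e₂
- D_{∂e₂} e₁ + ∂^*⟨De₁, e₂⟩` is a Courant bracket; isotropy makes `∂` send it to the commutator of
vector fields, which is what the Jacobi identity (`bracketSection_jacobi`) needs.

Groupoid side, in the spirit of Dold–Kan. Evaluating `δω = 0` on degenerate 3-simplices gives `A(∂θ,
w) = B(θ, ∂w)` (`boundary_adjoint`). Hence `A` identifies `T̂_2` with `W₀^*`, and its differential
to `T̂_1` with `∂^*`; then `∂² = 0` is isotropy. Every isotropic datum is realized by `model`, whose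
simplices are chain maps from a simplex to the complex, with the skew-symmetrized cup product as the
form. Any marked groupoid with the same data maps to the model by recording vertices, edges modulo
degenerate ones, and the functional `A(·, w)` on triangles. This is an isomorphism: degrees up to 2
are checked by hand, and unique horn fillers propagate it upwards (`toModel_injective`,
`toModel_surjective`).

The forms then agree only in `A` and `B`. This suffices: a constant normalized cocycle with `A = B =
0` is the coboundary of an explicit constant form (`eq_coboundary`). In the other direction, `A_{δα}
= B_{δα} = 0` makes `B` and `∂` invariants of the equivalence class. The unmarked statement follows
by choosing and forgetting markings. -/

theorem face_degen_of_le (q : ℕ) {i : Fin (q + 2)} {j : Fin (q + 1)} (h : i ≤ j.castSucc)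
    (x : X _⦋q + 1⦌) :
    face X (q + 1) i.castSucc (degen X (q + 1) j.succ x) = degen X q j (face X q i x) :=
  congrArg (fun g => g.hom x) (X.δ_comp_σ_of_le h)

theorem face_degen_of_gt (q : ℕ) {i : Fin (q + 2)} {j : Fin (q + 1)} (h : j.castSucc < i)
    (x : X _⦋q + 1⦌) :
    face X (q + 1) i.succ (degen X (q + 1) j.castSucc x) = degen X q j (face X q i x) :=
  congrArg (fun g => g.hom x) (X.δ_comp_σ_of_gt h)

variable {X}

/-- Moving the face past the degeneracy gives `d_i σ_r z_s = σ_{r-1} d_i z_s`, and the horn relation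
turns `d_i z_s` into a face of `z_i = 0`. So a correction by `σ_r z_s` leaves intact a face below
`r` that is already matched. -/
theorem face_degen_eq_zero_of_horn_lt {q : ℕ} {k : Fin (q + 3)}
    {z : {i : Fin (q + 3) // i ≠ k} → X _⦋q + 1⦌} (hz : z ∈ hornSpace X (q + 1) k)
    {i r : Fin (q + 2)} (hir : i < r) (s : {i : Fin (q + 3) // i ≠ k})
    (hs : s.1 = r.castSucc ∨ s.1 = r.succ) (hi : i.castSucc ≠ k) (h0 : z ⟨i.castSucc, hi⟩ = 0) :
    face X (q + 1) i.castSucc (degen X (q + 1) r (z s)) = 0 := by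
  obtain ⟨j, rfl⟩ : ∃ j : Fin (q + 1), r = j.succ := ⟨r.pred (by rintro rfl; simp at hir), by simp⟩
  have hij : i ≤ j.castSucc := by
    rw [Fin.lt_def] at hir
    rw [Fin.le_def]
    simp only [Fin.val_succ, Fin.val_castSucc] at *
    omega
  rw [face_degen_of_le X q hij]
  obtain ⟨s, hs'⟩ := s
  rcases hs with rfl | rfl
  · have := hz i j.castSucc hij hi hs'
    rw [h0, map_zero] at this
    exact (congrArg (degen X q j) this).trans (map_zero _)
  · have := hz i j.succ hir.le hi hs'
    rw [h0, map_zero] at this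
    exact (congrArg (degen X q j) this).trans (map_zero _)

/-- The mirror image, for the downward pass: faces above `r + 1` that are already matched survive a
correction by `σ_r`. -/
theorem face_degen_eq_zero_of_horn_gt {q : ℕ} {k : Fin (q + 3)}
    {z : {i : Fin (q + 3) // i ≠ k} → X _⦋q + 1⦌} (hz : z ∈ hornSpace X (q + 1) k)
    {i r : Fin (q + 2)} (hir : r < i) (hr : r.succ ≠ k) (hi : i.succ ≠ k)
    (h0 : z ⟨i.succ, hi⟩ = 0) :
    face X (q + 1) i.succ (degen X (q + 1) r (z ⟨r.succ, hr⟩)) = 0 := by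
  obtain ⟨j, rfl⟩ : ∃ j : Fin (q + 1), r = j.castSucc :=
    ⟨r.castPred (by rintro rfl; exact absurd hir (Fin.not_lt.mpr (Fin.le_last i))), by simp⟩
  rw [face_degen_of_gt X q hir]
  have hji : j.succ ≤ i := Fin.castSucc_lt_iff_succ_le.mp hir
  have := hz j.succ i hji hr hi
  rw [h0, map_zero] at this
  exact (congrArg (degen X q j) this.symm).trans (map_zero _)

/-- Moore's filling procedure, upward pass. The discrepancy between the horn and the faces of the
current `y` is again a horn. Adding `σ_m` of its entry at `m` repairs face `m`, and the faces below
`m` are undisturbed because the discrepancy vanishes there. -/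
theorem exists_fill_below {q : ℕ} {k : Fin (q + 3)}
    {z : {i : Fin (q + 3) // i ≠ k} → X _⦋q + 1⦌} (hz : z ∈ hornSpace X (q + 1) k) (m : ℕ) :
    ∃ y : X _⦋q + 2⦌, ∀ (i : {i : Fin (q + 3) // i ≠ k}), i.1 < k → i.1.1 < m →
      face X (q + 1) i.1 y = z i := by
  induction m with
  | zero => exact ⟨0, fun i _ h => absurd h (Nat.not_lt_zero _)⟩
  | succ m ih =>
    obtain ⟨y, hy⟩ := ih
    by_cases hm : m < k.1
    · have hk := k.2
      let r : Fin (q + 2) := ⟨m, by omega⟩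
      have hrk : r.castSucc ≠ k := by
        intro h
        rw [Fin.ext_iff] at h
        exact hm.ne h
      let w : {i : Fin (q + 3) // i ≠ k} → X _⦋q + 1⦌ := fun i => z i - face X (q + 1) i.1 y
      have hw : w ∈ hornSpace X (q + 1) k :=
        Submodule.sub_mem _ hz (hornMap_mem X (q + 1) k y)
      refine ⟨y + degen X (q + 1) r (w ⟨r.castSucc, hrk⟩), ?_⟩
      intro i hik him
      rw [map_add]
      rcases Nat.lt_succ_iff_lt_or_eq.mp him with him | him
      · obtain ⟨i, hi⟩ := i
        obtain ⟨i, rfl⟩ : ∃ j : Fin (q + 2), i = j.castSucc :=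
          ⟨i.castPred (by rintro rfl; exact absurd hik (Fin.not_lt.mpr (Fin.le_last k))), by simp⟩
        have h := face_degen_eq_zero_of_horn_lt hw (i := i) (r := r) him ⟨r.castSucc, hrk⟩
          (Or.inl rfl) hi (sub_eq_zero.mpr (hy ⟨i.castSucc, hi⟩ hik him).symm)
        rw [h, add_zero]
        exact hy _ hik him
      · obtain rfl : i = ⟨r.castSucc, hrk⟩ := Subtype.ext (Fin.ext him)
        rw [face_degen_castSucc]
        exact add_sub_cancel _ _
    · refine ⟨y, fun i hik _ => hy i hik ?_⟩
      have : i.1.1 < k.1 := hik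
      omega

/-- Moore's procedure, downward pass from the last face, started at the result of the upward pass.
Each correction must preserve two families of matched faces: those below `k` and those above the
current one. -/
theorem exists_fill_above {q : ℕ} {k : Fin (q + 3)}
    {z : {i : Fin (q + 3) // i ≠ k} → X _⦋q + 1⦌} (hz : z ∈ hornSpace X (q + 1) k) (m : ℕ) :
    ∃ y : X _⦋q + 2⦌, ∀ (i : {i : Fin (q + 3) // i ≠ k}), i.1 < k ∨ q + 3 ≤ i.1.1 + m →
      face X (q + 1) i.1 y = z i := by
  induction m with
  | zero =>
    obtain ⟨y, hy⟩ := exists_fill_below hz (q + 3)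
    refine ⟨y, fun i hi => hy i (hi.resolve_right ?_) i.1.2⟩
    have := i.1.2
    omega
  | succ m ih =>
    obtain ⟨y, hy⟩ := ih
    by_cases hm : k.1 + m < q + 2
    · have hk := k.2
      -- The largest unmatched face has index `q + 2 - m = r + 1`; it is repaired by `σ_r`, since
      -- `d_{r+1} σ_r = id`.
      let r : Fin (q + 2) := ⟨q + 1 - m, by omega⟩
      have hrk : r.succ ≠ k := by
        intro h
        rw [Fin.ext_iff] at h
        change q + 1 - m + 1 = k.1 at h
        omega
      let w : {i : Fin (q + 3) // i ≠ k} → X _⦋q + 1⦌ := fun i => z i - face X (q + 1) i.1 y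
      have hw : w ∈ hornSpace X (q + 1) k :=
        Submodule.sub_mem _ hz (hornMap_mem X (q + 1) k y)
      refine ⟨y + degen X (q + 1) r (w ⟨r.succ, hrk⟩), ?_⟩
      rintro ⟨i, hi⟩ him
      rw [map_add]
      by_cases hir : i = r.succ
      · subst hir
        rw [face_degen_succ]
        exact add_sub_cancel _ _
      have hir' : i.1 ≠ q + 1 - m + 1 := fun h => hir (Fin.ext h)
      have hy' : i < k ∨ q + 3 ≤ i.1 + m := by
        refine him.imp_right fun h => ?_
        change q + 3 ≤ i.1 + (m + 1) at h
        omega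
      have h0 : w ⟨i, hi⟩ = 0 := sub_eq_zero.mpr (hy ⟨i, hi⟩ hy').symm
      refine Eq.trans ?_ (hy ⟨i, hi⟩ hy')
      refine add_eq_left.mpr ?_
      rcases hy' with hik | him'
      · obtain ⟨i, rfl⟩ : ∃ j : Fin (q + 2), i = j.castSucc :=
          ⟨i.castPred (by rintro rfl; exact absurd hik (Fin.not_lt.mpr (Fin.le_last k))), by simp⟩
        refine face_degen_eq_zero_of_horn_lt hw ?_ ⟨r.succ, hrk⟩ (Or.inr rfl) hi h0
        have : i.1 < k.1 := hik
        change i.1 < q + 1 - m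
        omega
      · obtain ⟨i, rfl⟩ : ∃ j : Fin (q + 2), i = j.succ :=
          ⟨i.pred (by rintro rfl; simp at him'; omega), by simp⟩
        refine face_degen_eq_zero_of_horn_gt hw ?_ hrk hi h0
        have : q + 3 ≤ i.1 + 1 + m := him'
        have : i.1 + 1 ≠ q + 1 - m + 1 := hir'
        change q + 1 - m < i.1
        omega
    · refine ⟨y, fun i hik => hy i ?_⟩
      have h1 : i.1.1 ≠ k.1 := fun h => i.2 (Fin.ext h)
      by_cases h2 : i.1.1 < k.1
      · exact Or.inl h2
      · refine Or.inr ?_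
        omega

variable (X) in
/-- Horns in a simplicial vector space have fillers. -/
theorem hornMap_surjective (q : ℕ) (k : Fin (q + 2)) : Function.Surjective (hornMap X q k) := by
  rintro ⟨z, hz⟩
  cases q with
  | zero =>
    have key : ∀ i : {i : Fin 2 // i ≠ k}, i.1 = 1 - k := by
      rintro ⟨i, hi⟩
      clear hz z
      revert i k
      decide
    let i₀ : {i : Fin 2 // i ≠ k} := ⟨1 - k, by clear key hz z; revert k; decide⟩
    -- A horn of dimension 1 is a single vertex, and its degenerate edge fills it.
    refine ⟨degen X 0 0 (z i₀), Subtype.ext (funext fun i => ?_)⟩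
    obtain rfl : i = i₀ := Subtype.ext (key i)
    change face X 0 i₀.1 (degen X 0 0 (z i₀)) = z i₀
    generalize i₀.1 = j
    fin_cases j
    · exact face_degen_castSucc X 0 0 _
    · exact face_degen_succ X 0 0 _
  | succ q =>
    obtain ⟨y, hy⟩ := exists_fill_above hz (q + 3)
    exact ⟨y, Subtype.ext (funext fun i => hy i (Or.inr (by omega)))⟩

end Kan

end ConstantCourant

end

noncomputable section

set_option linter.unusedSectionVars false

namespace ConstantCourant

/-! ### The model 2-groupoid of isotropic data -/

section Model

variable {W₁ W₀ : Type u} [AddCommGroup W₁] [Module ℝ W₁] [FiniteDimensional ℝ W₁]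
  [AddCommGroup W₀] [Module ℝ W₀] [FiniteDimensional ℝ W₀] (D : IsotropicData W₁ W₀)

/-- The adjoint `∂^* : W₀^* → W₁` of `∂`. -/
def IsotropicData.codel : Module.Dual ℝ W₀ →ₗ[ℝ] W₁ :=
  (D.pairing.toDual D.nondegenerate).symm.toLinearMap ∘ₗ D.del.dualMap

theorem IsotropicData.pairing_codel (ξ : Module.Dual ℝ W₀) (w : W₁) :
    D.pairing (D.codel ξ) w = ξ (D.del w) :=
  LinearMap.BilinForm.apply_toDual_symm_apply (hB := D.nondegenerate) (D.del.dualMap ξ) w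

theorem IsotropicData.pairing_codel_right (ξ : Module.Dual ℝ W₀) (w : W₁) :
    D.pairing w (D.codel ξ) = ξ (D.del w) :=
  (D.symm.eq (D.codel ξ) w).symm.trans (D.pairing_codel ξ w)

/-! ### The simplicial vector space of a complex `W₀^* → W₁ → W₀` -/

/-- Cochains on the simplex `Δ` with values in `W₀`, `W₁`, `W₀^*` in degrees 0, 1, 2. -/
abbrev ModelCochain (W₁ W₀ : Type u) [AddCommGroup W₁] [Module ℝ W₁] [AddCommGroup W₀]
    [Module ℝ W₀] (Δ : SimplexCategory) : Type u :=
  ((⦋0⦌ ⟶ Δ) → W₀) × ((⦋1⦌ ⟶ Δ) → W₁) × ((⦋2⦌ ⟶ Δ) → Module.Dual ℝ W₀)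

/-- The normalized cochains that define chain maps from the simplex `Δ` to `W₀^* → W₁ → W₀`. -/
def modelSimplices (Δ : SimplexCategory) : Submodule ℝ (ModelCochain W₁ W₀ Δ) where
  carrier := {x |
    (∀ f : ⦋0⦌ ⟶ Δ, x.2.1 (SimplexCategory.σ 0 ≫ f) = 0) ∧
    (∀ (f : ⦋1⦌ ⟶ Δ) (i : Fin 2), x.2.2 (SimplexCategory.σ i ≫ f) = 0) ∧
    (∀ f : ⦋1⦌ ⟶ Δ, D.del (x.2.1 f)
      = x.1 (SimplexCategory.δ 0 ≫ f) - x.1 (SimplexCategory.δ 1 ≫ f)) ∧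
    (∀ f : ⦋2⦌ ⟶ Δ, D.codel (x.2.2 f)
      = x.2.1 (SimplexCategory.δ 0 ≫ f) - x.2.1 (SimplexCategory.δ 1 ≫ f)
        + x.2.1 (SimplexCategory.δ 2 ≫ f)) ∧
    (∀ f : ⦋3⦌ ⟶ Δ, x.2.2 (SimplexCategory.δ 0 ≫ f) - x.2.2 (SimplexCategory.δ 1 ≫ f)
        + x.2.2 (SimplexCategory.δ 2 ≫ f) - x.2.2 (SimplexCategory.δ 3 ≫ f) = 0)}
  zero_mem' := by simp
  add_mem' := by
    rintro x y ⟨h1, h2, h3, h4, h5⟩ ⟨k1, k2, k3, k4, k5⟩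
    refine ⟨fun f => ?_, fun f i => ?_, fun f => ?_, fun f => ?_, fun f => ?_⟩
    · simp [h1, k1]
    · simp [h2, k2]
    · simp only [Prod.snd_add, Prod.fst_add, Pi.add_apply, map_add, h3, k3]
      abel
    · simp only [Prod.snd_add, Prod.fst_add, Pi.add_apply, map_add, h4, k4]
      abel
    · simp only [Prod.snd_add, Pi.add_apply]
      linear_combination (norm := module) h5 f + k5 f
  smul_mem' := by
    rintro c x ⟨h1, h2, h3, h4, h5⟩
    refine ⟨fun f => ?_, fun f i => ?_, fun f => ?_, fun f => ?_, fun f => ?_⟩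
    · simp [h1]
    · simp [h2]
    · simp only [Prod.smul_snd, Prod.smul_fst, Pi.smul_apply, map_smul, h3, smul_sub]
    · simp only [Prod.smul_snd, Prod.smul_fst, Pi.smul_apply, map_smul, h4, smul_sub, smul_add]
    · simp only [Prod.smul_snd, Pi.smul_apply]
      linear_combination (norm := module) c • h5 f

/-- Restriction of cochains along a simplicial operator. -/
def modelCochainMap {Δ Δ' : SimplexCategory} (g : Δ ⟶ Δ') :
    ModelCochain W₁ W₀ Δ' →ₗ[ℝ] ModelCochain W₁ W₀ Δ :=
  (LinearMap.funLeft ℝ W₀ fun f : ⦋0⦌ ⟶ Δ => f ≫ g).prodMap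
    ((LinearMap.funLeft ℝ W₁ fun f : ⦋1⦌ ⟶ Δ => f ≫ g).prodMap
      (LinearMap.funLeft ℝ (Module.Dual ℝ W₀) fun f : ⦋2⦌ ⟶ Δ => f ≫ g))

theorem modelCochainMap_mem {Δ Δ' : SimplexCategory} (g : Δ ⟶ Δ') (x : ModelCochain W₁ W₀ Δ')
    (hx : x ∈ modelSimplices D Δ') : modelCochainMap g x ∈ modelSimplices D Δ :=
  ⟨fun f => hx.1 (f ≫ g), fun f => hx.2.1 (f ≫ g), fun f => hx.2.2.1 (f ≫ g),
    fun f => hx.2.2.2.1 (f ≫ g), fun f => hx.2.2.2.2 (f ≫ g)⟩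

/-- The simplicial vector space whose normalized chain complex is `W₀^* → W₁ → W₀`. -/
def model : SVect.{u} where
  obj Δ := ModuleCat.of ℝ (modelSimplices D Δ.unop)
  map g := ModuleCat.ofHom
    ((modelCochainMap g.unop).restrict fun x hx => modelCochainMap_mem D g.unop x hx)
  map_id Δ := by
    refine ModuleCat.hom_ext (LinearMap.ext fun x => ?_)
    refine Subtype.ext (Prod.ext ?_ (Prod.ext ?_ ?_)) <;> funext f
    · exact congrArg x.1.1 (Category.comp_id f)
    · exact congrArg x.1.2.1 (Category.comp_id f)
    · exact congrArg x.1.2.2 (Category.comp_id f)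
  map_comp g h := by
    refine ModuleCat.hom_ext (LinearMap.ext fun x => ?_)
    refine Subtype.ext (Prod.ext ?_ (Prod.ext ?_ ?_)) <;> funext f
    · exact congrArg x.1.1 (Category.assoc f h.unop g.unop).symm
    · exact congrArg x.1.2.1 (Category.assoc f h.unop g.unop).symm
    · exact congrArg x.1.2.2 (Category.assoc f h.unop g.unop).symm

/-! ### Values on vertices, edges and triangles; unique horn fillers in the model -/

variable {n : ℕ}

/-- The value of a simplex on a vertex. -/
def vert (f : ⦋0⦌ ⟶ ⦋n⦌) : model D _⦋n⦌ →ₗ[ℝ] W₀ :=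
  LinearMap.proj f ∘ₗ LinearMap.fst ℝ _ _ ∘ₗ (modelSimplices D ⦋n⦌).subtype

/-- The value of a simplex on an edge. -/
def edge (f : ⦋1⦌ ⟶ ⦋n⦌) : model D _⦋n⦌ →ₗ[ℝ] W₁ :=
  LinearMap.proj f ∘ₗ LinearMap.fst ℝ _ _ ∘ₗ LinearMap.snd ℝ _ _ ∘ₗ
    (modelSimplices D ⦋n⦌).subtype

/-- The value of a simplex on a triangle. -/
def tri (f : ⦋2⦌ ⟶ ⦋n⦌) : model D _⦋n⦌ →ₗ[ℝ] Module.Dual ℝ W₀ :=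
  LinearMap.proj f ∘ₗ LinearMap.snd ℝ _ _ ∘ₗ LinearMap.snd ℝ _ _ ∘ₗ
    (modelSimplices D ⦋n⦌).subtype

variable {D}

theorem model_ext {x y : model D _⦋n⦌} (h0 : ∀ f, vert D f x = vert D f y)
    (h1 : ∀ f, edge D f x = edge D f y) (h2 : ∀ f, tri D f x = tri D f y) : x = y :=
  Subtype.ext (Prod.ext (funext h0) (Prod.ext (funext h1) (funext h2)))

theorem vert_face (i : Fin (n + 2)) (f : ⦋0⦌ ⟶ ⦋n⦌) (x : model D _⦋n + 1⦌) :
    vert D f (face (model D) n i x) = vert D (f ≫ SimplexCategory.δ i) x := rfl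

theorem edge_face (i : Fin (n + 2)) (f : ⦋1⦌ ⟶ ⦋n⦌) (x : model D _⦋n + 1⦌) :
    edge D f (face (model D) n i x) = edge D (f ≫ SimplexCategory.δ i) x := rfl

theorem tri_face (i : Fin (n + 2)) (f : ⦋2⦌ ⟶ ⦋n⦌) (x : model D _⦋n + 1⦌) :
    tri D f (face (model D) n i x) = tri D (f ≫ SimplexCategory.δ i) x := rfl

theorem edge_degen (i : Fin (n + 1)) (f : ⦋1⦌ ⟶ ⦋n + 1⦌) (x : model D _⦋n⦌) :
    edge D f (degen (model D) n i x) = edge D (f ≫ SimplexCategory.σ i) x := rfl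

theorem tri_degen (i : Fin (n + 1)) (f : ⦋2⦌ ⟶ ⦋n + 1⦌) (x : model D _⦋n⦌) :
    tri D f (degen (model D) n i x) = tri D (f ≫ SimplexCategory.σ i) x := rfl

theorem edge_σ_comp (f : ⦋0⦌ ⟶ ⦋n⦌) (x : model D _⦋n⦌) :
    edge D (SimplexCategory.σ 0 ≫ f) x = 0 := x.2.1 f

theorem tri_σ_comp (i : Fin 2) (f : ⦋1⦌ ⟶ ⦋n⦌) (x : model D _⦋n⦌) :
    tri D (SimplexCategory.σ i ≫ f) x = 0 := x.2.2.1 f i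

theorem del_edge (f : ⦋1⦌ ⟶ ⦋n⦌) (x : model D _⦋n⦌) :
    D.del (edge D f x)
      = vert D (SimplexCategory.δ 0 ≫ f) x - vert D (SimplexCategory.δ 1 ≫ f) x :=
  x.2.2.2.1 f

theorem codel_tri (f : ⦋2⦌ ⟶ ⦋n⦌) (x : model D _⦋n⦌) :
    D.codel (tri D f x)
      = edge D (SimplexCategory.δ 0 ≫ f) x - edge D (SimplexCategory.δ 1 ≫ f) x
        + edge D (SimplexCategory.δ 2 ≫ f) x :=
  x.2.2.2.2.1 f

theorem tri_cocycle (f : ⦋3⦌ ⟶ ⦋n⦌) (x : model D _⦋n⦌) :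
    tri D (SimplexCategory.δ 0 ≫ f) x - tri D (SimplexCategory.δ 1 ≫ f) x
      + tri D (SimplexCategory.δ 2 ≫ f) x - tri D (SimplexCategory.δ 3 ≫ f) x = 0 :=
  x.2.2.2.2.2 f

variable (D) in
theorem model_finite (n : ℕ) : FiniteDimensional ℝ (model D _⦋n⦌) :=
  inferInstanceAs (FiniteDimensional ℝ (modelSimplices D ⦋n⦌))

/-- An endomorphism of a simplex is the identity or factors through a degeneracy. -/
theorem eq_id_or_eq_σ_comp {m : ℕ} (g : ⦋m + 1⦌ ⟶ ⦋m + 1⦌) :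
    g = 𝟙 _ ∨ ∃ (i : Fin (m + 1)) (h : ⦋m⦌ ⟶ ⦋m + 1⦌), g = SimplexCategory.σ i ≫ h := by
  by_cases hg : Function.Injective g.toOrderHom
  · have : Mono g := SimplexCategory.mono_iff_injective.mpr hg
    exact Or.inl (SimplexCategory.eq_id_of_mono g)
  · exact Or.inr (SimplexCategory.eq_σ_comp_of_not_injective g hg)

/-- The image of `f` together with `k` has at most `m + 2` elements, so some vertex `i ≠ k` is
missed. Thus low-dimensional simplices are seen by the faces of a horn at `k`. -/
theorem exists_eq_comp_δ {m q : ℕ} (f : ⦋m⦌ ⟶ ⦋q + 1⦌) (k : Fin (q + 2)) (h : m + 2 < q + 2) :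
    ∃ i ≠ k, ∃ g : ⦋m⦌ ⟶ ⦋q⦌, f = g ≫ SimplexCategory.δ i := by
  classical
  let s : Finset (Fin (q + 2)) := insert k (Finset.univ.image f.toOrderHom)
  have hs : s.card < (Finset.univ : Finset (Fin (q + 2))).card := by
    have h1 := Finset.card_insert_le k (Finset.univ.image f.toOrderHom)
    have h2 := Finset.card_image_le (s := Finset.univ) (f := f.toOrderHom)
    simp only [Finset.card_univ, Fintype.card_fin, SimplexCategory.len_mk] at h1 h2 ⊢
    change s.card ≤ _ at h1
    omega
  obtain ⟨i, -, hi⟩ := Finset.exists_mem_notMem_of_card_lt_card hs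
  have hi' : i ≠ k ∧ ∀ x, f.toOrderHom x ≠ i := by
    constructor
    · rintro rfl
      exact hi (Finset.mem_insert_self _ _)
    · rintro x rfl
      exact hi (Finset.mem_insert_of_mem (Finset.mem_image_of_mem _ (Finset.mem_univ x)))
  exact ⟨i, hi'.1, SimplexCategory.eq_comp_δ_of_not_surjective' f i hi'.2⟩

theorem exists_eq_comp_δ_of_lt {m q : ℕ} (f : ⦋m⦌ ⟶ ⦋q + 1⦌) (h : m < q + 1) :
    ∃ i, ∃ g : ⦋m⦌ ⟶ ⦋q⦌, f = g ≫ SimplexCategory.δ i := by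
  refine SimplexCategory.eq_comp_δ_of_not_surjective f fun hf => ?_
  have := Fintype.card_le_of_surjective _ hf
  simp at this
  omega

theorem edge_self_of_edge_id {x : model D _⦋1⦌} (h : edge D (𝟙 _) x = 0) (g : ⦋1⦌ ⟶ ⦋1⦌) :
    edge D g x = 0 := by
  rcases eq_id_or_eq_σ_comp g with rfl | ⟨i, g, rfl⟩
  · exact h
  · fin_cases i
    exact edge_σ_comp g x

theorem tri_self_of_tri_id {x : model D _⦋2⦌} (h : tri D (𝟙 _) x = 0) (g : ⦋2⦌ ⟶ ⦋2⦌) :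
    tri D g x = 0 := by
  rcases eq_id_or_eq_σ_comp g with rfl | ⟨i, g, rfl⟩
  · exact h
  · exact tri_σ_comp i g x

theorem edge_vertex (f : ⦋1⦌ ⟶ ⦋0⦌) (x : model D _⦋0⦌) : edge D f x = 0 := by
  obtain ⟨i, g, rfl⟩ := SimplexCategory.eq_σ_comp_of_not_injective f
    fun hf => by simpa using Fintype.card_le_of_injective _ hf
  fin_cases i
  exact edge_σ_comp g x

theorem tri_of_lt (hn : n < 2) (f : ⦋2⦌ ⟶ ⦋n⦌) (x : model D _⦋n⦌) : tri D f x = 0 := by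
  obtain ⟨i, g, rfl⟩ := SimplexCategory.eq_σ_comp_of_not_injective f
    fun hf => by
      have := Fintype.card_le_of_injective _ hf
      simp at this
      omega
  exact tri_σ_comp i g x

theorem model_zero_ext {x y : model D _⦋0⦌} (h : vert D (𝟙 _) x = vert D (𝟙 _) y) : x = y := by
  refine model_ext (fun f => ?_) (fun f => ?_) (fun f => ?_)
  · rwa [Subsingleton.elim f (𝟙 _)]
  · rw [edge_vertex, edge_vertex]
  · rw [tri_of_lt two_pos, tri_of_lt two_pos]

/-- The two vertices of an edge differ by `∂` of its value, so one vertex and the value in `W₁`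
determine it. -/
theorem model_one_eq_zero {x : model D _⦋1⦌} (k : Fin 2)
    (h : ∀ i ≠ k, face (model D) 0 i x = 0) (h1 : edge D (𝟙 _) x = 0) : x = 0 := by
  have hv : vert D (SimplexCategory.δ 0) x = vert D (SimplexCategory.δ 1) x := by
    have := del_edge (𝟙 _) x
    rw [h1, map_zero] at this
    exact (sub_eq_zero.mp this.symm)
  have h0 : ∀ i, vert D (SimplexCategory.δ i) x = 0 := by
    have hk : ∀ i ≠ k, vert D (SimplexCategory.δ i) x = 0 := fun i hi => by
      have := vert_face i (𝟙 _) x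
      rw [h i hi, map_zero] at this
      exact this.symm
    have h01 : vert D (SimplexCategory.δ 0) x = 0 ∧ vert D (SimplexCategory.δ 1) x = 0 := by
      by_cases h0k : 0 = k
      · have := hk 1 (by rw [← h0k]; decide)
        exact ⟨hv.trans this, this⟩
      · have := hk 0 h0k
        exact ⟨this, hv.symm.trans this⟩
    intro i
    fin_cases i
    exacts [h01.1, h01.2]
  refine model_ext (fun f => ?_) (fun f => ?_) (fun f => ?_) <;> rw [map_zero]
  · obtain ⟨i, g, rfl⟩ := exists_eq_comp_δ_of_lt f one_pos
    rw [Subsingleton.elim g (𝟙 _)]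
    exact h0 i
  · exact edge_self_of_edge_id h1 f
  · rw [tri_of_lt one_lt_two]

/-- The edges of faces 1 and 2 vanish, hence so does that of face 0, because the alternating sum of
the three is `∂^*` of the triangle. All faces are then zero. -/
theorem model_two_eq_zero {x : model D _⦋2⦌} (h1 : face (model D) 1 1 x = 0)
    (h2 : face (model D) 1 2 x = 0) (hx : tri D (𝟙 _) x = 0) : x = 0 := by
  have e1 : ∀ g, edge D (g ≫ SimplexCategory.δ 1) x = 0 := fun g => by
    rw [← edge_face, h1, map_zero]
  have e2 : ∀ g, edge D (g ≫ SimplexCategory.δ 2) x = 0 := fun g => by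
    rw [← edge_face, h2, map_zero]
  have h0 : face (model D) 1 0 x = 0 := by
    refine model_one_eq_zero 0 (fun i hi => ?_) ?_
    · fin_cases i
      · exact absurd rfl hi
      · have := face_face (model D) 0 (i := 0) (j := 1) (by decide) x
        refine this.symm.trans ?_
        exact (congrArg _ h2).trans (map_zero _)
    · have := codel_tri (𝟙 _) x
      have e1' := e1 (𝟙 _)
      have e2' := e2 (𝟙 _)
      rw [edge_face]
      simp only [Category.id_comp, Category.comp_id, hx, map_zero] at *
      rw [e1', e2'] at this
      simpa using this.symm
  have h : ∀ i, face (model D) 1 i x = 0 := fun i => by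
    fin_cases i
    exacts [h0, h1, h2]
  refine model_ext (fun f => ?_) (fun f => ?_) (fun f => ?_) <;> rw [map_zero]
  · obtain ⟨i, g, rfl⟩ := exists_eq_comp_δ_of_lt f two_pos
    rw [← vert_face, h, map_zero]
  · obtain ⟨i, g, rfl⟩ := exists_eq_comp_δ_of_lt f one_lt_two
    rw [← edge_face, h, map_zero]
  · exact tri_self_of_tri_id hx f

/-- Simplices of the model carry values only on vertices, edges and triangles. From dimension 4 on,
each of these lies in a face other than `k`. In dimension 3 only the triangle opposite `k` is
missing, and the cocycle condition recovers it from the other three. -/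
theorem model_eq_zero_of_horn {q : ℕ} (hq : 2 < q + 1) (k : Fin (q + 2)) {x : model D _⦋q + 1⦌}
    (h : ∀ i ≠ k, face (model D) q i x = 0) : x = 0 := by
  have ht : ∀ (i : Fin (q + 2)) (g : ⦋2⦌ ⟶ ⦋q⦌), i ≠ k → tri D (g ≫ SimplexCategory.δ i) x = 0 :=
    fun i g hi => by rw [← tri_face, h i hi, map_zero]
  refine model_ext (fun f => ?_) (fun f => ?_) (fun f => ?_) <;> rw [map_zero]
  · obtain ⟨i, hi, g, rfl⟩ := exists_eq_comp_δ f k (by omega)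
    rw [← vert_face, h i hi, map_zero]
  · obtain ⟨i, hi, g, rfl⟩ := exists_eq_comp_δ f k (by omega)
    rw [← edge_face, h i hi, map_zero]
  · rcases eq_or_lt_of_le (Nat.succ_le_of_lt hq) with hq' | hq'
    · obtain rfl : q = 2 := by omega
      obtain ⟨i, g, rfl⟩ := exists_eq_comp_δ_of_lt f hq
      by_cases hi : i = k
      · subst hi
        rw [← tri_face]
        refine tri_self_of_tri_id ?_ g
        have hc := tri_cocycle (𝟙 _) x
        have e := fun j hj => ht j (𝟙 _) hj
        rw [tri_face]
        simp only [Category.id_comp, Category.comp_id] at e hc ⊢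
        have e0 := e 0
        have e1 := e 1
        have e2 := e 2
        have e3 := e 3
        fin_cases i <;> simp_all
      · exact ht i g hi
    · obtain ⟨i, hi, g, rfl⟩ := exists_eq_comp_δ f k (by omega)
      exact ht i g hi

variable (D) in
/-- The linear 2-groupoid of the complex `W₀^* → W₁ → W₀`. -/
def modelGroupoid : LinearTwoGroupoid.{u} where
  X := model D
  finite := model_finite D
  horn_surjective := hornMap_surjective (model D)
  horn_bijective q k hq := by
    refine ⟨(injective_iff_map_eq_zero _).mpr fun x hx => ?_, hornMap_surjective (model D) q k⟩
    refine model_eq_zero_of_horn hq k fun i hi => ?_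
    exact congrArg (fun z : hornSpace (model D) q k => z.1 ⟨i, hi⟩) hx

end Model

end ConstantCourant

end

noncomputable section

set_option linter.unusedSectionVars false

namespace ConstantCourant

/-! ### Representatives modulo degenerate simplices -/

section Reduction

variable (X : SVect.{u})

theorem degen_mem_degenerate (q : ℕ) (i : Fin (q + 1)) (x : X _⦋q⦌) :
    degen X q i x ∈ degenerate X q :=
  Submodule.mem_iSup_of_mem i (LinearMap.mem_range_self _ x)

theorem exists_sub_mem_degenerate_one (x : X _⦋1⦌) :
    ∃ y : X _⦋1⦌, x - y ∈ degenerate X 0 ∧ face X 0 1 y = 0 := by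
  refine ⟨x - degen X 0 0 (face X 0 1 x), ?_, ?_⟩
  · rw [sub_sub_cancel]
    exact degen_mem_degenerate X 0 0 _
  · rw [map_sub, sub_eq_zero]
    exact (face_degen_succ X 0 0 _).symm

/-- Subtract `σ_1 d_2`, then `σ_0 d_1`. The second step keeps face 2 zero, since `d_2 σ_0 d_1 z =
σ_0 d_1 d_1 z = σ_0 d_1 d_2 z = 0`. Classes modulo degenerates are thus represented in the Moore
complex. -/
theorem exists_sub_mem_degenerate_two (x : X _⦋2⦌) :
    ∃ y : X _⦋2⦌, x - y ∈ degenerate X 1 ∧ face X 1 1 y = 0 ∧ face X 1 2 y = 0 := by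
  let z : X _⦋2⦌ := x - degen X 1 1 (face X 1 2 x)
  have hz : face X 1 2 z = 0 := by
    rw [map_sub, sub_eq_zero]
    exact (face_degen_succ X 1 1 _).symm
  refine ⟨z - degen X 1 0 (face X 1 1 z), ?_, ?_, ?_⟩
  · have : x - (z - degen X 1 0 (face X 1 1 z))
        = degen X 1 1 (face X 1 2 x) + degen X 1 0 (face X 1 1 z) := by
      simp only [z]
      abel
    rw [this]
    exact add_mem (degen_mem_degenerate X 1 1 _) (degen_mem_degenerate X 1 0 _)
  · rw [map_sub, sub_eq_zero]
    exact (face_degen_succ X 1 0 _).symm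
  · rw [map_sub, hz, zero_sub, neg_eq_zero]
    have h1 : face X 1 2 (degen X 1 0 (face X 1 1 z)) = degen X 0 0 (face X 0 1 (face X 1 1 z)) :=
      face_degen_of_gt X 0 (i := 1) (j := 0) (by decide) _
    have h2 : face X 0 1 (face X 1 2 z) = face X 0 1 (face X 1 1 z) :=
      face_face X 0 (i := 1) (j := 1) le_rfl z
    rw [h1, ← h2, hz, map_zero, map_zero]

end Reduction

/-! ### Coboundaries in low degree and constant 2-forms -/

section Constant

variable {X : SVect.{u}}

theorem coboundary_two_apply (ω : X _⦋2⦌ → LinearMap.BilinForm ℝ (X _⦋2⦌)) (y u v : X _⦋3⦌) :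
    coboundary X 2 ω y u v
      = ω (face X 2 0 y) (face X 2 0 u) (face X 2 0 v)
        - ω (face X 2 1 y) (face X 2 1 u) (face X 2 1 v)
        + ω (face X 2 2 y) (face X 2 2 u) (face X 2 2 v)
        - ω (face X 2 3 y) (face X 2 3 u) (face X 2 3 v) := by
  unfold coboundary
  rw [Fin.sum_univ_four]
  simp only [Fin.val_zero, Fin.val_one, pow_zero, pow_one, LinearMap.add_apply,
    LinearMap.smul_apply, pullback, LinearMap.compl₁₂_apply, smul_eq_mul]
  norm_num
  ring

theorem coboundary_one_apply (α : X _⦋1⦌ → LinearMap.BilinForm ℝ (X _⦋1⦌)) (y u v : X _⦋2⦌) :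
    coboundary X 1 α y u v
      = α (face X 1 0 y) (face X 1 0 u) (face X 1 0 v)
        - α (face X 1 1 y) (face X 1 1 u) (face X 1 1 v)
        + α (face X 1 2 y) (face X 1 2 u) (face X 1 2 v) := by
  unfold coboundary
  rw [Fin.sum_univ_three]
  simp only [Fin.val_zero, Fin.val_one, pow_zero, pow_one, LinearMap.add_apply,
    LinearMap.smul_apply, pullback, LinearMap.compl₁₂_apply, smul_eq_mul]
  norm_num
  ring

variable {V : Type u} [AddCommGroup V] [Module ℝ V] [FiniteDimensional ℝ V]

theorem isTwoForm_const {ω : LinearMap.BilinForm ℝ V} (h : ω.IsAlt) :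
    IsTwoForm fun _ : V => ω :=
  ⟨fun _ => h, fun _ _ => SmoothFun.const _⟩

theorem isClosedForm_const (ω : LinearMap.BilinForm ℝ V) : IsClosedForm fun _ : V => ω := by
  intro x u v w
  simp [lineDeriv]

end Constant

section Model

variable {W₁ W₀ : Type u} [AddCommGroup W₁] [Module ℝ W₁] [FiniteDimensional ℝ W₁]
  [AddCommGroup W₀] [Module ℝ W₀] [FiniteDimensional ℝ W₀] (D : IsotropicData W₁ W₀)

/-! ### Special simplices of the model -/

theorem IsotropicData.del_codel (ξ : Module.Dual ℝ W₀) : D.del (D.codel ξ) = 0 :=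
  congrArg (fun L => L ξ) D.isotropic

/-- The totally degenerate simplex at a vector. -/
def constSimplex (n : ℕ) (v : W₀) : model D _⦋n⦌ :=
  ⟨(fun _ => v, 0, 0), by simp [modelSimplices]⟩

/-- The coboundary of a function with values in `W₁`. -/
def vertexSimplex {n : ℕ} (B : (⦋0⦌ ⟶ ⦋n⦌) → W₁) : model D _⦋n⦌ :=
  ⟨(fun f => D.del (B f),
    fun f => B (SimplexCategory.δ 0 ≫ f) - B (SimplexCategory.δ 1 ≫ f), 0), by
    refine ⟨fun f => ?_, fun f i => rfl, fun f => map_sub _ _ _, fun f => ?_, fun f => by simp⟩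
    · have e : SimplexCategory.δ (0 : Fin 2) ≫ SimplexCategory.σ 0 ≫ f
          = SimplexCategory.δ 1 ≫ SimplexCategory.σ 0 ≫ f := by
        rw [← Category.assoc, ← Category.assoc]
        exact congrArg (· ≫ f) (by decide)
      exact sub_eq_zero.mpr (congrArg B e)
    · have e : ∀ g h k l, SimplexCategory.δ (n := 0) g ≫ SimplexCategory.δ h
          = SimplexCategory.δ k ≫ SimplexCategory.δ l → B (SimplexCategory.δ g ≫
            SimplexCategory.δ h ≫ f) = B (SimplexCategory.δ k ≫ SimplexCategory.δ l ≫ f) := by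
        intro g h k l e
        rw [← Category.assoc, e, Category.assoc]
      change D.codel 0 = _
      dsimp only
      rw [map_zero, e 0 1 0 0 (by decide), e 1 1 1 2 (by decide), e 1 0 0 2 (by decide)]
      abel⟩

/-- The coboundary of a normalized 1-cochain with values in `W₀^*`. -/
def edgeSimplex {n : ℕ} (C : (⦋1⦌ ⟶ ⦋n⦌) → Module.Dual ℝ W₀)
    (hC : ∀ f : ⦋0⦌ ⟶ ⦋n⦌, C (SimplexCategory.σ 0 ≫ f) = 0) : model D _⦋n⦌ :=
  ⟨(0, fun f => D.codel (C f), fun f => C (SimplexCategory.δ 0 ≫ f)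
      - C (SimplexCategory.δ 1 ≫ f) + C (SimplexCategory.δ 2 ≫ f)), by
    refine ⟨fun f => ?_, fun f i => ?_, fun f => ?_, fun f => ?_, fun f => ?_⟩
    · simp [hC]
    · have e : ∀ g (h : ⦋1⦌ ⟶ ⦋1⦌), SimplexCategory.δ (n := 1) g ≫ SimplexCategory.σ i = h →
          C (SimplexCategory.δ g ≫ SimplexCategory.σ i ≫ f) = C (h ≫ f) := by
        intro g h e
        rw [← Category.assoc, e]
      dsimp only
      fin_cases i
      · rw [e 0 (𝟙 _) (by decide), e 1 (𝟙 _) (by decide),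
          e 2 (SimplexCategory.σ 0 ≫ SimplexCategory.δ 1) (by decide), Category.assoc, hC]
        simp
      · rw [e 0 (SimplexCategory.σ 0 ≫ SimplexCategory.δ 0) (by decide), e 1 (𝟙 _) (by decide),
          e 2 (𝟙 _) (by decide), Category.assoc, hC]
        simp
    · simp [D.del_codel]
    · simp
    · have e : ∀ g h k l, SimplexCategory.δ (n := 1) g ≫ SimplexCategory.δ h
          = SimplexCategory.δ k ≫ SimplexCategory.δ l → C (SimplexCategory.δ g ≫
            SimplexCategory.δ h ≫ f) = C (SimplexCategory.δ k ≫ SimplexCategory.δ l ≫ f) := by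
        intro g h k l e
        rw [← Category.assoc, e, Category.assoc]
      dsimp only
      rw [e 0 1 0 0 (by decide), e 0 2 1 0 (by decide), e 0 3 2 0 (by decide),
        e 1 2 1 1 (by decide), e 1 3 2 1 (by decide), e 2 3 2 2 (by decide)]
      abel⟩

theorem exists_edge_id (w : W₁) : ∃ x : model D _⦋1⦌, edge D (𝟙 _) x = w := by
  -- The coboundary of the 0-cochain supported at vertex 1 with value `w`: the edge from 0 to 1
  -- receives `w - 0`.
  refine ⟨vertexSimplex D fun f => if f = SimplexCategory.δ 0 then w else 0, ?_⟩
  change (if SimplexCategory.δ 0 ≫ 𝟙 _ = _ then w else 0)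
    - (if SimplexCategory.δ 1 ≫ 𝟙 _ = _ then w else 0) = w
  rw [if_pos (by decide), if_neg (by decide), sub_zero]

theorem exists_tri_id (ξ : Module.Dual ℝ W₀) : ∃ x : model D _⦋2⦌, tri D (𝟙 _) x = ξ := by
  -- The coboundary of the 1-cochain supported on the edge from 1 to 2. This edge is nondegenerate,
  -- so the cochain is normalized, and it enters the boundary of the triangle once, with sign `+`.
  refine ⟨edgeSimplex D (fun f => if f = SimplexCategory.δ 0 then ξ else 0) fun f => ?_, ?_⟩
  · refine if_neg fun h => ?_
    have h0 := congrArg (fun g => g.toOrderHom 0) h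
    have h1 := congrArg (fun g => g.toOrderHom 1) h
    have : (SimplexCategory.δ (n := 1) 0).toOrderHom 0
        = (SimplexCategory.δ (n := 1) 0).toOrderHom 1 := h0.symm.trans h1
    exact absurd this (by decide)
  · change (if SimplexCategory.δ 0 ≫ 𝟙 _ = _ then ξ else 0)
      - (if SimplexCategory.δ 1 ≫ 𝟙 _ = _ then ξ else 0)
      + (if SimplexCategory.δ 2 ≫ 𝟙 _ = _ then ξ else 0) = ξ
    rw [if_pos (by decide), if_neg (by decide), if_neg (by decide), sub_zero, add_zero]

theorem vert_bijective : Function.Bijective (vert D (𝟙 ⦋0⦌)) :=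
  ⟨fun _ _ h => model_zero_ext h, fun v => ⟨constSimplex D 0 v, rfl⟩⟩

theorem degenerate_le_ker_edge : degenerate (model D) 0 ≤ LinearMap.ker (edge D (𝟙 ⦋1⦌)) := by
  refine iSup_le fun i => ?_
  rintro _ ⟨v, rfl⟩
  fin_cases i
  exact edge_vertex _ v

theorem degenerate_le_ker_tri : degenerate (model D) 1 ≤ LinearMap.ker (tri D (𝟙 ⦋2⦌)) := by
  refine iSup_le fun i => ?_
  rintro _ ⟨v, rfl⟩
  exact tri_of_lt one_lt_two _ v

/-- A representative with vanishing face 1 and vanishing edge value is zero. Together with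
`degenerate_le_ker_edge` this makes `T̂_1` of the model isomorphic to `W₁`. -/
theorem mem_degenerate_of_edge {x : model D _⦋1⦌} (hx : edge D (𝟙 _) x = 0) :
    x ∈ degenerate (model D) 0 := by
  obtain ⟨y, hxy, hy⟩ := exists_sub_mem_degenerate_one (model D) x
  have h := degenerate_le_ker_edge D hxy
  rw [LinearMap.mem_ker, map_sub, hx, zero_sub, neg_eq_zero] at h
  have : y = 0 := model_one_eq_zero 0 (fun i hi => by
    fin_cases i
    · exact absurd rfl hi
    · exact hy) h
  rwa [this, sub_zero] at hxy

theorem mem_degenerate_of_tri {x : model D _⦋2⦌} (hx : tri D (𝟙 _) x = 0) :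
    x ∈ degenerate (model D) 1 := by
  obtain ⟨y, hxy, hy1, hy2⟩ := exists_sub_mem_degenerate_two (model D) x
  have h := degenerate_le_ker_tri D hxy
  rw [LinearMap.mem_ker, map_sub, hx, zero_sub, neg_eq_zero] at h
  have : y = 0 := model_two_eq_zero hy1 hy2 h
  rwa [this, sub_zero] at hxy

/-- The identification of the vertices of the model with `W₀`. -/
def modelMark₀ : model D _⦋0⦌ ≃ₗ[ℝ] W₀ :=
  LinearEquiv.ofBijective (vert D (𝟙 ⦋0⦌)) (vert_bijective D)

/-- The identification of the tangent space of the model in degree 1 with `W₁`. -/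
def modelMark₁ : NormTangent (model D) 0 ≃ₗ[ℝ] W₁ :=
  LinearEquiv.ofBijective ((degenerate (model D) 0).liftQ _ (degenerate_le_ker_edge D)) <| by
    constructor
    · refine (injective_iff_map_eq_zero _).mpr fun x => ?_
      obtain ⟨x, rfl⟩ := Submodule.Quotient.mk_surjective _ x
      intro hx
      exact (Submodule.Quotient.mk_eq_zero _).mpr (mem_degenerate_of_edge D hx)
    · intro w
      obtain ⟨x, hx⟩ := exists_edge_id D w
      exact ⟨Submodule.Quotient.mk x, hx⟩

/-! ### The symplectic form of the model -/

/-- The cup product of cochains, with respect to the pairing of `W₁` and the canonical pairing of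
`W₀` and `W₀^*`. -/
def cupForm : LinearMap.BilinForm ℝ (model D _⦋2⦌) :=
  D.pairing.compl₁₂ (edge D (SimplexCategory.δ 2)) (edge D (SimplexCategory.δ 0))
    + (tri D (𝟙 _)).flip.comp (vert D (SimplexCategory.const _ _ 0))
    - (tri D (𝟙 _)).compl₂ (vert D (SimplexCategory.const _ _ 2))

theorem cupForm_apply (x y : model D _⦋2⦌) :
    cupForm D x y
      = D.pairing (edge D (SimplexCategory.δ 2) x) (edge D (SimplexCategory.δ 0) y)
        + tri D (𝟙 _) y (vert D (SimplexCategory.const _ _ 0) x)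
        - tri D (𝟙 _) x (vert D (SimplexCategory.const _ _ 2) y) := rfl

theorem cupForm_face (i : Fin 4) (x y : model D _⦋3⦌) :
    cupForm D (face (model D) 2 i x) (face (model D) 2 i y)
      = D.pairing (edge D (SimplexCategory.δ 2 ≫ SimplexCategory.δ i) x)
          (edge D (SimplexCategory.δ 0 ≫ SimplexCategory.δ i) y)
        + tri D (SimplexCategory.δ i) y
            (vert D (SimplexCategory.const _ _ 0 ≫ SimplexCategory.δ i) x)
        - tri D (SimplexCategory.δ i) x
            (vert D (SimplexCategory.const _ _ 2 ≫ SimplexCategory.δ i) y) := rfl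

/-- The Leibniz rule for a cup product of cocycles. The terms with the metric of `W₁` reduce, by
`codel_tri` and adjointness of `∂` and `∂^*`, to `x₀₁₂(y₃ - y₂) - y₁₂₃(x₁ - x₀)`. The two evaluation
terms, through `tri_cocycle`, contribute the negative of this; it fixes their signs in `cupForm`. -/
theorem cupForm_cocycle (x y : model D _⦋3⦌) :
    cupForm D (face (model D) 2 0 x) (face (model D) 2 0 y)
      - cupForm D (face (model D) 2 1 x) (face (model D) 2 1 y)
      + cupForm D (face (model D) 2 2 x) (face (model D) 2 2 y)
      - cupForm D (face (model D) 2 3 x) (face (model D) 2 3 y) = 0 := by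
  simp only [cupForm_face]
  have hx := codel_tri (SimplexCategory.δ 3) x
  have hy := codel_tri (SimplexCategory.δ 0) y
  have hx' := congrArg (fun ξ : Module.Dual ℝ W₀ => ξ (vert D (SimplexCategory.const _ _ 3) y))
    (tri_cocycle (𝟙 _) x)
  have hy' := congrArg (fun ξ : Module.Dual ℝ W₀ => ξ (vert D (SimplexCategory.const _ _ 0) x))
    (tri_cocycle (𝟙 _) y)
  have ex := del_edge (SimplexCategory.δ (n := 1) 2 ≫ SimplexCategory.δ 2) x
  have ey := del_edge (SimplexCategory.δ (n := 1) 0 ≫ SimplexCategory.δ 0) y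
  have hcx := D.pairing_codel (tri D (SimplexCategory.δ 3) x)
    (edge D (SimplexCategory.δ 0 ≫ SimplexCategory.δ 0) y)
  have hcy := D.pairing_codel_right (tri D (SimplexCategory.δ 0) y)
    (edge D (SimplexCategory.δ 2 ≫ SimplexCategory.δ 2) x)
  have f1 : SimplexCategory.δ (n := 1) 0 ≫ SimplexCategory.δ 1
    = SimplexCategory.δ 0 ≫ SimplexCategory.δ 0 := by decide
  have f2 : SimplexCategory.δ (n := 1) 0 ≫ SimplexCategory.δ 2
    = SimplexCategory.δ 1 ≫ SimplexCategory.δ 0 := by decide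
  have f3 : SimplexCategory.δ (n := 1) 0 ≫ SimplexCategory.δ 3
    = SimplexCategory.δ 2 ≫ SimplexCategory.δ 0 := by decide
  have f4 : SimplexCategory.δ (n := 1) 1 ≫ SimplexCategory.δ 3
    = SimplexCategory.δ 2 ≫ SimplexCategory.δ 1 := by decide
  have f5 : SimplexCategory.δ (n := 1) 2 ≫ SimplexCategory.δ 3
    = SimplexCategory.δ 2 ≫ SimplexCategory.δ 2 := by decide
  have c00 : SimplexCategory.const ⦋0⦌ ⦋2⦌ 0 ≫ SimplexCategory.δ 0
    = SimplexCategory.const ⦋0⦌ ⦋3⦌ 1 := by decide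
  have c01 : SimplexCategory.const ⦋0⦌ ⦋2⦌ 0 ≫ SimplexCategory.δ 1
    = SimplexCategory.const ⦋0⦌ ⦋3⦌ 0 := by decide
  have c02 : SimplexCategory.const ⦋0⦌ ⦋2⦌ 0 ≫ SimplexCategory.δ 2
    = SimplexCategory.const ⦋0⦌ ⦋3⦌ 0 := by decide
  have c03 : SimplexCategory.const ⦋0⦌ ⦋2⦌ 0 ≫ SimplexCategory.δ 3
    = SimplexCategory.const ⦋0⦌ ⦋3⦌ 0 := by decide
  have c20 : SimplexCategory.const ⦋0⦌ ⦋2⦌ 2 ≫ SimplexCategory.δ 0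
    = SimplexCategory.const ⦋0⦌ ⦋3⦌ 3 := by decide
  have c21 : SimplexCategory.const ⦋0⦌ ⦋2⦌ 2 ≫ SimplexCategory.δ 1
    = SimplexCategory.const ⦋0⦌ ⦋3⦌ 3 := by decide
  have c22 : SimplexCategory.const ⦋0⦌ ⦋2⦌ 2 ≫ SimplexCategory.δ 2
    = SimplexCategory.const ⦋0⦌ ⦋3⦌ 3 := by decide
  have c23 : SimplexCategory.const ⦋0⦌ ⦋2⦌ 2 ≫ SimplexCategory.δ 3
    = SimplexCategory.const ⦋0⦌ ⦋3⦌ 2 := by decide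
  have g1 : SimplexCategory.δ (n := 0) 0 ≫ SimplexCategory.δ 2 ≫ SimplexCategory.δ 2
    = SimplexCategory.const ⦋0⦌ ⦋3⦌ 1 := by decide
  have g2 : SimplexCategory.δ (n := 0) 1 ≫ SimplexCategory.δ 2 ≫ SimplexCategory.δ 2
    = SimplexCategory.const ⦋0⦌ ⦋3⦌ 0 := by decide
  have g3 : SimplexCategory.δ (n := 0) 0 ≫ SimplexCategory.δ 0 ≫ SimplexCategory.δ 0
    = SimplexCategory.const ⦋0⦌ ⦋3⦌ 3 := by decide
  have g4 : SimplexCategory.δ (n := 0) 1 ≫ SimplexCategory.δ 0 ≫ SimplexCategory.δ 0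
    = SimplexCategory.const ⦋0⦌ ⦋3⦌ 2 := by decide
  rw [hx, ey, f3, f4, f5, g3, g4] at hcx
  rw [hy, ex, g1, g2] at hcy
  rw [f1, f2, f3, f5, c00, c01, c02, c03, c20, c21, c22, c23]
  simp only [Category.comp_id, map_add, map_sub, LinearMap.add_apply, LinearMap.sub_apply,
    LinearMap.zero_apply] at hcx hcy hx' hy' ⊢
  linarith

/-- The symplectic form of the model. -/
def modelForm : LinearMap.BilinForm ℝ (model D _⦋2⦌) :=
  -- With the factor 1/2, `A` is exactly evaluation and `B` exactly the metric: in both cases two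
  -- equal halves add up.
  (1 / 2 : ℝ) • (cupForm D - (cupForm D).flip)

theorem modelForm_apply (x y : model D _⦋2⦌) :
    modelForm D x y = 1 / 2 * (cupForm D x y - cupForm D y x) := rfl

theorem modelForm_isAlt : (modelForm D).IsAlt := fun x => by
  rw [modelForm_apply, sub_self, mul_zero]

theorem modelForm_multiplicative : IsMultiplicative (model D) 2 fun _ => modelForm D := by
  funext z
  refine LinearMap.ext fun x => LinearMap.ext fun y => ?_
  rw [coboundary_two_apply]
  simp only [modelForm_apply, Pi.zero_apply, LinearMap.zero_apply]
  have h1 := cupForm_cocycle D x y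
  have h2 := cupForm_cocycle D y x
  linarith

/-- Triangles of a degenerate simplex have value zero. For `σ_0` the edge 01 is degenerate, and for
`σ_1` the edge 12, so the metric term vanishes too. -/
theorem cupForm_degen (i : Fin 2) (x y : model D _⦋1⦌) :
    cupForm D (degen (model D) 1 i x) (degen (model D) 1 i y) = 0 := by
  rw [cupForm_apply, tri_degen, tri_of_lt one_lt_two, tri_degen, tri_of_lt one_lt_two,
    edge_degen, edge_degen]
  fin_cases i
  · have : SimplexCategory.δ (n := 1) 2 ≫ SimplexCategory.σ 0
      = SimplexCategory.σ 0 ≫ SimplexCategory.δ 1 := by decide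
    change D.pairing (edge D (SimplexCategory.δ (n := 1) 2 ≫ SimplexCategory.σ 0) x) _ + _ - _ = _
    rw [this, edge_σ_comp]
    simp
  · have : SimplexCategory.δ (n := 1) 0 ≫ SimplexCategory.σ 1
      = SimplexCategory.σ 0 ≫ SimplexCategory.δ 0 := by decide
    change D.pairing _ (edge D (SimplexCategory.δ (n := 1) 0 ≫ SimplexCategory.σ 1) y) + _ - _ = _
    rw [this, edge_σ_comp]
    simp

theorem modelForm_normalized : IsNormalized (model D) 1 fun _ => modelForm D := by
  intro i
  funext z
  refine LinearMap.ext fun x => LinearMap.ext fun y => ?_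
  change modelForm D (degen (model D) 1 i x) (degen (model D) 1 i y) = 0
  rw [modelForm_apply, cupForm_degen, cupForm_degen, sub_self, mul_zero]

theorem edge_unitTwo (f : ⦋1⦌ ⟶ ⦋2⦌) (v : model D _⦋0⦌) : edge D f (unitTwo (model D) v) = 0 :=
  edge_vertex _ v

theorem tri_unitTwo (f : ⦋2⦌ ⟶ ⦋2⦌) (v : model D _⦋0⦌) : tri D f (unitTwo (model D) v) = 0 :=
  tri_of_lt two_pos _ v

theorem vert_unitTwo (f : ⦋0⦌ ⟶ ⦋2⦌) (v : model D _⦋0⦌) :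
    vert D f (unitTwo (model D) v) = vert D (𝟙 _) v :=
  congrArg (fun g => vert D g v) (Subsingleton.elim _ _)

theorem modelForm_unitTwo (v : model D _⦋0⦌) (w : model D _⦋2⦌) :
    modelForm D (unitTwo (model D) v) w = tri D (𝟙 _) w (vert D (𝟙 _) v) := by
  rw [modelForm_apply, cupForm_apply, cupForm_apply]
  have h : ∀ i, edge D (SimplexCategory.δ (n := 1) i) (unitTwo (model D) v) = 0 :=
    fun i => edge_unitTwo D _ v
  rw [h, h]
  simp only [tri_unitTwo, vert_unitTwo, map_zero, LinearMap.zero_apply]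
  ring

theorem cupForm_degen_one_zero (θ η : model D _⦋1⦌) :
    cupForm D (degen (model D) 1 1 θ) (degen (model D) 1 0 η)
      = D.pairing (edge D (𝟙 _) θ) (edge D (𝟙 _) η) := by
  rw [cupForm_apply, tri_degen, tri_of_lt one_lt_two, tri_degen, tri_of_lt one_lt_two,
    edge_degen, edge_degen]
  have h1 : SimplexCategory.δ (n := 1) 2 ≫ SimplexCategory.σ 1 = 𝟙 _ := by decide
  have h2 : SimplexCategory.δ (n := 1) 0 ≫ SimplexCategory.σ 0 = 𝟙 _ := by decide
  rw [h1, h2]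
  simp

theorem cupForm_degen_zero_one (θ η : model D _⦋1⦌) :
    cupForm D (degen (model D) 1 0 η) (degen (model D) 1 1 θ) = 0 := by
  rw [cupForm_apply, tri_degen, tri_of_lt one_lt_two, tri_degen, tri_of_lt one_lt_two,
    edge_degen, edge_degen]
  have h1 : SimplexCategory.δ (n := 1) 2 ≫ SimplexCategory.σ 0
      = SimplexCategory.σ 0 ≫ SimplexCategory.δ 1 := by decide
  rw [h1, edge_σ_comp]
  simp

theorem tildeB_modelForm (x : model D _⦋0⦌) (θ η : model D _⦋1⦌) :
    tildeB (model D) (fun _ => modelForm D) x θ η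
      = D.pairing (edge D (𝟙 _) θ) (edge D (𝟙 _) η) := by
  change modelForm D (degen (model D) 1 1 θ) (degen (model D) 1 0 η)
    + modelForm D (degen (model D) 1 1 η) (degen (model D) 1 0 θ) = _
  rw [modelForm_apply, modelForm_apply, cupForm_degen_one_zero, cupForm_degen_zero_one,
    cupForm_degen_one_zero, cupForm_degen_zero_one]
  have : D.pairing (edge D (𝟙 _) θ) (edge D (𝟙 _) η)
    = D.pairing (edge D (𝟙 _) η) (edge D (𝟙 _) θ) := D.symm.eq _ _
  linarith

theorem pairingB_modelForm (x : model D _⦋0⦌) (θ η : NormTangent (model D) 0) :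
    pairingB (model D) (fun _ => modelForm D) (modelForm_normalized D) x θ η
      = D.pairing (modelMark₁ D θ) (modelMark₁ D η) := by
  obtain ⟨θ, rfl⟩ := Submodule.Quotient.mk_surjective _ θ
  obtain ⟨η, rfl⟩ := Submodule.Quotient.mk_surjective _ η
  exact tildeB_modelForm D x θ η

/-- Up to the identifications, `A` is the evaluation pairing of `W₀` with `W₀^*`, and `B` is the
given metric. -/
theorem modelForm_nondegenerate :
    SimpliciallyNondegenerate (model D) (fun _ => modelForm D) (modelForm_normalized D) := by
  intro x
  have hA : ∀ v w, pairingA (model D) (fun _ => modelForm D) (modelForm_normalized D) x v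
      (Submodule.Quotient.mk w) = tri D (𝟙 _) w (vert D (𝟙 _) v) := modelForm_unitTwo D
  refine ⟨⟨fun v hv => ?_, fun w hw => ?_⟩, fun θ hθ => ?_, fun θ hθ => ?_⟩
  · refine model_zero_ext ?_
    rw [map_zero, ← Module.forall_dual_apply_eq_zero_iff ℝ]
    intro ξ
    obtain ⟨w, rfl⟩ := exists_tri_id D ξ
    rw [← hA]
    exact hv _
  · obtain ⟨w, rfl⟩ := Submodule.Quotient.mk_surjective _ w
    rw [Submodule.Quotient.mk_eq_zero]
    refine mem_degenerate_of_tri D (LinearMap.ext fun v => ?_)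
    have := hw (constSimplex D 0 v)
    rwa [hA] at this
  · refine (modelMark₁ D).map_eq_zero_iff.mp (D.nondegenerate.1 _ fun w => ?_)
    have := hθ ((modelMark₁ D).symm w)
    rwa [pairingB_modelForm, LinearEquiv.apply_symm_apply] at this
  · refine (modelMark₁ D).map_eq_zero_iff.mp (D.nondegenerate.2 _ fun w => ?_)
    have := hθ ((modelMark₁ D).symm w)
    rwa [pairingB_modelForm, LinearEquiv.apply_symm_apply] at this

/-- The constant symplectic 2-groupoid of isotropic data. -/
def modelSymplectic : MarkedSymplecticTwoGroupoid W₁ W₀ where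
  toLinearTwoGroupoid := modelGroupoid D
  ω _ := modelForm D
  isTwoForm :=
    haveI := model_finite D 2
    isTwoForm_const (modelForm_isAlt D)
  closed :=
    haveI := model_finite D 2
    isClosedForm_const (modelForm D)
  multiplicative := modelForm_multiplicative D
  normalized := modelForm_normalized D
  nondegenerate := modelForm_nondegenerate D
  constant _ _ := rfl
  mark₁ := modelMark₁ D
  mark₀ := modelMark₀ D

theorem tangentBoundary_mk (X : SVect.{u}) (θ : X _⦋1⦌) :
    tangentBoundary X (Submodule.Quotient.mk θ) = face X 0 0 θ - face X 0 1 θ := by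
  change boundary X 0 θ = _
  unfold boundary
  rw [Fin.sum_univ_two]
  simp [sub_eq_add_neg]

theorem modelMark₀_tangentBoundary (θ : NormTangent (model D) 0) :
    D.del (modelMark₁ D θ) = modelMark₀ D (tangentBoundary (model D) θ) := by
  obtain ⟨θ, rfl⟩ := Submodule.Quotient.mk_surjective _ θ
  rw [tangentBoundary_mk, map_sub]
  exact del_edge (𝟙 _) θ

end Model

end ConstantCourant

end

noncomputable section

set_option linter.unusedSectionVars false

namespace ConstantCourant

/-! ### Multiplicative constant 2-forms -/

/-- An alternating form on `X_2` which is multiplicative and normalized as a constant 2-form. -/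
structure IsNormalizedCocycle (X : SVect.{u}) (ω : LinearMap.BilinForm ℝ (X _⦋2⦌)) : Prop where
  alt : ω.IsAlt
  cocycle : ∀ u v : X _⦋3⦌,
    ω (face X 2 0 u) (face X 2 0 v) - ω (face X 2 1 u) (face X 2 1 v)
      + ω (face X 2 2 u) (face X 2 2 v) - ω (face X 2 3 u) (face X 2 3 v) = 0
  normalized : ∀ (i : Fin 2) (a b : X _⦋1⦌), ω (degen X 1 i a) (degen X 1 i b) = 0

/-! ### Faces of degenerate simplices in low degree -/

section FaceDegen

variable (X : SVect.{u})

theorem face_two_degen_zero (θ : X _⦋1⦌) :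
    face X 1 2 (degen X 1 0 θ) = degen X 0 0 (face X 0 1 θ) :=
  face_degen_of_gt X 0 (i := 1) (j := 0) (by decide) θ

theorem face_zero_degen_one (θ : X _⦋1⦌) :
    face X 1 0 (degen X 1 1 θ) = degen X 0 0 (face X 0 0 θ) :=
  face_degen_of_le X 0 (i := 0) (j := 0) (by decide) θ

theorem face_zero_degen_zero (θ : X _⦋1⦌) : face X 1 0 (degen X 1 0 θ) = θ :=
  face_degen_castSucc X 1 0 θ

theorem face_one_degen_zero (θ : X _⦋1⦌) : face X 1 1 (degen X 1 0 θ) = θ :=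
  face_degen_succ X 1 0 θ

theorem face_one_degen_one (θ : X _⦋1⦌) : face X 1 1 (degen X 1 1 θ) = θ :=
  face_degen_castSucc X 1 1 θ

theorem face_two_degen_one (θ : X _⦋1⦌) : face X 1 2 (degen X 1 1 θ) = θ :=
  face_degen_succ X 1 1 θ

theorem faces_degen_zero (x : X _⦋2⦌) :
    face X 2 0 (degen X 2 0 x) = x ∧ face X 2 1 (degen X 2 0 x) = x ∧
    face X 2 2 (degen X 2 0 x) = degen X 1 0 (face X 1 1 x) ∧
    face X 2 3 (degen X 2 0 x) = degen X 1 0 (face X 1 2 x) :=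
  ⟨face_degen_castSucc X 2 0 x, face_degen_succ X 2 0 x,
    face_degen_of_gt X 1 (i := 1) (j := 0) (by decide) x,
    face_degen_of_gt X 1 (i := 2) (j := 0) (by decide) x⟩

theorem faces_degen_one (x : X _⦋2⦌) :
    face X 2 0 (degen X 2 1 x) = degen X 1 0 (face X 1 0 x) ∧ face X 2 1 (degen X 2 1 x) = x ∧
    face X 2 2 (degen X 2 1 x) = x ∧ face X 2 3 (degen X 2 1 x) = degen X 1 1 (face X 1 2 x) :=
  ⟨face_degen_of_le X 1 (i := 0) (j := 0) (by decide) x, face_degen_castSucc X 2 1 x,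
    face_degen_succ X 2 1 x, face_degen_of_gt X 1 (i := 2) (j := 1) (by decide) x⟩

theorem faces_degen_two (x : X _⦋2⦌) :
    face X 2 0 (degen X 2 2 x) = degen X 1 1 (face X 1 0 x) ∧
    face X 2 1 (degen X 2 2 x) = degen X 1 1 (face X 1 1 x) ∧
    face X 2 2 (degen X 2 2 x) = x ∧ face X 2 3 (degen X 2 2 x) = x :=
  ⟨face_degen_of_le X 1 (i := 0) (j := 1) (by decide) x,
    face_degen_of_le X 1 (i := 1) (j := 1) (by decide) x,
    face_degen_castSucc X 2 2 x, face_degen_succ X 2 2 x⟩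

theorem unitTwo_eq (v : X _⦋0⦌) : degen X 1 0 (degen X 0 0 v) = unitTwo X v := rfl

theorem unitTwo_eq' (v : X _⦋0⦌) : degen X 1 1 (degen X 0 0 v) = unitTwo X v :=
  (degen_degen X v).symm

theorem face_unitTwo (i : Fin 3) (v : X _⦋0⦌) : face X 1 i (unitTwo X v) = degen X 0 0 v := by
  fin_cases i
  · exact face_zero_degen_zero X _
  · exact face_one_degen_zero X _
  · exact (face_two_degen_zero X _).trans (congrArg _ (face_degen_succ X 0 0 v))

end FaceDegen

/-! ### Consequences of the cocycle condition on degenerate 3-simplices -/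

namespace IsNormalizedCocycle

variable {X : SVect.{u}} {ω : LinearMap.BilinForm ℝ (X _⦋2⦌)} (h : IsNormalizedCocycle X ω)

include h

theorem skew (x y : X _⦋2⦌) : ω x y = -ω y x := (h.alt.neg_eq y x).symm

/-- This identity and the next two evaluate the cocycle condition on pairs `(σ_i x, σ_j y)` with `i
< j`. They are all that is used of multiplicativity to relate `ω` to its values on degenerate
vectors. -/
theorem cocycle_zero_one (x y : X _⦋2⦌) :
    ω x (degen X 1 0 (face X 1 0 y)) - ω x y + ω (degen X 1 0 (face X 1 1 x)) y
      - ω (degen X 1 0 (face X 1 2 x)) (degen X 1 1 (face X 1 2 y)) = 0 := by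
  have := h.cocycle (degen X 2 0 x) (degen X 2 1 y)
  obtain ⟨a0, a1, a2, a3⟩ := faces_degen_zero X x
  obtain ⟨b0, b1, b2, b3⟩ := faces_degen_one X y
  rwa [a0, a1, a2, a3, b0, b1, b2, b3] at this

theorem cocycle_zero_two (x y : X _⦋2⦌) :
    ω x (degen X 1 1 (face X 1 0 y)) - ω x (degen X 1 1 (face X 1 1 y))
      + ω (degen X 1 0 (face X 1 1 x)) y - ω (degen X 1 0 (face X 1 2 x)) y = 0 := by
  have := h.cocycle (degen X 2 0 x) (degen X 2 2 y)
  obtain ⟨a0, a1, a2, a3⟩ := faces_degen_zero X x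
  obtain ⟨b0, b1, b2, b3⟩ := faces_degen_two X y
  rwa [a0, a1, a2, a3, b0, b1, b2, b3] at this

theorem cocycle_one_two (x y : X _⦋2⦌) :
    ω (degen X 1 0 (face X 1 0 x)) (degen X 1 1 (face X 1 0 y))
      - ω x (degen X 1 1 (face X 1 1 y)) + ω x y - ω (degen X 1 1 (face X 1 2 x)) y = 0 := by
  have := h.cocycle (degen X 2 1 x) (degen X 2 2 y)
  obtain ⟨a0, a1, a2, a3⟩ := faces_degen_one X x
  obtain ⟨b0, b1, b2, b3⟩ := faces_degen_two X y
  rwa [a0, a1, a2, a3, b0, b1, b2, b3] at this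

/-- Specializing one argument to a degenerate simplex expresses `ω` there through `A` and the values
`ω(σ_1 ·, σ_0 ·)`; the next two lemmas are the analogues for `σ_0`. -/
theorem apply_degen_one (x : X _⦋2⦌) (θ : X _⦋1⦌) :
    ω x (degen X 1 1 θ) = ω x (unitTwo X (face X 0 0 θ))
      + ω (degen X 1 0 (face X 1 1 x)) (degen X 1 1 θ)
      - ω (degen X 1 0 (face X 1 2 x)) (degen X 1 1 θ) := by
  have := h.cocycle_zero_one x (degen X 1 1 θ)
  rw [face_zero_degen_one, face_two_degen_one, unitTwo_eq] at this
  linarith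

theorem apply_degen_zero (x : X _⦋2⦌) (θ : X _⦋1⦌) :
    ω x (degen X 1 0 θ) = ω x (degen X 1 1 θ)
      - ω (degen X 1 0 (face X 1 0 x)) (degen X 1 1 θ)
      + ω (degen X 1 1 (face X 1 2 x)) (degen X 1 0 θ) := by
  have := h.cocycle_one_two x (degen X 1 0 θ)
  rw [face_zero_degen_zero, face_one_degen_zero] at this
  linarith

theorem degen_zero_apply (θ : X _⦋1⦌) (y : X _⦋2⦌) :
    ω (degen X 1 0 θ) y = ω (unitTwo X (face X 0 1 θ)) y
      + ω (degen X 1 0 θ) (degen X 1 1 (face X 1 1 y))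
      - ω (degen X 1 0 θ) (degen X 1 1 (face X 1 0 y)) := by
  have := h.cocycle_zero_two (degen X 1 0 θ) y
  rw [face_one_degen_zero, face_two_degen_zero, unitTwo_eq] at this
  linarith

/-- The compatibility `A_ω(∂θ, w) = B_ω(θ, ∂w)`. -/
theorem boundary_adjoint (θ : X _⦋1⦌) (w : X _⦋2⦌) :
    ω (unitTwo X (face X 0 0 θ - face X 0 1 θ)) w
      = ω (degen X 1 1 θ) (degen X 1 0 (face X 1 0 w - face X 1 1 w + face X 1 2 w))
        + ω (degen X 1 1 (face X 1 0 w - face X 1 1 w + face X 1 2 w)) (degen X 1 0 θ) := by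
  -- The first two identities compute `ω(w, σ_0 θ)` from `A` at `d_0 θ`, the third from `A` at `d_1
  -- θ`. Equating them eliminates the mixed terms and leaves a relation between `A` and `B`.
  have e1 := h.apply_degen_one w θ
  have e2 := h.apply_degen_zero w θ
  have e3 := h.degen_zero_apply θ w
  have s := h.skew
  rw [s w (degen X 1 1 θ), s w (unitTwo X _), s (degen X 1 0 (face X 1 1 w)),
    s (degen X 1 0 (face X 1 2 w))] at e1
  rw [s w (degen X 1 0 θ), s w (degen X 1 1 θ), s (degen X 1 0 (face X 1 0 w))] at e2
  rw [s (degen X 1 0 θ) (degen X 1 1 (face X 1 1 w)),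
    s (degen X 1 0 θ) (degen X 1 1 (face X 1 0 w))] at e3
  simp only [map_add, map_sub, LinearMap.add_apply, LinearMap.sub_apply]
  linarith

/-- A normalized cocycle with `A = B = 0` is the coboundary of an explicit form on `X_1`. -/
theorem eq_coboundary (hA : ∀ v w, ω (unitTwo X v) w = 0)
    (hB : ∀ θ η, ω (degen X 1 1 θ) (degen X 1 0 η) + ω (degen X 1 1 η) (degen X 1 0 θ) = 0)
    (x y : X _⦋2⦌) :
    ω x y = -(ω (degen X 1 1 (face X 1 0 x)) (degen X 1 0 (face X 1 0 y))
      - ω (degen X 1 1 (face X 1 1 x)) (degen X 1 0 (face X 1 1 y))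
      + ω (degen X 1 1 (face X 1 2 x)) (degen X 1 0 (face X 1 2 y))) := by
  have s := h.skew
  have hA' : ∀ v w, ω w (unitTwo X v) = 0 := fun v w => by rw [s, hA, neg_zero]
  -- With `A = 0` the unit terms drop out, and `B = 0` makes `(θ, η) ↦ ω(σ_1 θ, σ_0 η)` skew. So `ω`
  -- with one degenerate argument depends only on this form and the faces of `x`.
  have r1 : ∀ x θ, ω x (degen X 1 1 θ) = ω (degen X 1 1 (face X 1 1 x)) (degen X 1 0 θ)
      - ω (degen X 1 1 (face X 1 2 x)) (degen X 1 0 θ) := fun x θ => by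
    have e := h.apply_degen_one x θ
    rw [hA', s (degen X 1 0 _), s (degen X 1 0 _)] at e
    have b1 := hB θ (face X 1 1 x)
    have b2 := hB θ (face X 1 2 x)
    linarith
  have r0 : ∀ x θ, ω x (degen X 1 0 θ) = ω (degen X 1 1 (face X 1 1 x)) (degen X 1 0 θ)
      - ω (degen X 1 1 (face X 1 0 x)) (degen X 1 0 θ) := fun x θ => by
    have e := h.apply_degen_zero x θ
    rw [r1, s (degen X 1 0 _)] at e
    have b1 := hB θ (face X 1 0 x)
    linarith
  -- Here `ω x y` is the only term without a degenerate argument, so it can be solved for.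
  have e := h.cocycle_zero_one x y
  rw [r0, s (degen X 1 0 (face X 1 1 x)), r0 y, s (degen X 1 0 (face X 1 2 x))] at e
  have b1 := hB (face X 1 1 y) (face X 1 1 x)
  have b2 := hB (face X 1 0 y) (face X 1 1 x)
  have b3 := hB (face X 1 2 y) (face X 1 2 x)
  linarith

end IsNormalizedCocycle

theorem IsNormalizedCocycle.sub {X : SVect.{u}} {ω ω' : LinearMap.BilinForm ℝ (X _⦋2⦌)}
    (h : IsNormalizedCocycle X ω) (h' : IsNormalizedCocycle X ω') :
    IsNormalizedCocycle X (ω' - ω) where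
  alt x := by rw [LinearMap.sub_apply, LinearMap.sub_apply, h.alt x, h'.alt x, sub_zero]
  cocycle u v := by
    have := h.cocycle u v
    have := h'.cocycle u v
    simp only [LinearMap.sub_apply]
    linarith
  normalized i a b := by
    rw [LinearMap.sub_apply, LinearMap.sub_apply, h.normalized, h'.normalized, sub_zero]

/-- Constant forms on `X_2` with the same `A` and `B` are equivalent. -/
theorem formEquivalent_of_eq {X : SVect.{u}} [FiniteDimensional ℝ (X _⦋1⦌)]
    {ω ω' : LinearMap.BilinForm ℝ (X _⦋2⦌)}
    (h : IsNormalizedCocycle X ω) (h' : IsNormalizedCocycle X ω')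
    (hA : ∀ v w, ω (unitTwo X v) w = ω' (unitTwo X v) w)
    (hB : ∀ θ η, ω (degen X 1 1 θ) (degen X 1 0 η) + ω (degen X 1 1 η) (degen X 1 0 θ)
      = ω' (degen X 1 1 θ) (degen X 1 0 η) + ω' (degen X 1 1 η) (degen X 1 0 θ)) :
    FormEquivalent X (fun _ => ω) (fun _ => ω') := by
  let η : LinearMap.BilinForm ℝ (X _⦋2⦌) := ω' - ω
  have hη : IsNormalizedCocycle X η := h.sub h'
  have hηA : ∀ v w, η (unitTwo X v) w = 0 := fun v w => by
    simp only [η, LinearMap.sub_apply, hA, sub_self]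
  have hηB : ∀ θ θ', η (degen X 1 1 θ) (degen X 1 0 θ')
      + η (degen X 1 1 θ') (degen X 1 0 θ) = 0 := fun θ θ' => by
    have := hB θ θ'
    simp only [η, LinearMap.sub_apply]
    linarith
  -- The primitive read off from `eq_coboundary`. It is alternating because `B` of the difference
  -- vanishes, normalized because `A` does, and closed because it is constant.
  let α : LinearMap.BilinForm ℝ (X _⦋1⦌) := -(η.compl₁₂ (degen X 1 1) (degen X 1 0))
  have hα : ∀ θ θ', α θ θ' = -η (degen X 1 1 θ) (degen X 1 0 θ') := fun _ _ => rfl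
  have hδ : ∀ x y z, coboundary X 1 (fun _ => α) z x y = η x y := fun x y z => by
    rw [coboundary_one_apply, hα, hα, hα, hη.eq_coboundary hηA hηB x y]
    ring
  refine ⟨fun _ => α, isTwoForm_const fun θ => ?_, isClosedForm_const α, fun i => ?_, ?_, ?_, ?_⟩
  · have := hηB θ θ
    rw [hα]
    linarith
  · funext z
    refine LinearMap.ext fun v => LinearMap.ext fun w => ?_
    fin_cases i
    change α (degen X 0 0 v) (degen X 0 0 w) = 0
    rw [hα, unitTwo_eq', hηA, neg_zero]
  · intro x y z
    rw [hδ]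
    rfl
  · intro x
    refine LinearMap.ext fun v => LinearMap.ext fun w => ?_
    change coboundary X 1 (fun _ => α) _ (unitTwo X v) w = 0
    rw [hδ, hηA]
  · intro x
    refine LinearMap.ext fun θ => LinearMap.ext fun θ' => ?_
    change coboundary X 1 (fun _ => α) _ (degen X 1 1 θ) (degen X 1 0 θ')
      + coboundary X 1 (fun _ => α) _ (degen X 1 1 θ') (degen X 1 0 θ) = 0
    rw [hδ, hδ, hηB]

theorem ConstantSymplecticTwoGroupoid.isNormalizedCocycle (S : ConstantSymplecticTwoGroupoid.{u}) :
    IsNormalizedCocycle S.X (S.ω 0) where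
  alt := S.isTwoForm.1 0
  cocycle u v := by
    have := congrArg (fun B : LinearMap.BilinForm ℝ (S.X _⦋3⦌) => B u v)
      (congrFun S.multiplicative 0)
    simp only [coboundary_two_apply, map_zero] at this
    exact this
  normalized i a b := by
    have := normalized_apply S.X S.normalized 0 i a b
    rwa [map_zero] at this

theorem ConstantSymplecticTwoGroupoid.form_eq (S : ConstantSymplecticTwoGroupoid.{u})
    (x : S.X _⦋2⦌) : S.ω x = S.ω 0 :=
  S.constant x 0

theorem IsNormalizedCocycle.pullback {X Y : SVect.{u}} (φ : X ⟶ Y)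
    {ω : LinearMap.BilinForm ℝ (Y _⦋2⦌)} (h : IsNormalizedCocycle Y ω) :
    IsNormalizedCocycle X (ω.compl₁₂ (degreeMap φ 2) (degreeMap φ 2)) where
  alt x := h.alt _
  cocycle u v := by
    simp only [LinearMap.compl₁₂_apply, degreeMap_face]
    exact h.cocycle _ _
  normalized i a b := by
    have e := degreeMap_degen φ 1 i
    change ω (degreeMap φ (1 + 1) (degen X 1 i a)) (degreeMap φ (1 + 1) (degen X 1 i b)) = 0
    rw [e, e]
    exact h.normalized i _ _

end ConstantCourant

end

noncomputable section

set_option linter.unusedSectionVars false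

namespace ConstantCourant

/-! ### Comparison of a marked groupoid with the model -/

section Classification

variable {W₁ W₀ : Type u} [AddCommGroup W₁] [Module ℝ W₁] [FiniteDimensional ℝ W₁]
  [AddCommGroup W₀] [Module ℝ W₀] [FiniteDimensional ℝ W₀]

namespace MarkedSymplecticTwoGroupoid

variable (S : MarkedSymplecticTwoGroupoid W₁ W₀)

/-- The map `X_2 → W₀^*` given by `A_ω`. -/
def triMap : S.X _⦋2⦌ →ₗ[ℝ] Module.Dual ℝ W₀ :=
  (LinearMap.comp (S.ω 0) (unitTwo S.X ∘ₗ S.mark₀.symm.toLinearMap)).flip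

theorem triMap_apply (w : S.X _⦋2⦌) (v : W₀) :
    S.triMap w v = S.ω 0 (unitTwo S.X (S.mark₀.symm v)) w := rfl

theorem triMap_mark₀ (w : S.X _⦋2⦌) (v : S.X _⦋0⦌) :
    S.triMap w (S.mark₀ v) = S.ω 0 (unitTwo S.X v) w := by
  rw [triMap_apply, LinearEquiv.symm_apply_apply]

theorem pairingA_mk (v : S.X _⦋0⦌) (w : S.X _⦋2⦌) :
    pairingA S.X S.ω S.normalized 0 v (Submodule.Quotient.mk w) = S.triMap w (S.mark₀ v) := by
  rw [triMap_mark₀, ← S.form_eq (unitTwo S.X 0)]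
  rfl

theorem triMap_degen (i : Fin 2) (θ : S.X _⦋1⦌) : S.triMap (degen S.X 1 i θ) = 0 := by
  refine LinearMap.ext fun v => ?_
  rw [triMap_apply]
  have h := S.isNormalizedCocycle.normalized i
  fin_cases i
  · exact h _ _
  · change S.ω 0 _ (degen S.X 1 1 θ) = 0
    rw [← unitTwo_eq']
    exact h _ _

/-- In finite dimension the nondegenerate pairing `A` is perfect, so every functional on `W₀` is
`A(·, w)` for some `w`. -/
theorem triMap_surjective : Function.Surjective S.triMap := by
  intro ξ
  have hA := (S.nondegenerate 0).1
  have : (pairingA S.X S.ω S.normalized 0).IsPerfPair :=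
    LinearMap.IsPerfPair.of_injective (LinearMap.ker_eq_bot.mp
      (LinearMap.separatingLeft_iff_ker_eq_bot.mp hA.1))
      (LinearMap.ker_eq_bot.mp (LinearMap.separatingRight_iff_flip_ker_eq_bot.mp hA.2))
  let w := (pairingA S.X S.ω S.normalized 0).flip.toPerfPair.symm (ξ ∘ₗ S.mark₀.toLinearMap)
  have hw : ∀ v, pairingA S.X S.ω S.normalized 0 v w = ξ (S.mark₀ v) := fun v =>
    LinearMap.apply_toPerfPair_flip _ _ v
  obtain ⟨w', hw'⟩ := Submodule.Quotient.mk_surjective _ w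
  refine ⟨w', LinearMap.ext fun v => ?_⟩
  have := hw (S.mark₀.symm v)
  rwa [← hw', pairingA_mk, LinearEquiv.apply_symm_apply] at this

theorem mem_degenerate_of_triMap {w : S.X _⦋2⦌} (hw : S.triMap w = 0) : w ∈ degenerate S.X 1 := by
  rw [← Submodule.Quotient.mk_eq_zero]
  refine (S.nondegenerate 0).1.2 _ fun v => ?_
  rw [pairingA_mk, hw, LinearMap.zero_apply]

/-- The cocycle condition for `ω`, paired with a totally degenerate 3-simplex. -/
theorem triMap_cocycle (y : S.X _⦋3⦌) :
    S.triMap (face S.X 2 0 y) - S.triMap (face S.X 2 1 y) + S.triMap (face S.X 2 2 y)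
      - S.triMap (face S.X 2 3 y) = 0 := by
  refine LinearMap.ext fun v => ?_
  have h := S.isNormalizedCocycle.cocycle (degen S.X 2 0 (unitTwo S.X (S.mark₀.symm v))) y
  obtain ⟨a0, a1, a2, a3⟩ := faces_degen_zero S.X (unitTwo S.X (S.mark₀.symm v))
  rw [a0, a1, a2, a3, face_unitTwo, face_unitTwo, unitTwo_eq] at h
  exact h

theorem pairingB_mk (x : S.X _⦋0⦌) (θ η : S.X _⦋1⦌) :
    pairingB S.X S.ω S.normalized x (Submodule.Quotient.mk θ) (Submodule.Quotient.mk η)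
      = S.ω 0 (degen S.X 1 1 θ) (degen S.X 1 0 η)
        + S.ω 0 (degen S.X 1 1 η) (degen S.X 1 0 θ) := by
  rw [← S.form_eq (unitTwo S.X x)]
  rfl

/-- The groupoid `S` has the linear algebra data `D`. -/
def HasData (D : IsotropicData W₁ W₀) : Prop :=
  (∀ x θ η, D.pairing (S.mark₁ θ) (S.mark₁ η) = pairingB S.X S.ω S.normalized x θ η) ∧
    ∀ θ, D.del (S.mark₁ θ) = S.mark₀ (tangentBoundary S.X θ)

variable {S} {D : IsotropicData W₁ W₀} (h : S.HasData D)

include h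

/-- Pair both sides with an arbitrary `θ` and use `A(∂θ, w) = B(θ, ∂w)`. So the top differential is
no extra datum: under `A` it becomes `∂^*`. -/
theorem HasData.codel_triMap (w : S.X _⦋2⦌) :
    D.codel (S.triMap w) = S.mark₁ (Submodule.Quotient.mk (face S.X 1 0 w))
      - S.mark₁ (Submodule.Quotient.mk (face S.X 1 1 w))
      + S.mark₁ (Submodule.Quotient.mk (face S.X 1 2 w)) := by
  rw [← map_sub, ← map_add, ← sub_eq_zero]
  refine D.nondegenerate.2 _ fun θ' => ?_
  obtain ⟨θ, rfl⟩ := S.mark₁.surjective θ'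
  obtain ⟨θ, rfl⟩ := Submodule.Quotient.mk_surjective _ θ
  rw [map_sub, D.pairing_codel_right, h.2, triMap_mark₀, tangentBoundary_mk,
    S.isNormalizedCocycle.boundary_adjoint, h.1 0, ← Submodule.Quotient.mk_sub,
    ← Submodule.Quotient.mk_add, S.pairingB_mk, sub_self]

/-- The comparison map to the model, in one degree. -/
def HasData.toModelCochain (_ : S.HasData D) (Δ : SimplexCategory) :
    S.X.obj (op Δ) →ₗ[ℝ] ModelCochain W₁ W₀ Δ :=
  (LinearMap.pi fun f => S.mark₀.toLinearMap ∘ₗ (S.X.map f.op).hom).prod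
    ((LinearMap.pi fun f => S.mark₁.toLinearMap ∘ₗ (degenerate S.X 0).mkQ ∘ₗ
      (S.X.map f.op).hom).prod (LinearMap.pi fun f => S.triMap ∘ₗ (S.X.map f.op).hom))

omit h in
theorem map_op_comp {X : SVect.{u}} {Δ Δ' Δ'' : SimplexCategory} (g : Δ ⟶ Δ') (f : Δ' ⟶ Δ'')
    (x : X.obj (op Δ'')) :
    (X.map (g ≫ f).op).hom x = (X.map g.op).hom ((X.map f.op).hom x) := by
  rw [op_comp, X.map_comp]
  rfl

/-- The two normalization conditions come from passing to the quotient and from `triMap_degen`; the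
three differential conditions are compatibility with `∂`, `codel_triMap` and `triMap_cocycle`. -/
theorem HasData.toModelCochain_mem (Δ : SimplexCategory) (x : S.X.obj (op Δ)) :
    h.toModelCochain Δ x ∈ modelSimplices D Δ := by
  refine ⟨fun f => ?_, fun f i => ?_, fun f => ?_, fun f => ?_, fun f => ?_⟩
  · change S.mark₁ (Submodule.Quotient.mk ((S.X.map (SimplexCategory.σ 0 ≫ f).op).hom x)) = 0
    rw [map_op_comp, (Submodule.Quotient.mk_eq_zero _).mpr, map_zero]
    exact degen_mem_degenerate S.X 0 0 _
  · change S.triMap ((S.X.map (SimplexCategory.σ i ≫ f).op).hom x) = 0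
    rw [map_op_comp]
    exact S.triMap_degen i _
  · change D.del (S.mark₁ (Submodule.Quotient.mk ((S.X.map f.op).hom x)))
      = S.mark₀ ((S.X.map (SimplexCategory.δ 0 ≫ f).op).hom x)
        - S.mark₀ ((S.X.map (SimplexCategory.δ 1 ≫ f).op).hom x)
    rw [map_op_comp, map_op_comp, h.2, tangentBoundary_mk, map_sub]
    rfl
  · change D.codel (S.triMap ((S.X.map f.op).hom x))
      = S.mark₁ (Submodule.Quotient.mk ((S.X.map (SimplexCategory.δ 0 ≫ f).op).hom x))
        - S.mark₁ (Submodule.Quotient.mk ((S.X.map (SimplexCategory.δ 1 ≫ f).op).hom x))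
        + S.mark₁ (Submodule.Quotient.mk ((S.X.map (SimplexCategory.δ 2 ≫ f).op).hom x))
    rw [map_op_comp, map_op_comp, map_op_comp, h.codel_triMap]
    rfl
  · change S.triMap ((S.X.map (SimplexCategory.δ 0 ≫ f).op).hom x)
      - S.triMap ((S.X.map (SimplexCategory.δ 1 ≫ f).op).hom x)
      + S.triMap ((S.X.map (SimplexCategory.δ 2 ≫ f).op).hom x)
      - S.triMap ((S.X.map (SimplexCategory.δ 3 ≫ f).op).hom x) = 0
    rw [map_op_comp, map_op_comp, map_op_comp, map_op_comp]
    exact S.triMap_cocycle _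

/-- The comparison map to the model. -/
def HasData.toModel : S.X ⟶ model D where
  app Δ := ModuleCat.ofHom ((h.toModelCochain Δ.unop).codRestrict _ (h.toModelCochain_mem Δ.unop))
  naturality Δ Δ' g := by
    refine ModuleCat.hom_ext (LinearMap.ext fun x => ?_)
    refine Subtype.ext (Prod.ext ?_ (Prod.ext ?_ ?_)) <;> funext f
    · exact congrArg S.mark₀ (map_op_comp f g.unop x).symm
    · exact congrArg (fun z => S.mark₁ (Submodule.Quotient.mk z)) (map_op_comp f g.unop x).symm
    · exact congrArg S.triMap (map_op_comp f g.unop x).symm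

theorem HasData.vert_toModel (v : S.X _⦋0⦌) :
    vert D (𝟙 _) (degreeMap h.toModel 0 v) = S.mark₀ v :=
  congrArg (fun g => S.mark₀ (g.hom v)) (S.X.map_id (op ⦋0⦌))

theorem HasData.edge_toModel (θ : S.X _⦋1⦌) :
    edge D (𝟙 _) (degreeMap h.toModel 1 θ) = S.mark₁ (Submodule.Quotient.mk θ) :=
  congrArg (fun g : S.X _⦋1⦌ ⟶ S.X _⦋1⦌ => S.mark₁ (Submodule.Quotient.mk (g.hom θ)))
    (S.X.map_id (op ⦋1⦌))

theorem HasData.tri_toModel (w : S.X _⦋2⦌) :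
    tri D (𝟙 _) (degreeMap h.toModel 2 w) = S.triMap w :=
  congrArg (fun g => S.triMap (g.hom w)) (S.X.map_id (op ⦋2⦌))

theorem HasData.face_eq_zero {q : ℕ} (hq : Function.Injective (degreeMap h.toModel q))
    {x : S.X _⦋q + 1⦌} (hx : degreeMap h.toModel (q + 1) x = 0) (i : Fin (q + 2)) :
    face S.X q i x = 0 := by
  refine hq ?_
  rw [degreeMap_face, hx, map_zero, map_zero]

theorem HasData.toModel_injective_zero : Function.Injective (degreeMap h.toModel 0) := by
  intro x y hxy
  refine S.mark₀.injective ?_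
  rw [← h.vert_toModel, ← h.vert_toModel, hxy]

theorem HasData.toModel_injective_one : Function.Injective (degreeMap h.toModel 1) := by
  refine (injective_iff_map_eq_zero _).mpr fun x hx => ?_
  have h1 := h.edge_toModel x
  rw [hx, map_zero] at h1
  have hd := (Submodule.Quotient.mk_eq_zero _).mp (S.mark₁.map_eq_zero_iff.mp h1.symm)
  have hle : degenerate S.X 0 ≤ LinearMap.range (degen S.X 0 0) := iSup_le fun i => by
    fin_cases i
    exact le_rfl
  obtain ⟨v, rfl⟩ := hle hd
  have hv : face S.X 0 0 (degen S.X 0 0 v) = v := face_degen_castSucc S.X 0 0 v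
  rw [← hv, h.face_eq_zero h.toModel_injective_zero hx, map_zero]

/-- A kernel element is degenerate, say `σ_0 a + σ_1 b`, and its faces vanish by injectivity in
degree 1. Faces 0 and 1 give `a = -b` and `b = σ_0 d_0 b`, and then `σ_0 σ_0 = σ_1 σ_0` cancels the
sum. -/
theorem HasData.toModel_injective_two : Function.Injective (degreeMap h.toModel 2) := by
  refine (injective_iff_map_eq_zero _).mpr fun x hx => ?_
  have h1 := h.tri_toModel x
  rw [hx, map_zero] at h1
  have hd := S.mem_degenerate_of_triMap h1.symm
  have hle : degenerate S.X 1 ≤ LinearMap.range (degen S.X 1 0) ⊔ LinearMap.range (degen S.X 1 1) :=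
    iSup_le fun i => by
      fin_cases i
      exacts [le_sup_left, le_sup_right]
  obtain ⟨_, ⟨a, rfl⟩, _, ⟨b, rfl⟩, rfl⟩ := Submodule.mem_sup.mp (hle hd)
  have hf := h.face_eq_zero h.toModel_injective_one hx
  have h0 := hf 0
  have h1 := hf 1
  rw [map_add, face_zero_degen_zero, face_zero_degen_one] at h0
  rw [map_add, face_one_degen_zero, face_one_degen_one] at h1
  obtain rfl := eq_neg_of_add_eq_zero_left h1
  obtain hb := neg_add_eq_zero.mp h0
  rw [hb, map_neg, unitTwo_eq, unitTwo_eq', neg_add_cancel]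

theorem HasData.toModel_injective (n : ℕ) : Function.Injective (degreeMap h.toModel n) := by
  induction n with
  | zero => exact h.toModel_injective_zero
  | succ q ih =>
    match q with
    | 0 => exact h.toModel_injective_one
    | 1 => exact h.toModel_injective_two
    | q + 2 =>
      -- From degree 3 on, a simplex of `S` is determined by a horn, and the faces of a kernel
      -- element vanish by induction.
      refine (injective_iff_map_eq_zero _).mpr fun x hx => ?_
      refine (injective_iff_map_eq_zero _).mp (S.horn_bijective (q + 2) 0 (by omega)).1 x ?_
      exact Subtype.ext (funext fun i => h.face_eq_zero ih hx i.1)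

theorem HasData.degenerate_le_range {q : ℕ} (hq : Function.Surjective (degreeMap h.toModel q)) :
    degenerate (model D) q ≤ LinearMap.range (degreeMap h.toModel (q + 1)) := by
  refine iSup_le fun i => ?_
  rintro _ ⟨y, rfl⟩
  obtain ⟨x, rfl⟩ := hq y
  exact ⟨degen S.X q i x, degreeMap_degen h.toModel q i x⟩

/-- In degrees 1 and 2 a simplex is lifted modulo degenerate ones, and the degenerate remainder is
hit by induction. -/
theorem HasData.toModel_surjective (n : ℕ) : Function.Surjective (degreeMap h.toModel n) := by
  induction n with
  | zero =>
    intro y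
    refine ⟨S.mark₀.symm (vert D (𝟙 _) y), model_zero_ext ?_⟩
    rw [h.vert_toModel, LinearEquiv.apply_symm_apply]
  | succ q ih =>
    intro y
    match q with
    | 0 =>
      obtain ⟨θ, hθ⟩ := Submodule.Quotient.mk_surjective _ (S.mark₁.symm (edge D (𝟙 _) y))
      have hy : y - degreeMap h.toModel 1 θ ∈ degenerate (model D) 0 := by
        refine mem_degenerate_of_edge D ?_
        rw [map_sub, h.edge_toModel, hθ, LinearEquiv.apply_symm_apply, sub_self]
      obtain ⟨z, hz⟩ := h.degenerate_le_range ih hy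
      exact ⟨z + θ, by rw [map_add]; exact eq_sub_iff_add_eq.mp hz⟩
    | 1 =>
      obtain ⟨w, hw⟩ := S.triMap_surjective (tri D (𝟙 _) y)
      have hy : y - degreeMap h.toModel 2 w ∈ degenerate (model D) 1 := by
        refine mem_degenerate_of_tri D ?_
        rw [map_sub, h.tri_toModel, hw, sub_self]
      obtain ⟨z, hz⟩ := h.degenerate_le_range ih hy
      exact ⟨z + w, by rw [map_add]; exact eq_sub_iff_add_eq.mp hz⟩
    | q + 2 =>
      -- Lift every face of `y`. The lifts form a horn by injectivity one degree lower; a filler in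
      -- `S` maps to a simplex sharing a horn with `y`, hence to `y` by `model_eq_zero_of_horn`.
      choose z hz using fun i : Fin (q + 4) => ih (face (model D) (q + 2) i y)
      have hmem : (fun i : {i : Fin (q + 4) // i ≠ 0} => z i.1) ∈ hornSpace S.X (q + 2) 0 := by
        intro i j hij _ _
        refine h.toModel_injective (q + 1) ?_
        dsimp only
        rw [degreeMap_face, degreeMap_face, hz, hz]
        exact face_face (model D) (q + 1) hij y
      obtain ⟨x, hx⟩ := S.horn_surjective (q + 2) 0 ⟨_, hmem⟩
      refine ⟨x, sub_eq_zero.mp (model_eq_zero_of_horn (by omega) 0 fun i hi => ?_)⟩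
      have hxi : face S.X (q + 2) i x = z i :=
        congrFun (congrArg Subtype.val hx) ⟨i, hi⟩
      rw [map_sub, ← degreeMap_face, hxi, hz, sub_self]

/-- The comparison isomorphism to the model. -/
def HasData.modelIso : S.X ≅ model D :=
  NatIso.ofComponents (fun Δ => (LinearEquiv.ofBijective (degreeMap h.toModel Δ.unop.len)
    ⟨h.toModel_injective _, h.toModel_surjective _⟩).toModuleIso) fun g => h.toModel.naturality g

/-- The model form need not pull back to `S.ω`, but the two have the same `A`, by construction of
`triMap`, and the same `B`, by hypothesis; `formEquivalent_of_eq` does the rest. -/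
theorem HasData.modelIso_isEquivalence :
    ConstantSymplecticTwoGroupoid.IsEquivalence (S := S.toConstantSymplecticTwoGroupoid)
      (T := (modelSymplectic D).toConstantSymplecticTwoGroupoid) h.modelIso := by
  have hS : S.ω = fun _ => S.ω 0 := funext S.form_eq
  unfold ConstantSymplecticTwoGroupoid.IsEquivalence
  rw [hS]
  refine formEquivalent_of_eq S.isNormalizedCocycle (IsNormalizedCocycle.pullback h.toModel
    (modelSymplectic D).isNormalizedCocycle) (fun v w => ?_) fun θ η => ?_
  · change _ = modelForm D (degreeMap h.toModel 2 (unitTwo S.X v)) (degreeMap h.toModel 2 w)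
    rw [degreeMap_unitTwo, modelForm_unitTwo, h.tri_toModel, h.vert_toModel, triMap_mark₀]
  · have e := tildeB_modelForm D 0 (degreeMap h.toModel 1 θ) (degreeMap h.toModel 1 η)
    rw [h.edge_toModel, h.edge_toModel, h.1 0, S.pairingB_mk] at e
    rw [← e]
    have d := degreeMap_degen h.toModel 1
    change modelForm D (degen (model D) 1 1 (degreeMap h.toModel 1 θ))
        (degen (model D) 1 0 (degreeMap h.toModel 1 η))
      + modelForm D (degen (model D) 1 1 (degreeMap h.toModel 1 η))
        (degen (model D) 1 0 (degreeMap h.toModel 1 θ)) = _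
    rw [← d, ← d, ← d, ← d]
    rfl

theorem HasData.equiv_model : S ≈ modelSymplectic D :=
  ⟨h.modelIso, h.modelIso_isEquivalence, h.edge_toModel, h.vert_toModel⟩

end MarkedSymplecticTwoGroupoid

end Classification

/-! ### Invariance of the linear algebra data under equivalence -/

section Invariance

variable {S T : ConstantSymplecticTwoGroupoid.{u}} {φ : S.X ≅ T.X}

/-- The two forms differ by `δα`, and `B_{δα} = 0` is part of the definition of equivalence. -/
theorem ConstantSymplecticTwoGroupoid.IsEquivalence.pairingB_eq
    (h : ConstantSymplecticTwoGroupoid.IsEquivalence φ) (x : S.X _⦋0⦌) (θ η : S.X _⦋1⦌) :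
    pairingB T.X T.ω T.normalized (degreeMap φ.hom 0 x)
        (Submodule.Quotient.mk (degreeMap φ.hom 1 θ)) (Submodule.Quotient.mk (degreeMap φ.hom 1 η))
      = pairingB S.X S.ω S.normalized x (Submodule.Quotient.mk θ) (Submodule.Quotient.mk η) := by
  obtain ⟨α, -, -, -, h1, -, h2⟩ := h
  have e := congrArg (fun B : S.X _⦋1⦌ →ₗ[ℝ] S.X _⦋1⦌ →ₗ[ℝ] ℝ => B θ η) (h2 x)
  change coboundary S.X 1 α (unitTwo S.X x) (degen S.X 1 1 θ) (degen S.X 1 0 η)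
    + coboundary S.X 1 α (unitTwo S.X x) (degen S.X 1 1 η) (degen S.X 1 0 θ) = 0 at e
  rw [← h1, ← h1] at e
  have d := degreeMap_degen φ.hom 1
  change T.ω (unitTwo T.X (degreeMap φ.hom 0 x)) (degen T.X 1 1 (degreeMap φ.hom 1 θ))
      (degen T.X 1 0 (degreeMap φ.hom 1 η))
    + T.ω (unitTwo T.X (degreeMap φ.hom 0 x)) (degen T.X 1 1 (degreeMap φ.hom 1 η))
      (degen T.X 1 0 (degreeMap φ.hom 1 θ))
    = S.ω (unitTwo S.X x) (degen S.X 1 1 θ) (degen S.X 1 0 η)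
      + S.ω (unitTwo S.X x) (degen S.X 1 1 η) (degen S.X 1 0 θ)
  rw [← degreeMap_unitTwo, ← d, ← d, ← d, ← d]
  simp only [pullback, LinearMap.compl₁₂_apply] at e
  exact sub_eq_zero.mp (Eq.trans (by simp only [Nat.reduceAdd]; ring) e)

theorem degreeMap_tangentBoundary {X Y : SVect.{u}} (φ : X ⟶ Y) (θ : X _⦋1⦌) :
    degreeMap φ 0 (tangentBoundary X (Submodule.Quotient.mk θ))
      = tangentBoundary Y (Submodule.Quotient.mk (degreeMap φ 1 θ)) := by
  rw [tangentBoundary_mk, tangentBoundary_mk, map_sub, degreeMap_face, degreeMap_face]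

variable {W₁ W₀ : Type u} [AddCommGroup W₁] [Module ℝ W₁] [FiniteDimensional ℝ W₁]
  [AddCommGroup W₀] [Module ℝ W₀] [FiniteDimensional ℝ W₀]

theorem MarkedSymplecticTwoGroupoid.HasData.of_equiv {S T : MarkedSymplecticTwoGroupoid W₁ W₀}
    {D : IsotropicData W₁ W₀} (hT : T.HasData D) (h : S ≈ T) : S.HasData D := by
  obtain ⟨φ, hφ, h1, h0⟩ := h
  constructor
  · intro x θ η
    obtain ⟨θ, rfl⟩ := Submodule.Quotient.mk_surjective _ θ
    obtain ⟨η, rfl⟩ := Submodule.Quotient.mk_surjective _ η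
    rw [← h1, ← h1, ← hφ.pairingB_eq]
    exact hT.1 _ _ _
  · intro θ
    obtain ⟨θ, rfl⟩ := Submodule.Quotient.mk_surjective _ θ
    rw [← h1, ← h0, degreeMap_tangentBoundary]
    exact hT.2 _

theorem modelSymplectic_hasData (D : IsotropicData W₁ W₀) : (modelSymplectic D).HasData D :=
  ⟨fun x θ η => (pairingB_modelForm D x θ η).symm, modelMark₀_tangentBoundary D⟩

theorem equiv_modelSymplectic_iff {S : MarkedSymplecticTwoGroupoid W₁ W₀}
    {D : IsotropicData W₁ W₀} : modelSymplectic D ≈ S ↔ S.HasData D :=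
  ⟨fun h => (modelSymplectic_hasData D).of_equiv (Setoid.symm h),
    fun h => Setoid.symm h.equiv_model⟩

theorem MarkedSymplecticTwoGroupoid.HasData.unique {S : MarkedSymplecticTwoGroupoid W₁ W₀}
    {D D' : IsotropicData W₁ W₀} (h : S.HasData D) (h' : S.HasData D') : D = D' := by
  refine IsotropicData.ext ?_ ?_
  · refine LinearMap.ext fun w => LinearMap.ext fun w' => ?_
    obtain ⟨θ, rfl⟩ := S.mark₁.surjective w
    obtain ⟨η, rfl⟩ := S.mark₁.surjective w'
    rw [h.1 0, h'.1 0]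
  · refine LinearMap.ext fun w => ?_
    obtain ⟨θ, rfl⟩ := S.mark₁.surjective w
    rw [h.2, h'.2]

theorem tangentBoundary_boundary (X : SVect.{u}) (w : X _⦋2⦌) :
    tangentBoundary X (Submodule.Quotient.mk (face X 1 0 w - face X 1 1 w + face X 1 2 w)) = 0 := by
  have h1 : face X 0 0 (face X 1 1 w) = face X 0 0 (face X 1 0 w) :=
    face_face X 0 (i := 0) (j := 0) le_rfl w
  have h2 : face X 0 0 (face X 1 2 w) = face X 0 1 (face X 1 0 w) :=
    face_face X 0 (i := 0) (j := 1) (by decide) w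
  have h3 : face X 0 1 (face X 1 2 w) = face X 0 1 (face X 1 1 w) :=
    face_face X 0 (i := 1) (j := 1) le_rfl w
  rw [tangentBoundary_mk, map_add, map_sub, map_add, map_sub, h1, h2, h3]
  abel

/-- The form `B_ω`, transported to `W₁`. -/
def MarkedSymplecticTwoGroupoid.markedPairing (S : MarkedSymplecticTwoGroupoid W₁ W₀) :
    LinearMap.BilinForm ℝ W₁ :=
  (pairingB S.X S.ω S.normalized 0).compl₁₂ S.mark₁.symm.toLinearMap S.mark₁.symm.toLinearMap

theorem MarkedSymplecticTwoGroupoid.markedPairing_mark (S : MarkedSymplecticTwoGroupoid W₁ W₀)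
    (x : S.X _⦋0⦌) (θ η : NormTangent S.X 0) :
    S.markedPairing (S.mark₁ θ) (S.mark₁ η) = pairingB S.X S.ω S.normalized x θ η := by
  change pairingB S.X S.ω S.normalized 0 (S.mark₁.symm (S.mark₁ θ)) (S.mark₁.symm (S.mark₁ η)) = _
  rw [LinearEquiv.symm_apply_apply, LinearEquiv.symm_apply_apply]
  obtain ⟨θ, rfl⟩ := Submodule.Quotient.mk_surjective _ θ
  obtain ⟨η, rfl⟩ := Submodule.Quotient.mk_surjective _ η
  rw [S.pairingB_mk, S.pairingB_mk]

theorem MarkedSymplecticTwoGroupoid.markedPairing_nondegenerate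
    (S : MarkedSymplecticTwoGroupoid W₁ W₀) : S.markedPairing.Nondegenerate := by
  refine ⟨fun w hw => ?_, fun w hw => ?_⟩ <;> obtain ⟨θ, rfl⟩ := S.mark₁.surjective w
  · rw [(S.nondegenerate 0).2.1 θ fun η => ?_, map_zero]
    rw [← S.markedPairing_mark]
    exact hw _
  · rw [(S.nondegenerate 0).2.2 θ fun η => ?_, map_zero]
    rw [← S.markedPairing_mark]
    exact hw _

/-- The linear algebra data of a marked constant symplectic 2-groupoid. -/
def MarkedSymplecticTwoGroupoid.data (S : MarkedSymplecticTwoGroupoid W₁ W₀) :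
    IsotropicData W₁ W₀ where
  pairing := S.markedPairing
  symm := ⟨fun w w' => by
    obtain ⟨θ, rfl⟩ := S.mark₁.surjective w
    obtain ⟨η, rfl⟩ := S.mark₁.surjective w'
    obtain ⟨θ, rfl⟩ := Submodule.Quotient.mk_surjective _ θ
    obtain ⟨η, rfl⟩ := Submodule.Quotient.mk_surjective _ η
    rw [S.markedPairing_mark 0, S.markedPairing_mark 0, S.pairingB_mk, S.pairingB_mk, add_comm]⟩
  nondegenerate := S.markedPairing_nondegenerate
  del := S.mark₀.toLinearMap ∘ₗ tangentBoundary S.X ∘ₗ S.mark₁.symm.toLinearMap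
  isotropic := by
    refine LinearMap.ext fun ξ => ?_
    -- Every functional has the form `A(·, w)`, whose image under `∂^*` is the class of the boundary
    -- of `w` by `boundary_adjoint`. Isotropy is then `∂² = 0`.
    obtain ⟨w, rfl⟩ := S.triMap_surjective ξ
    have h : (S.markedPairing.toDual S.markedPairing_nondegenerate).symm
        ((S.mark₀.toLinearMap ∘ₗ tangentBoundary S.X ∘ₗ S.mark₁.symm.toLinearMap).dualMap
          (S.triMap w)) = S.mark₁ (Submodule.Quotient.mk
            (face S.X 1 0 w - face S.X 1 1 w + face S.X 1 2 w)) := by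
      rw [LinearEquiv.symm_apply_eq]
      refine LinearMap.ext fun θ => ?_
      obtain ⟨θ, rfl⟩ := S.mark₁.surjective θ
      obtain ⟨θ, rfl⟩ := Submodule.Quotient.mk_surjective _ θ
      change S.triMap w (S.mark₀ (tangentBoundary S.X (S.mark₁.symm (S.mark₁ _))))
        = S.markedPairing _ _
      rw [LinearEquiv.symm_apply_apply, tangentBoundary_mk, S.triMap_mark₀,
        S.isNormalizedCocycle.boundary_adjoint, S.markedPairing_mark 0, S.pairingB_mk, add_comm]
    refine (congrArg (fun z => S.mark₀ (tangentBoundary S.X (S.mark₁.symm z))) h).trans ?_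
    rw [LinearEquiv.symm_apply_apply, tangentBoundary_boundary, map_zero]
    rfl

theorem MarkedSymplecticTwoGroupoid.hasData (S : MarkedSymplecticTwoGroupoid W₁ W₀) :
    S.HasData S.data :=
  ⟨fun x θ η => S.markedPairing_mark x θ η, fun θ =>
    congrArg (fun z => S.mark₀ (tangentBoundary S.X z)) (S.mark₁.symm_apply_apply θ)⟩

end Invariance

end ConstantCourant

end

noncomputable section

set_option linter.unusedSectionVars false

namespace ConstantCourant

/-! ### Constant Courant algebroids and their linear algebra data -/

section LineDeriv

variable {V W : Type u} [AddCommGroup V] [Module ℝ V] [AddCommGroup W] [Module ℝ W]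

theorem SmoothFun.linear [FiniteDimensional ℝ V] (ξ : V →ₗ[ℝ] ℝ) : SmoothFun fun x => ξ x :=
  (LinearMap.toContinuousLinearMap (ξ ∘ₗ (coords V).symm.toLinearMap)).contDiff

theorem lineDeriv_linear_mul (ξ : V →ₗ[ℝ] ℝ) (c : ℝ) (x v : V) :
    lineDeriv ℝ (fun y => ξ y * c) x v = ξ v * c := by
  simp [lineDeriv]

theorem lineDeriv_linear (ξ : V →ₗ[ℝ] ℝ) (x v : V) : lineDeriv ℝ (fun y => ξ y) x v = ξ v := by
  simp [lineDeriv]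

theorem lineDeriv_map (φ : V →ₗ[ℝ] W) {f : V → ℝ} {g : W → ℝ} (h : ∀ y, g (φ y) = f y)
    (x v : V) : lineDeriv ℝ g (φ x) (φ v) = lineDeriv ℝ f x v := by
  unfold lineDeriv
  congr 1
  funext t
  rw [← h, map_add, map_smul]

end LineDeriv

/-! ### Reduction of a constant Courant algebroid to pairing and anchor -/

section Courant

variable {W₁ W₀ : Type u} [AddCommGroup W₁] [Module ℝ W₁] [FiniteDimensional ℝ W₁]
  [AddCommGroup W₀] [Module ℝ W₀] [FiniteDimensional ℝ W₀]

namespace ConstantCourantAlgebroid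

variable (E : ConstantCourantAlgebroid W₁ W₀)

/-- The bracket is determined by the pairing and the anchor. -/
theorem pairing_bracket (e₁ e₂ : Sections W₁ W₀) (x : W₀) (w : W₁) :
    E.pairing x ((E.bracket e₁ e₂).1 x) w
      = lineDeriv ℝ (fun y => E.pairing y (e₂.1 y) w) x (E.anchor x (e₁.1 x))
        - lineDeriv ℝ (fun y => E.pairing y (e₁.1 y) w) x (E.anchor x (e₂.1 x))
        + lineDeriv ℝ (fun y => E.pairing y (e₁.1 y) (e₂.1 x)) x (E.anchor x w) := by
  -- Freeze `w` and `e₂(x)` as constant sections. Invariance trades `⟨[e₁, e₂], w⟩` for `⟨[e₁, w],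
  -- e₂(x)⟩`, the skew axiom reverses this bracket, and a second invariance removes it because `[w,
  -- e₂(x)] = 0`.
  have i1 := E.invariance e₁ e₂ (Sections.const w) x
  have s1 := E.skew e₁ (Sections.const w) (Sections.const (e₂.1 x)) x
  have i2 := E.invariance (Sections.const w) e₁ (Sections.const (e₂.1 x)) x
  rw [E.bracket_constant] at i2
  have sy : E.pairing x ((E.bracket e₁ (Sections.const w)).1 x) (e₂.1 x)
    = E.pairing x (e₂.1 x) ((E.bracket e₁ (Sections.const w)).1 x) := (E.pairing_symm x).eq _ _
  change lineDeriv ℝ (fun y => E.pairing y (e₂.1 y) w) x (E.anchor x (e₁.1 x)) = _ at i1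
  change E.pairing x ((E.bracket e₁ (Sections.const w)).1 x
      + (E.bracket (Sections.const w) e₁).1 x) (e₂.1 x)
    = lineDeriv ℝ (fun y => E.pairing y (e₁.1 y) w) x (E.anchor x (e₂.1 x)) at s1
  change lineDeriv ℝ (fun y => E.pairing y (e₁.1 y) (e₂.1 x)) x (E.anchor x w)
    = E.pairing x ((E.bracket (Sections.const w) e₁).1 x) (e₂.1 x)
      + E.pairing x (e₁.1 x) 0 at i2
  change _ = _ + E.pairing x (e₂.1 x) ((E.bracket e₁ (Sections.const w)).1 x) at i1
  change _ = E.pairing x ((E.bracket e₁ e₂).1 x) w + _ at i1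
  rw [map_add, LinearMap.add_apply] at s1
  rw [map_zero] at i2
  linarith

/-- Put `s = ρ^* ξ ≠ 0` and choose `w₂` with `⟨s, w₂⟩ ≠ 0`. The sections `ξ s` and `w₂` have
symmetrized bracket `𝒟(ξ ⟨s, w₂⟩) = ⟨s, w₂⟩ s`, and by the Jacobi identity a symmetrized bracket has
zero bracket with every section on its right. The Leibniz rule then gives `⟨s, w₂⟩ g(ρ s) s = 0` for
every functional `g`, so `ρ s = 0`. -/
theorem anchor_toDual_symm (ξ : Module.Dual ℝ W₀) :
    E.anchor 0 (((E.pairing 0).toDual (E.pairing_nondegenerate 0)).symm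
      ((E.anchor 0).dualMap ξ)) = 0 := by
  set s := ((E.pairing 0).toDual (E.pairing_nondegenerate 0)).symm ((E.anchor 0).dualMap ξ)
  have hs : ∀ w, E.pairing 0 s w = ξ (E.anchor 0 w) := fun w =>
    LinearMap.BilinForm.apply_toDual_symm_apply (hB := E.pairing_nondegenerate 0)
      ((E.anchor 0).dualMap ξ) w
  by_cases hW : s = 0
  · rw [hW, map_zero]
  obtain ⟨w₂, hw₂⟩ : ∃ w₂, E.pairing 0 s w₂ ≠ 0 := by
    by_contra hcon
    push Not at hcon
    exact hW ((E.pairing_nondegenerate 0).1 s hcon)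
  let e₁ : Sections W₁ W₀ := Sections.mulFun (fun y => ξ y) (SmoothFun.linear ξ) (Sections.const s)
  let e₂ : Sections W₁ W₀ := Sections.const w₂
  have hsum : E.bracket e₁ e₂ + E.bracket e₂ e₁ = Sections.const (E.pairing 0 s w₂ • s) := by
    refine Subtype.ext (funext fun x => ?_)
    rw [← sub_eq_zero]
    refine (E.pairing_nondegenerate x).1 _ fun w => ?_
    have h := E.skew e₁ e₂ (Sections.const w) x
    have hl : (fun y => E.pairing y (e₁.1 y) (e₂.1 y)) = fun y => ξ y * E.pairing 0 s w₂ := by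
      funext y
      change E.pairing y (ξ y • s) w₂ = _
      rw [map_smul, E.pairing_constant y 0]
      rfl
    rw [hl, lineDeriv_linear_mul] at h
    change E.pairing x _ w = ξ (E.anchor x w) * _ at h
    rw [map_sub, LinearMap.sub_apply, h, E.pairing_constant x 0, E.anchor_constant x 0]
    change _ - E.pairing 0 (E.pairing 0 s w₂ • s) w = 0
    rw [map_smul, LinearMap.smul_apply, hs w, smul_eq_mul]
    ring
  have hj : ∀ e₃, E.bracket (Sections.const (E.pairing 0 s w₂ • s)) e₃ = 0 := fun e₃ => by
    rw [← hsum, map_add, LinearMap.add_apply, E.jacobi, E.jacobi]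
    abel
  rw [← Module.forall_dual_apply_eq_zero_iff ℝ]
  intro g
  -- Any nonzero constant section would serve as the second argument; `s` is at hand.
  have hl := E.leibniz (Sections.const (E.pairing 0 s w₂ • s)) (Sections.const s) (fun y => g y)
    (SmoothFun.linear g) 0
  rw [hj, hj, lineDeriv_linear] at hl
  change (0 : W₁) = g (E.anchor 0 (E.pairing 0 s w₂ • s)) • s + g 0 • (0 : W₁) at hl
  rw [smul_zero, add_zero, map_smul, map_smul, smul_eq_mul] at hl
  have h0 := (smul_eq_zero.mp hl.symm).resolve_right hW
  exact (mul_eq_zero.mp h0).resolve_left hw₂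

/-- The linear algebra data of a constant Courant algebroid. -/
def data : IsotropicData W₁ W₀ where
  pairing := E.pairing 0
  symm := E.pairing_symm 0
  nondegenerate := E.pairing_nondegenerate 0
  del := E.anchor 0
  isotropic := LinearMap.ext E.anchor_toDual_symm

theorem data_injective : Function.Injective (data (W₁ := W₁) (W₀ := W₀)) := by
  intro E E' h
  have hp : E.pairing = E'.pairing := by
    funext x
    rw [E.pairing_constant x 0, E'.pairing_constant x 0]
    exact congrArg IsotropicData.pairing h
  have ha : E.anchor = E'.anchor := by
    funext x
    rw [E.anchor_constant x 0, E'.anchor_constant x 0]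
    exact congrArg IsotropicData.del h
  refine ConstantCourantAlgebroid.ext hp ha ?_
  refine LinearMap.ext fun e₁ => LinearMap.ext fun e₂ => Subtype.ext (funext fun x => ?_)
  rw [← sub_eq_zero]
  refine (E.pairing_nondegenerate x).1 _ fun w => ?_
  rw [map_sub, LinearMap.sub_apply, E.pairing_bracket, hp, ha, E'.pairing_bracket, sub_self]

end ConstantCourantAlgebroid

/-- The formula of `pairing_bracket` is natural in pairing and anchor, so an isomorphism preserving
these preserves the bracket. -/
theorem BundledConstantCourant.isIsomorphism_of_pairing_anchor {C D : BundledConstantCourant.{u}}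
    (φ₁ : C.W₁ ≃ₗ[ℝ] D.W₁) (φ₀ : C.W₀ ≃ₗ[ℝ] D.W₀)
    (hp : ∀ x w w', D.E.pairing (φ₀ x) (φ₁ w) (φ₁ w') = C.E.pairing x w w')
    (ha : ∀ x w, D.E.anchor (φ₀ x) (φ₁ w) = φ₀ (C.E.anchor x w)) :
    IsIsomorphism φ₁ φ₀ where
  pairing := hp
  anchor := ha
  bracket e₁ e₂ e₁' e₂' h₁ h₂ x := by
    rw [← sub_eq_zero]
    refine (D.E.pairing_nondegenerate (φ₀ x)).1 _ fun w' => ?_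
    obtain ⟨w, rfl⟩ := φ₁.surjective w'
    rw [map_sub, LinearMap.sub_apply, hp, C.E.pairing_bracket, D.E.pairing_bracket, h₁, h₂,
      ha, ha, ha, sub_eq_zero]
    have key : ∀ (e : Sections C.W₁ C.W₀) (e' : Sections D.W₁ D.W₀) (u : C.W₁) (v : C.W₀),
        (∀ x, e'.1 (φ₀ x) = φ₁ (e.1 x)) →
        lineDeriv ℝ (fun y => D.E.pairing y (e'.1 y) (φ₁ u)) (φ₀ x) (φ₀ v)
          = lineDeriv ℝ (fun y => C.E.pairing y (e.1 y) u) x v := fun e e' u v he =>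
      lineDeriv_map φ₀.toLinearMap (fun y => by
        rw [LinearEquiv.coe_coe, he, hp]) x v
    rw [key e₂ e₂' _ _ h₂, key e₁ e₁' _ _ h₁, key e₁ e₁' _ _ h₁]

end Courant

end ConstantCourant

end

noncomputable section

set_option linter.unusedSectionVars false

namespace ConstantCourant

/-! ### The Courant algebroid of isotropic data -/

section Existence

open scoped ContDiff

variable {W₁ W₀ : Type u} [NormedAddCommGroup W₁] [NormedSpace ℝ W₁] [FiniteDimensional ℝ W₁]
  [NormedAddCommGroup W₀] [NormedSpace ℝ W₀] [FiniteDimensional ℝ W₀]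

/-- Links smoothness in coordinates with smoothness for an auxiliary norm, so that Fréchet
derivatives become available. -/
theorem smoothFun_iff_contDiff {f : W₀ → ℝ} : SmoothFun f ↔ ContDiff ℝ ∞ f := by
  constructor
  · intro h
    have h2 : ContDiff ℝ ∞ (LinearMap.toContinuousLinearMap (coords W₀).toLinearMap) :=
      ContinuousLinearMap.contDiff _
    refine (congrArg (ContDiff ℝ ∞) ?_).mp (ContDiff.comp h h2)
    funext y
    simp
  · intro h
    exact h.comp (LinearMap.toContinuousLinearMap (coords W₀).symm.toLinearMap).contDiff

theorem smoothMap_iff_contDiff {e : W₀ → W₁} : SmoothMap e ↔ ContDiff ℝ ∞ e := by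
  constructor
  · intro h
    have h1 : ContDiff ℝ ∞ fun x => coords W₁ (e x) := contDiff_pi.mpr fun i =>
      smoothFun_iff_contDiff.mp (h (LinearMap.proj i ∘ₗ (coords W₁).toLinearMap))
    have h2 : ContDiff ℝ ∞ (LinearMap.toContinuousLinearMap (coords W₁).symm.toLinearMap) :=
      ContinuousLinearMap.contDiff _
    refine (congrArg (ContDiff ℝ ∞) ?_).mp (h2.comp h1)
    funext y
    simp
  · intro h ξ
    exact smoothFun_iff_contDiff.mpr ((LinearMap.toContinuousLinearMap ξ).contDiff.comp h)

theorem Sections.contDiff (e : Sections W₁ W₀) : ContDiff ℝ ∞ e.1 :=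
  smoothMap_iff_contDiff.mp e.2

theorem Sections.differentiableAt (e : Sections W₁ W₀) (x : W₀) : DifferentiableAt ℝ e.1 x :=
  (Sections.contDiff e).differentiable (by simp) x

theorem Sections.contDiff_fderiv (e : Sections W₁ W₀) : ContDiff ℝ ∞ (fderiv ℝ e.1) :=
  (Sections.contDiff e).fderiv_right (by simp)

theorem Sections.differentiableAt_fderiv (e : Sections W₁ W₀) (x : W₀) :
    DifferentiableAt ℝ (fderiv ℝ e.1) x :=
  (Sections.contDiff_fderiv e).differentiable (by simp) x

theorem Sections.fderiv_fderiv_comm (e : Sections W₁ W₀) (x u v : W₀) :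
    fderiv ℝ (fderiv ℝ e.1) x u v = fderiv ℝ (fderiv ℝ e.1) x v u :=
  ((Sections.contDiff e).contDiffAt.isSymmSndFDerivAt
    (by rw [minSmoothness_of_isRCLikeNormedField]; exact ENat.LEInfty.out)).eq u v

/-! ### The bracket built from the metric and `∂`, and the Courant axioms -/

namespace IsotropicData

variable (D : IsotropicData W₁ W₀)

/-- The pairing as a continuous bilinear map. -/
def pairingCLM : W₁ →L[ℝ] W₁ →L[ℝ] ℝ :=
  LinearMap.toContinuousLinearMap (LinearMap.toContinuousLinearMap.toLinearMap ∘ₗ D.pairing)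

theorem pairingCLM_apply (w w' : W₁) : D.pairingCLM w w' = D.pairing w w' := rfl

theorem pairingCLM_comm (w w' : W₁) : D.pairingCLM w w' = D.pairingCLM w' w := D.symm.eq w w'

theorem eq_of_pairing {w w' : W₁} (h : ∀ u, D.pairingCLM w u = D.pairingCLM w' u) : w = w' := by
  rw [← sub_eq_zero]
  refine D.nondegenerate.1 _ fun u => ?_
  rw [map_sub, LinearMap.sub_apply, sub_eq_zero]
  exact h u

/-- The map `∂` as a continuous linear map. -/
def delCLM : W₁ →L[ℝ] W₀ := LinearMap.toContinuousLinearMap D.del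

theorem smoothMap_of_pairing {e : W₀ → W₁} (h : ∀ w, ContDiff ℝ ∞ fun x => D.pairingCLM (e x) w) :
    SmoothMap e := by
  intro ξ
  have : ∀ u, ξ u = D.pairingCLM u ((D.pairing.toDual D.nondegenerate).symm ξ) := fun u => by
    rw [pairingCLM_comm, pairingCLM_apply]
    exact (LinearMap.BilinForm.apply_toDual_symm_apply (hB := D.nondegenerate) ξ u).symm
  simp only [this]
  exact smoothFun_iff_contDiff.mpr (h _)

/-- The bracket of two vector valued functions at a point. -/
def bracketFun (e₁ e₂ : W₀ → W₁) (x : W₀) : W₁ :=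
  -- The only possible formula: paired with `w`, it is what `pairing_bracket` forces.
  fderiv ℝ e₂ x (D.delCLM (e₁ x)) - fderiv ℝ e₁ x (D.delCLM (e₂ x))
    + D.codel (D.pairing.flip (e₂ x) ∘ₗ (fderiv ℝ e₁ x).toLinearMap)

theorem pairing_bracketFun (e₁ e₂ : W₀ → W₁) (x : W₀) (w : W₁) :
    D.pairingCLM (D.bracketFun e₁ e₂ x) w
      = D.pairingCLM (fderiv ℝ e₂ x (D.delCLM (e₁ x))) w
        - D.pairingCLM (fderiv ℝ e₁ x (D.delCLM (e₂ x))) w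
        + D.pairingCLM (fderiv ℝ e₁ x (D.delCLM w)) (e₂ x) := by
  have h := D.pairing_codel (D.pairing.flip (e₂ x) ∘ₗ (fderiv ℝ e₁ x).toLinearMap) w
  rw [bracketFun, map_add, map_sub, _root_.add_apply, _root_.sub_apply]
  exact congrArg _ h

/-- The `∂^*` term is killed by `∂ ∘ ∂^* = 0`. This is where isotropy enters the Jacobi identity. -/
theorem delCLM_bracketFun (e₁ e₂ : W₀ → W₁) (x : W₀) :
    D.delCLM (D.bracketFun e₁ e₂ x)
      = D.delCLM (fderiv ℝ e₂ x (D.delCLM (e₁ x)))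
        - D.delCLM (fderiv ℝ e₁ x (D.delCLM (e₂ x))) := by
  rw [bracketFun, map_add, map_sub]
  exact add_eq_left.mpr (D.del_codel _)

/-- The bracket of sections. -/
def bracketSection (e₁ e₂ : Sections W₁ W₀) : Sections W₁ W₀ :=
  ⟨D.bracketFun e₁.1 e₂.1, D.smoothMap_of_pairing fun w => by
    simp only [pairing_bracketFun]
    have h1 := Sections.contDiff e₁
    have h2 := Sections.contDiff e₂
    have k1 := Sections.contDiff_fderiv e₁
    have k2 := Sections.contDiff_fderiv e₂
    fun_prop⟩

theorem pairing_bracketSection (e₁ e₂ : Sections W₁ W₀) (x : W₀) (w : W₁) :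
    D.pairingCLM ((D.bracketSection e₁ e₂).1 x) w
      = D.pairingCLM (fderiv ℝ e₂.1 x (D.delCLM (e₁.1 x))) w
        - D.pairingCLM (fderiv ℝ e₁.1 x (D.delCLM (e₂.1 x))) w
        + D.pairingCLM (fderiv ℝ e₁.1 x (D.delCLM w)) (e₂.1 x) :=
  D.pairing_bracketFun e₁.1 e₂.1 x w

theorem delCLM_bracketSection (e₁ e₂ : Sections W₁ W₀) (x : W₀) :
    D.delCLM ((D.bracketSection e₁ e₂).1 x)
      = D.delCLM (fderiv ℝ e₂.1 x (D.delCLM (e₁.1 x)))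
        - D.delCLM (fderiv ℝ e₁.1 x (D.delCLM (e₂.1 x))) :=
  D.delCLM_bracketFun e₁.1 e₂.1 x

theorem pairing_fderiv_bracketSection (e₁ e₂ : Sections W₁ W₀) (x v : W₀) (w : W₁) :
    D.pairingCLM (fderiv ℝ (D.bracketSection e₁ e₂).1 x v) w
      = D.pairingCLM (fderiv ℝ e₂.1 x (D.delCLM (fderiv ℝ e₁.1 x v))) w
        + D.pairingCLM (fderiv ℝ (fderiv ℝ e₂.1) x v (D.delCLM (e₁.1 x))) w
        - (D.pairingCLM (fderiv ℝ e₁.1 x (D.delCLM (fderiv ℝ e₂.1 x v))) w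
          + D.pairingCLM (fderiv ℝ (fderiv ℝ e₁.1) x v (D.delCLM (e₂.1 x))) w)
        + (D.pairingCLM (fderiv ℝ e₁.1 x (D.delCLM w)) (fderiv ℝ e₂.1 x v)
          + D.pairingCLM (fderiv ℝ (fderiv ℝ e₁.1) x v (D.delCLM w)) (e₂.1 x)) := by
  have d1 := (Sections.differentiableAt e₁ x).hasFDerivAt
  have d2 := (Sections.differentiableAt e₂ x).hasFDerivAt
  have k1 := (Sections.differentiableAt_fderiv e₁ x).hasFDerivAt
  have k2 := (Sections.differentiableAt_fderiv e₂ x).hasFDerivAt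
  have hP : ∀ {f : W₀ → W₁} {f'} (_ : HasFDerivAt f f' x), HasFDerivAt
      (fun y => D.pairingCLM (f y) w) ((D.pairingCLM.flip w).comp f') x := fun hf =>
    (D.pairingCLM.flip w).hasFDerivAt.comp x hf
  have hl := hP (Sections.differentiableAt (D.bracketSection e₁ e₂) x).hasFDerivAt
  have h1 := hP (k2.clm_apply (D.delCLM.hasFDerivAt.comp x d1))
  have h2 := hP (k1.clm_apply (D.delCLM.hasFDerivAt.comp x d2))
  have h3 := (D.pairingCLM.hasFDerivAt.comp x
    (k1.clm_apply (hasFDerivAt_const (D.delCLM w) x))).clm_apply d2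
  have hr := (h1.sub h2).add h3
  have he : (fun y => D.pairingCLM ((D.bracketSection e₁ e₂).1 y) w)
      = fun y => D.pairingCLM (fderiv ℝ e₂.1 y (D.delCLM (e₁.1 y))) w
        - D.pairingCLM (fderiv ℝ e₁.1 y (D.delCLM (e₂.1 y))) w
        + D.pairingCLM (fderiv ℝ e₁.1 y (D.delCLM w)) (e₂.1 y) :=
    funext fun y => D.pairing_bracketSection e₁ e₂ y w
  rw [he] at hl
  have := congrArg (fun L => L v) (hl.unique hr)
  simpa using this

/-- Paired with `d`, both sides expand into products of first derivatives and terms with one second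
derivative. They match once second derivatives are taken symmetric and the pairing is commuted;
`delCLM_bracketSection` removes `∂^*` inside nested anchors. -/
theorem bracketSection_jacobi (a b c : Sections W₁ W₀) :
    D.bracketSection (D.bracketSection a b) c
      = D.bracketSection a (D.bracketSection b c) - D.bracketSection b (D.bracketSection a c) := by
  refine Subtype.ext (funext fun x => D.eq_of_pairing fun d => ?_)
  change _ = D.pairingCLM ((D.bracketSection a (D.bracketSection b c)).1 x
    - (D.bracketSection b (D.bracketSection a c)).1 x) d
  rw [map_sub, _root_.sub_apply]
  rw [D.pairing_bracketSection _ c, D.pairing_bracketSection a (D.bracketSection b c),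
    D.pairing_bracketSection b (D.bracketSection a c)]
  simp only [delCLM_bracketSection, pairing_fderiv_bracketSection, map_sub,
    _root_.sub_apply]
  rw [D.pairingCLM_comm _ ((D.bracketSection b c).1 x),
    D.pairingCLM_comm _ ((D.bracketSection a c).1 x), D.pairing_bracketSection,
    D.pairing_bracketSection]
  -- Bring all second derivatives and pairings into one normal form, so that the remaining identity
  -- is polynomial.
  rw [Sections.fderiv_fderiv_comm a x (D.delCLM (c.1 x)) (D.delCLM d),
    Sections.fderiv_fderiv_comm a x (D.delCLM (c.1 x)) (D.delCLM (b.1 x)),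
    Sections.fderiv_fderiv_comm a x (D.delCLM d) (D.delCLM (b.1 x)),
    Sections.fderiv_fderiv_comm b x (D.delCLM (c.1 x)) (D.delCLM (a.1 x)),
    Sections.fderiv_fderiv_comm b x (D.delCLM d) (D.delCLM (a.1 x)),
    Sections.fderiv_fderiv_comm c x (D.delCLM (a.1 x)) (D.delCLM (b.1 x))]
  rw [D.pairingCLM_comm (fderiv ℝ c.1 x (D.delCLM (b.1 x))) (fderiv ℝ a.1 x (D.delCLM d)),
    D.pairingCLM_comm (fderiv ℝ c.1 x (D.delCLM (a.1 x))) (fderiv ℝ b.1 x (D.delCLM d)),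
    D.pairingCLM_comm (fderiv ℝ b.1 x (D.delCLM (c.1 x))) (fderiv ℝ a.1 x (D.delCLM d))]
  ring

/-- The bracket of sections, as a bilinear map. -/
def bracketLin : Sections W₁ W₀ →ₗ[ℝ] Sections W₁ W₀ →ₗ[ℝ] Sections W₁ W₀ := by
  have hadd : ∀ (e e' : Sections W₁ W₀) (x : W₀),
      fderiv ℝ (e + e').1 x = fderiv ℝ e.1 x + fderiv ℝ e'.1 x := fun e e' x =>
    fderiv_add (Sections.differentiableAt e x) (Sections.differentiableAt e' x)
  have hsmul : ∀ (c : ℝ) (e : Sections W₁ W₀) (x : W₀),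
      fderiv ℝ (c • e).1 x = c • fderiv ℝ e.1 x := fun c e x =>
    fderiv_const_smul (Sections.differentiableAt e x) c
  have vadd : ∀ (e e' : Sections W₁ W₀) (x : W₀), (e + e').1 x = e.1 x + e'.1 x :=
    fun _ _ _ => rfl
  have vsmul : ∀ (c : ℝ) (e : Sections W₁ W₀) (x : W₀), (c • e).1 x = c • e.1 x :=
    fun _ _ _ => rfl
  refine LinearMap.mk₂ ℝ D.bracketSection ?_ ?_ ?_ ?_
  all_goals
    intro p q r
    refine Subtype.ext (funext fun x => D.eq_of_pairing fun d => ?_)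
    simp only [vadd, vsmul, hadd, hsmul, pairing_bracketSection, map_add, map_smul,
      _root_.add_apply, _root_.smul_apply, smul_eq_mul]
    ring

theorem bracketLin_apply (e₁ e₂ : Sections W₁ W₀) :
    D.bracketLin e₁ e₂ = D.bracketSection e₁ e₂ := rfl

theorem lineDeriv_pairing (e e' : Sections W₁ W₀) (x v : W₀) :
    lineDeriv ℝ (fun y => D.pairing (e.1 y) (e'.1 y)) x v
      = D.pairingCLM (fderiv ℝ e.1 x v) (e'.1 x) + D.pairingCLM (e.1 x) (fderiv ℝ e'.1 x v) := by
  have d := (Sections.differentiableAt e x).hasFDerivAt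
  have d' := (Sections.differentiableAt e' x).hasFDerivAt
  have h := (D.pairingCLM.hasFDerivAt.comp x d).clm_apply d'
  have := (h.hasLineDerivAt v).lineDeriv
  refine Eq.trans this ?_
  simp [add_comm]

/-- The constant Courant algebroid of isotropic data, in terms of auxiliary norms. -/
def courantAux : ConstantCourantAlgebroid W₁ W₀ where
  pairing _ := D.pairing
  anchor _ := D.del
  bracket := D.bracketLin
  pairing_smooth _ _ := SmoothFun.const _
  pairing_symm _ := D.symm
  pairing_nondegenerate _ := D.nondegenerate
  anchor_smooth _ ξ := SmoothFun.const _
  leibniz e₁ e₂ f hf x := by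
    have hf' := (smoothFun_iff_contDiff.mp hf).differentiable (by simp) x
    have hd : fderiv ℝ (Sections.mulFun f hf e₂).1 x
        = f x • fderiv ℝ e₂.1 x + (fderiv ℝ f x).smulRight (e₂.1 x) :=
      fderiv_fun_smul hf' (Sections.differentiableAt e₂ x)
    have hv : (Sections.mulFun f hf e₂).1 x = f x • e₂.1 x := rfl
    rw [hf'.lineDeriv_eq_fderiv]
    refine D.eq_of_pairing fun d => ?_
    simp only [bracketLin_apply, pairing_bracketSection, hd, hv, map_add, map_smul,
      _root_.add_apply, _root_.smul_apply,
      ContinuousLinearMap.smulRight_apply, smul_eq_mul]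
    change _ = fderiv ℝ f x (D.delCLM (e₁.1 x)) * _ + _
    ring
  invariance e₁ e₂ e₃ x := by
    rw [lineDeriv_pairing]
    change _ = D.pairingCLM ((D.bracketSection e₁ e₂).1 x) (e₃.1 x)
      + D.pairingCLM (e₂.1 x) ((D.bracketSection e₁ e₃).1 x)
    rw [D.pairingCLM_comm (e₂.1 x) ((D.bracketSection e₁ e₃).1 x), pairing_bracketSection,
      pairing_bracketSection, D.pairingCLM_comm (e₂.1 x)]
    change D.pairingCLM (fderiv ℝ e₂.1 x (D.delCLM (e₁.1 x))) _
      + D.pairingCLM (fderiv ℝ e₃.1 x (D.delCLM (e₁.1 x))) _ = _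
    ring
  jacobi := D.bracketSection_jacobi
  skew e₁ e₂ e x := by
    rw [lineDeriv_pairing]
    change D.pairingCLM ((D.bracketSection e₁ e₂).1 x + (D.bracketSection e₂ e₁).1 x) (e.1 x)
      = D.pairingCLM (fderiv ℝ e₁.1 x (D.delCLM (e.1 x))) _
        + D.pairingCLM _ (fderiv ℝ e₂.1 x (D.delCLM (e.1 x)))
    rw [map_add, _root_.add_apply, pairing_bracketSection, pairing_bracketSection,
      D.pairingCLM_comm (e₁.1 x)]
    ring
  pairing_constant _ _ := rfl
  anchor_constant _ _ := rfl
  bracket_constant w w' := by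
    refine Subtype.ext (funext fun x => D.eq_of_pairing fun d => ?_)
    have hc : ∀ w : W₁, fderiv ℝ (Sections.const (W₀ := W₀) w).1 x = 0 := fun w =>
      fderiv_const_apply w
    rw [bracketLin_apply, pairing_bracketSection, hc, hc]
    simp

end IsotropicData

end Existence

section Data

variable {W₁ W₀ : Type u} [AddCommGroup W₁] [Module ℝ W₁] [FiniteDimensional ℝ W₁]
  [AddCommGroup W₀] [Module ℝ W₀] [FiniteDimensional ℝ W₀]

theorem ConstantCourantAlgebroid.data_surjective :
    Function.Surjective (ConstantCourantAlgebroid.data (W₁ := W₁) (W₀ := W₀)) := by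
  intro D
  -- Norms induced from coordinates keep the given algebraic structure, so the algebroid constructed
  -- with them has the required type and its data are `D` by definition.
  let _ : NormedAddCommGroup W₁ :=
    NormedAddCommGroup.induced W₁ _ (coords W₁) (coords W₁).injective
  let _ : NormedSpace ℝ W₁ := NormedSpace.induced ℝ W₁ _ (coords W₁)
  let _ : NormedAddCommGroup W₀ :=
    NormedAddCommGroup.induced W₀ _ (coords W₀) (coords W₀).injective
  let _ : NormedSpace ℝ W₀ := NormedSpace.induced ℝ W₀ _ (coords W₀)
  exact ⟨D.courantAux, rfl⟩

end Data

end ConstantCourant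

end

/-! ### Isomorphism classes and the final correspondences -/

namespace ConstantCourant

theorem MarkedSymplecticTwoGroupoid.equiv_of_marked_equiv {W₁ W₀ : Type u} [AddCommGroup W₁]
    [Module ℝ W₁] [AddCommGroup W₀] [Module ℝ W₀] {S T : MarkedSymplecticTwoGroupoid W₁ W₀}
    (h : S ≈ T) : S.toConstantSymplecticTwoGroupoid ≈ T.toConstantSymplecticTwoGroupoid := by
  obtain ⟨φ, hφ, -, -⟩ := h
  exact ⟨φ, hφ⟩

theorem ConstantCourantAlgebroid.data_pairing {W₁ W₀ : Type u} [AddCommGroup W₁] [Module ℝ W₁]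
    [FiniteDimensional ℝ W₁] [AddCommGroup W₀] [Module ℝ W₀] [FiniteDimensional ℝ W₀]
    (E : ConstantCourantAlgebroid W₁ W₀) (x : W₀) : E.data.pairing = E.pairing x :=
  E.pairing_constant 0 x

theorem ConstantCourantAlgebroid.data_del {W₁ W₀ : Type u} [AddCommGroup W₁] [Module ℝ W₁]
    [FiniteDimensional ℝ W₁] [AddCommGroup W₀] [Module ℝ W₀] [FiniteDimensional ℝ W₀]
    (E : ConstantCourantAlgebroid W₁ W₀) (x : W₀) : E.data.del = E.anchor x :=
  E.anchor_constant 0 x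

/-- The two isomorphisms in `Corresponds` are exactly a marking; this transfers the marked
classification to unmarked objects. -/
theorem corresponds_iff_exists_hasData {C : BundledConstantCourant.{u}}
    {S : ConstantSymplecticTwoGroupoid.{u}} :
    Corresponds C S ↔ ∃ T : MarkedSymplecticTwoGroupoid C.W₁ C.W₀,
      T.toConstantSymplecticTwoGroupoid = S ∧ T.HasData C.E.data := by
  constructor
  · rintro ⟨φ₁, φ₀, hp, ha⟩
    refine ⟨{ S with mark₁ := φ₁, mark₀ := φ₀ }, rfl, fun x θ η => ?_, fun θ => ?_⟩
    · rw [C.E.data_pairing (φ₀ x)]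
      exact hp x θ η
    · exact ha 0 θ
  · rintro ⟨T, rfl, hT⟩
    refine ⟨T.mark₁, T.mark₀, fun x θ η => ?_, fun x θ => ?_⟩
    · rw [← C.E.data_pairing]
      exact hT.1 x θ η
    · rw [← C.E.data_del]
      exact hT.2 θ

/-- The constant symplectic 2-groupoid of a constant Courant algebroid. -/
noncomputable def BundledConstantCourant.symplectic (C : BundledConstantCourant.{u}) :
    ConstantSymplecticTwoGroupoid.{u} :=
  (modelSymplectic C.E.data).toConstantSymplecticTwoGroupoid

theorem corresponds_symplectic (C : BundledConstantCourant.{u}) : Corresponds C C.symplectic :=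
  corresponds_iff_exists_hasData.mpr ⟨modelSymplectic C.E.data, rfl, modelSymplectic_hasData _⟩

theorem Corresponds.equiv_symplectic {C : BundledConstantCourant.{u}}
    {S : ConstantSymplecticTwoGroupoid.{u}} (h : Corresponds C S) : S ≈ C.symplectic := by
  obtain ⟨T, rfl, hT⟩ := corresponds_iff_exists_hasData.mp h
  exact MarkedSymplecticTwoGroupoid.equiv_of_marked_equiv hT.equiv_model

theorem Corresponds.of_iso {C D : BundledConstantCourant.{u}} {S : ConstantSymplecticTwoGroupoid.{u}}
    (h : Corresponds C S) (e : C ≈ D) : Corresponds D S := by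
  obtain ⟨φ₁, φ₀, hp, ha⟩ := h
  obtain ⟨ψ₁, ψ₀, hψ⟩ := e
  refine ⟨φ₁.trans ψ₁, φ₀.trans ψ₀, fun x θ η => ?_, fun x θ => ?_⟩
  · exact (hψ.pairing _ _ _).trans (hp x θ η)
  · obtain ⟨x, rfl⟩ := ψ₀.surjective x
    exact (hψ.anchor _ _).trans (congrArg ψ₀ (ha x θ))

/-- Composing the identifications through `S` preserves pairing and anchor, hence the bracket. This
gives injectivity on isomorphism classes. -/
theorem Corresponds.iso {C D : BundledConstantCourant.{u}} {S : ConstantSymplecticTwoGroupoid.{u}}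
    (h : Corresponds C S) (k : Corresponds D S) : C ≈ D := by
  obtain ⟨φ₁, φ₀, hp, ha⟩ := h
  obtain ⟨ψ₁, ψ₀, kp, ka⟩ := k
  refine ⟨φ₁.symm.trans ψ₁, φ₀.symm.trans ψ₀,
    BundledConstantCourant.isIsomorphism_of_pairing_anchor _ _ (fun x w w' => ?_) fun x w => ?_⟩
  · refine (kp _ _ _).trans ?_
    have := hp (φ₀.symm x) (φ₁.symm w) (φ₁.symm w')
    rw [φ₀.apply_symm_apply, φ₁.apply_symm_apply, φ₁.apply_symm_apply] at this
    exact this.symm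
  · refine (ka _ _).trans (congrArg ψ₀ ?_)
    have := ha x (φ₁.symm w)
    rw [φ₁.apply_symm_apply] at this
    rw [this]
    exact (φ₀.symm_apply_apply _).symm

theorem Corresponds.of_equiv {C : BundledConstantCourant.{u}}
    {S T : ConstantSymplecticTwoGroupoid.{u}} (h : Corresponds C T) (e : S ≈ T) :
    Corresponds C S := by
  obtain ⟨φ₁, φ₀, hp, ha⟩ := h
  obtain ⟨φ, hφ⟩ := e
  let ψ₀ : S.X _⦋0⦌ ≃ₗ[ℝ] T.X _⦋0⦌ := (φ.app (op ⦋0⦌)).toLinearEquiv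
  let ψ : S.X _⦋1⦌ ≃ₗ[ℝ] T.X _⦋1⦌ := (φ.app (op ⦋1⦌)).toLinearEquiv
  have hψ : ∀ θ, ψ θ = degreeMap φ.hom 1 θ := fun _ => rfl
  have hψ' : ∀ θ, ψ.symm θ = degreeMap φ.inv 1 θ := fun _ => rfl
  -- A simplicial isomorphism matches degenerate subspaces, so it descends to `T̂_1`.
  have hmap : (degenerate S.X 0).map (ψ : S.X _⦋1⦌ →ₗ[ℝ] T.X _⦋1⦌) = degenerate T.X 0 := by
    refine le_antisymm ?_ ?_
    · rw [Submodule.map_le_iff_le_comap]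
      refine iSup_le fun i => ?_
      rintro _ ⟨v, rfl⟩
      rw [Submodule.mem_comap, LinearEquiv.coe_coe, hψ]
      exact (degreeMap_degen φ.hom 0 i v).symm ▸ degen_mem_degenerate T.X 0 i _
    · refine iSup_le fun i => ?_
      rintro _ ⟨v, rfl⟩
      refine ⟨ψ.symm (degen T.X 0 i v), ?_, ψ.apply_symm_apply _⟩
      rw [hψ']
      exact (degreeMap_degen φ.inv 0 i v).symm ▸ degen_mem_degenerate S.X 0 i _
  let ψ₁ : NormTangent S.X 0 ≃ₗ[ℝ] NormTangent T.X 0 := Submodule.Quotient.equiv _ _ ψ hmap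
  refine ⟨ψ₁.trans φ₁, ψ₀.trans φ₀, fun x θ η => ?_, fun x θ => ?_⟩
  · obtain ⟨θ, rfl⟩ := Submodule.Quotient.mk_surjective _ θ
    obtain ⟨η, rfl⟩ := Submodule.Quotient.mk_surjective _ η
    rw [← hφ.pairingB_eq]
    exact hp _ _ _
  · obtain ⟨θ, rfl⟩ := Submodule.Quotient.mk_surjective _ θ
    refine (ha _ _).trans (congrArg φ₀ ?_)
    exact (degreeMap_tangentBoundary φ.hom θ).symm

theorem symplectic_equiv_iff {C : BundledConstantCourant.{u}}
    {S : ConstantSymplecticTwoGroupoid.{u}} : C.symplectic ≈ S ↔ Corresponds C S :=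
  ⟨fun h => (corresponds_symplectic C).of_equiv (Setoid.symm h),
    fun h => Setoid.symm h.equiv_symplectic⟩

/-- Every constant symplectic 2-groupoid corresponds to a constant Courant algebroid. -/
theorem exists_corresponds (S : ConstantSymplecticTwoGroupoid.{u}) :
    ∃ C : BundledConstantCourant.{u}, Corresponds C S := by
  -- Mark `S` tautologically by its own tangent spaces.
  let T : MarkedSymplecticTwoGroupoid (NormTangent S.X 0) (S.X _⦋0⦌) :=
    { S with mark₁ := LinearEquiv.refl ℝ _, mark₀ := LinearEquiv.refl ℝ _ }
  obtain ⟨E, hE⟩ := ConstantCourantAlgebroid.data_surjective T.data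
  refine ⟨{ W₁ := NormTangent S.X 0, W₀ := S.X _⦋0⦌, E := E },
    corresponds_iff_exists_hasData.mpr ⟨T, rfl, ?_⟩⟩
  change T.HasData E.data
  rw [hE]
  exact T.hasData

end ConstantCourant

open ConstantCourant
theorem theorem4p3 :
    (∀ (W₁ W₀ : Type u) [AddCommGroup W₁] [Module ℝ W₁] [FiniteDimensional ℝ W₁]
      [AddCommGroup W₀] [Module ℝ W₀] [FiniteDimensional ℝ W₀],
      ∃ (F : ConstantCourantAlgebroid W₁ W₀ ≃ IsotropicData W₁ W₀)
        (G : IsotropicData W₁ W₀ ≃ Quotient (MarkedSymplecticTwoGroupoid.setoid W₁ W₀)),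
        (∀ E x, (F E).pairing = E.pairing x ∧ (F E).del = E.anchor x) ∧
        ∀ (D : IsotropicData W₁ W₀) (S : MarkedSymplecticTwoGroupoid W₁ W₀), G D = ⟦S⟧ ↔
          (∀ x θ η, D.pairing (S.mark₁ θ) (S.mark₁ η) = pairingB S.X S.ω S.normalized x θ η) ∧
          ∀ θ, D.del (S.mark₁ θ) = S.mark₀ (tangentBoundary S.X θ)) ∧
    ∃ H : Quotient BundledConstantCourant.setoid.{u} ≃
        Quotient ConstantSymplecticTwoGroupoid.setoid.{u},
      ∀ (C : BundledConstantCourant.{u}) (S : ConstantSymplecticTwoGroupoid.{u}),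
        H ⟦C⟧ = ⟦S⟧ ↔ Corresponds C S := by
  refine ⟨fun W₁ W₀ _ _ _ _ _ _ => ?_, ?_⟩
  · have hG : ∀ (D : IsotropicData W₁ W₀) (S : MarkedSymplecticTwoGroupoid W₁ W₀),
        (⟦modelSymplectic D⟧ : Quotient (MarkedSymplecticTwoGroupoid.setoid W₁ W₀)) = ⟦S⟧
          ↔ S.HasData D := fun D S => Quotient.eq.trans equiv_modelSymplectic_iff
    refine ⟨Equiv.ofBijective ConstantCourantAlgebroid.data
        ⟨ConstantCourantAlgebroid.data_injective, ConstantCourantAlgebroid.data_surjective⟩,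
      Equiv.ofBijective (fun D => ⟦modelSymplectic D⟧) ⟨fun D D' h => ?_, fun q => ?_⟩,
      fun E x => ⟨E.data_pairing x, E.data_del x⟩, hG⟩
    -- If the models are equivalent, the model of `D'` carries both data, and a marked groupoid
    -- carries only one.
    · exact ((hG D _).mp h).unique (modelSymplectic_hasData D')
    · induction q using Quotient.inductionOn with
      | h S => exact ⟨S.data, (hG _ S).mpr S.hasData⟩
  · have hH : ∀ (C : BundledConstantCourant.{u}) (S : ConstantSymplecticTwoGroupoid.{u}),
        (⟦C.symplectic⟧ : Quotient ConstantSymplecticTwoGroupoid.setoid.{u}) = ⟦S⟧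
          ↔ Corresponds C S := fun C S => Quotient.eq.trans symplectic_equiv_iff
    let f : Quotient BundledConstantCourant.setoid.{u} →
        Quotient ConstantSymplecticTwoGroupoid.setoid.{u} :=
      -- Well defined because the groupoid of `C'` also corresponds to the isomorphic algebroid `C`,
      -- and `hH` turns this into equality of classes.
      Quotient.lift (fun C => ⟦C.symplectic⟧) fun C C' h =>
        (hH C _).mpr ((corresponds_symplectic C').of_iso (Setoid.symm h))
    refine ⟨Equiv.ofBijective f ⟨fun p q h => ?_, fun q => ?_⟩, hH⟩
    · induction p using Quotient.inductionOn with
      | h C =>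
        induction q using Quotient.inductionOn with
        | h C' =>
          exact Quotient.sound (((hH C _).mp h).iso (corresponds_symplectic C'))
    · induction q using Quotient.inductionOn with
      | h S =>
        obtain ⟨C, hC⟩ := exists_corresponds S
        exact ⟨⟦C⟧, (hH C S).mpr hC⟩
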